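/- We work over $\mathbb C$. Let $C$ be a smooth projective non-hyperelliptic curve of genus $g\ge 2$ (equivalently, $C\subseteq\mathbb P^{g-1}$ is a canonically embedded curve), with canonical divisor $K_C$ and canonical bundle $\omega_C$. Its Clifford index is $$\operatorname{Cliff}(C)=\min\{\deg D-2(h^0(C,D)-1)\;:\;D \text{ a divisor on } C,\ h^0(C,D)\ge 2,\ h^1(C,D)\ge 2\}$$ if $g\ge 4$, and $\operatorname{Cliff}(C)=1$ if $g=3$ (there are no non-hyperelliptic curves of genus $2$). For a nonzero linear subspace $W\subseteq H^0(C,\omega_C)$, let $D_W$ be the base locus of the linear system $|W|$, i.e. the effective divisor such that the evaluation map of $W$ is surjective onto $\omega_C(-D_W)$; put $\deg|W|=\deg\omega_C(-D_W)=\deg K_C-\deg D_W$, and let $\dim|W|=\dim_{\mathbb C}W-1$ be the projective dimension of $|W|$. Let $V\subseteq H^0(C,\omega_C)$ be a linear subspace of codimension $k\le g-2$, and set $m:=\min\{k,\operatorname{Cliff}(C)\}$. Then for every linear subspace $W\subseteq V$ with $\dim_{\mathbb C}W\ge 2$, $$\frac{\deg|W|}{\dim|W|}\ \ge\ \frac{2g-2-m}{g-m-1}.$$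 Moreover, if $k\le\operatorname{Cliff}(C)$, then $\deg|V|\ge 2g-2-k$, i.e. the base locus $D_V$ of $|V|$ has degree at most $k$. -/

import Mathlib

open CategoryTheory AlgebraicGeometry
open scoped KaehlerDifferential

noncomputable section

/-- A smooth projective (irreducible) curve over `ℂ`: an integral scheme which is proper and smooth
of relative dimension one over `Spec ℂ`. (Proper curves over a field are automatically
projective.) -/
structure SmoothCurve where
  /-- the underlying scheme -/
  X : Scheme.{0}
  /-- the structure morphism -/
  π : X ⟶ Spec (CommRingCat.of ℂ)
  [integral : IsIntegral X]
  [proper : IsProper π]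
  [smooth : SmoothOfRelativeDimension 1 π]

namespace SmoothCurve

attribute [instance] SmoothCurve.integral SmoothCurve.proper SmoothCurve.smooth

variable (C : SmoothCurve)

instance : IsLocallyNoetherian C.X := LocallyOfFiniteType.isLocallyNoetherian C.π

/-- The points of the curve `C`, i.e. the closed points of the scheme. -/
abbrev Point : Type := {x : C.X // IsClosed ({x} : Set C.X)}

/-- The function field `ℂ(C)`. -/
abbrev K : Type := C.X.functionField

/-- The local rings of `C` are `ℂ`-algebras through the structure morphism. -/
instance stalkAlgebra (x : C.X) : Algebra ℂ (C.X.presheaf.stalk x) :=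
  ((C.X.presheaf.germ ⊤ x trivial).hom.comp
    (C.π.appTop.hom.comp (Scheme.ΓSpecIso (CommRingCat.of ℂ)).inv.hom)).toAlgebra

instance (x : C.X) : IsScalarTower ℂ (C.X.presheaf.stalk x) C.K := by
  refine IsScalarTower.of_algebraMap_eq fun z => ?_
  have : Nonempty (⊤ : C.X.Opens) := ⟨⟨genericPoint C.X, trivial⟩⟩
  exact (Scheme.algebraMap_germ_eq_germToFunctionField (X := C.X) (U := ⊤) (x := x) trivial _).symm

/-- The local ring `𝒪_{C,x}`, as a subring of the function field. -/
def localRing (x : C.Point) : Subalgebra ℂ C.K :=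
  (IsScalarTower.toAlgHom ℂ (C.X.presheaf.stalk x.1) C.K).range

/-- Divisors on `C`. -/
abbrev Divisor : Type := C.Point →₀ ℤ

variable {C}

/-- The degree of a divisor (all points have residue field `ℂ`). -/
def degree (D : C.Divisor) : ℤ := D.sum fun _ n => n

variable (C)

/-! ### The invertible sheaves `𝒪_C(D)` and `ω_C(D)` -/

/-- The stalk of `𝒪_C(D)` at `x`, inside the function field: the `𝒪_{C,x}`-module generated by the
rational functions of order exactly `-D(x)` at `x` (the inverses of local equations of `D`). -/
def stalkO (D : C.Divisor) (x : C.Point) : Submodule (C.localRing x) C.K :=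
  Submodule.span (C.localRing x) {f | f ≠ 0 ∧ Scheme.ord f x.1 = -D x}

/-- The stalk of `ω_C(D)` at `x`, inside the rational differentials: it is generated over
`𝒪_{C,x}` by the `f • da` with `f` of order exactly `-D(x)` at `x` and `a ∈ 𝒪_{C,x}`. -/
def stalkω (D : C.Divisor) (x : C.Point) : Submodule (C.localRing x) Ω[C.K⁄ℂ] :=
  Submodule.span (C.localRing x)
    {η | ∃ f : C.K, ∃ a ∈ C.localRing x,
      f ≠ 0 ∧ Scheme.ord f x.1 = -D x ∧ η = f • KaehlerDifferential.D ℂ C.K a}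

/-- `H⁰(C, 𝒪_C(D))`. -/
def H0 (D : C.Divisor) : Submodule ℂ C.K := ⨅ x, (C.stalkO D x).restrictScalars ℂ

/-- `H⁰(C, ω_C)`: the rational differentials that are regular at every point. -/
def H0ω : Submodule ℂ Ω[C.K⁄ℂ] := ⨅ x, (C.stalkω 0 x).restrictScalars ℂ

/-- The répartitions: families of rational functions indexed by the points of `C`, almost all of
whose members are regular at their point. -/
def repartitions : Submodule ℂ (C.Point → C.K) where
  carrier := {a | {x | a x ∉ C.localRing x}.Finite}
  zero_mem' := by simp [zero_mem]
  add_mem' {a b} ha hb := by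
    refine (Set.Finite.union ha hb).subset fun x hx => ?_
    by_contra h
    simp only [Set.mem_union, Set.mem_ofPred_eq, not_or, not_not] at h
    exact hx (add_mem h.1 h.2)
  smul_mem' c a ha := ha.subset fun _ hx h => hx (Subalgebra.smul_mem _ h c)

/-- `H¹(C, 𝒪_C(D))`, computed by the flasque resolution
`0 → 𝒪_C(D) → ℂ(C) → ⨁_x ℂ(C) / 𝒪_C(D)_x → 0`: it is the quotient of the space of répartitions by
those lying in `𝒪_C(D)_x` at every `x`, and by the constant ones. -/
abbrev H1 (D : C.Divisor) : Type :=
  C.repartitions ⧸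
    ((Submodule.pi Set.univ fun x => (C.stalkO D x).restrictScalars ℂ).comap
        C.repartitions.subtype ⊔
      (LinearMap.range (LinearMap.pi fun _ : C.Point => (LinearMap.id : C.K →ₗ[ℂ] C.K))).comap
        C.repartitions.subtype)

/-- `h⁰(C, D)`. -/
def h0 (D : C.Divisor) : ℕ := Module.finrank ℂ (C.H0 D)

/-- `h¹(C, D)`. -/
def h1 (D : C.Divisor) : ℕ := Module.finrank ℂ (C.H1 D)

/-- The genus `g(C) = h⁰(C, ω_C)`. -/
def genus : ℕ := Module.finrank ℂ C.H0ω

/-- A curve is hyperelliptic if it has genus at least two and carries a `g¹₂`. -/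
def IsHyperelliptic : Prop := 2 ≤ C.genus ∧ ∃ D : C.Divisor, degree D = 2 ∧ 2 ≤ C.h0 D

open Classical in
/-- The Clifford index: for `g ≥ 4` it is the minimum of `deg D - 2 dim |D|`, where
`dim |D| = h⁰(D) - 1`, over all divisors with `h⁰(D) ≥ 2` and `h¹(D) ≥ 2`. In genus `3` it is `0` if
the curve is hyperelliptic and `1` otherwise; in genus `2` it is `0`. -/
def cliffordIndex : ℤ :=
  if 4 ≤ C.genus then
    sInf {c : ℤ | ∃ D : C.Divisor, 2 ≤ C.h0 D ∧ 2 ≤ C.h1 D ∧ c = degree D - 2 * ((C.h0 D : ℤ) - 1)}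
  else if C.genus = 3 ∧ ¬ C.IsHyperelliptic then 1
  else 0

/-! ### Canonical divisors, base loci, and degrees of linear systems -/

/-- The set `S` of rational differentials generates the subsheaf `ω_C(-D)` of the sheaf of rational
differentials. -/
def Generates (S : Set Ω[C.K⁄ℂ]) (D : C.Divisor) : Prop :=
  ∀ x : C.Point, Submodule.span (C.localRing x) S = C.stalkω (-D) x

/-- `D` is a canonical divisor, i.e. the divisor of some nonzero rational differential `η`:
`𝒪_C η = ω_C(-D)`. -/
def IsCanonicalDivisor (D : C.Divisor) : Prop := ∃ η : Ω[C.K⁄ℂ], η ≠ 0 ∧ C.Generates {η} D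

open Classical in
/-- A canonical divisor `K_C`. -/
def canonicalDivisor : C.Divisor :=
  if h : ∃ D, C.IsCanonicalDivisor D then h.choose else 0

variable {C}

/-- `D` is the base locus of the linear system `|W|`, `W ⊆ H⁰(C, ω_C)`: the image of the evaluation
morphism `W ⊗ 𝒪_C → ω_C` is `ω_C(-D)`. -/
def IsBaseLocus (W : Submodule ℂ C.H0ω) (D : C.Divisor) : Prop :=
  C.Generates ((↑) '' (W : Set C.H0ω)) D

open Classical in
/-- The base locus `D_W` of the linear system `|W|`. -/
def baseLocus (W : Submodule ℂ C.H0ω) : C.Divisor :=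
  if h : ∃ D, IsBaseLocus W D then h.choose else 0

/-- `deg |W| = deg ω_C(-D_W)`. -/
def degSystem (W : Submodule ℂ C.H0ω) : ℤ := degree C.canonicalDivisor - degree (baseLocus W)

/-- The projective dimension `dim |W| = dim W - 1`. -/
def dimSystem (W : Submodule ℂ C.H0ω) : ℤ := (Module.finrank ℂ W : ℤ) - 1

end SmoothCurve

end

/-!
The bound on the degree of a linear system `|W|` of canonical differentials comes from the divisor
`E = K_C - D_W`, which satisfies `deg E = deg |W|` and `h⁰(E) ≥ dim W` (`finrank_le_of_isBaseLocus`).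
If `h¹(E) ≥ 2`, then `E` contributes to the Clifford index, so that
`deg E ≥ 2 (h⁰(E) - 1) + Cliff(C)`; if `h¹(E) ≤ 1`, then `deg E ≥ h⁰(E) + g - 2` by the theorem of
Riemann–Roch. With `r = dim |W|`, this gives `deg |W| ≥ 2 r + Cliff(C)` or `deg |W| ≥ r + g - 1`
(`degSystem_ge`), and both claims follow by elementary inequalities from `r ≤ g - 1 - k`. That the
Clifford index is a minimum of nonnegative numbers is Clifford's theorem, and in genus three a divisor
with `h⁰, h¹ ≥ 2` is a `g¹₂`. What has to be built are the theorem of Riemann–Roch, Serre duality and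
Clifford's inequality.

These are proved for a `PlaceSystem`, a family of discrete valuations on a field `K` with the formal
properties of the points of a complete curve.

* The degree of the divisor of zeros of `x` is at most `[K : k(x)]` (`sum_zeros_le_finrank`), and the
  functions `xⁱ u`, `u` in a basis of `K` over `k(x)`, make the spaces `L(D)` large. Hence `H¹(0)`,
  a quotient of the adeles, is finite-dimensional, and `χ(D) = deg D + χ(0)` (`riemannRoch_aux`) since
  adding a point to `D` enlarges `A(D)` by one dimension.
* The residue of `a dg` is, following Tate, the trace of the commutator of the compressions of `a` and
  `g` to a space of adeles `A(D)`. It vanishes on principal adeles because multiplication by functions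
  commutes and preserves them (`tateResidue_eq_zero_of_preserves`), and it is computed at a single
  point by the trace of an operator that differs from a scalar by a nilpotent one
  (`tateResidue_local`). The resulting functional on the adeles (`exists_residue_functional`)
  identifies the dual of `H¹(D)` with `L(κ - D)`, where `κ` is the divisor of `dg` (`finrank_H1`);
  surjectivity is Weil's argument that two functionals are dependent over `K`, because their multiples
  would not fit into the dual of `H¹` of a very negative divisor.
* The orders of vanishing at a point of the functions in a space of dimension `n` form a set of `n`
  integers, so the bound `|S + T| ≥ |S| + |T| - 1` for finite sets of integers yields
  `h⁰(D) + h⁰(E) ≤ h⁰(D + E) + 1`, from which Clifford's inequality follows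
  (`finrank_L_add_finrank_L_le`).

It remains to see that a smooth complete curve gives a `PlaceSystem` (`SmoothCurve.places`). Smoothness
makes the differentials of the local rings free of rank one, which forces their maximal ideals to be
principal; separatedness distinguishes the local rings of different points; and properness makes
functions without poles constant. Writing all differentials as multiples of a fixed `dg` then turns
the sheaf `ω_C`, canonical divisors and base loci into statements about orders of functions
(`stalkω_eq_map_smulD`, `generates_iff`).
-/

/-! ### Traces of finite-rank operators -/

section FiniteRank

variable {k : Type*} [Field k]
variable {V W U : Type*} [AddCommGroup V] [Module k V] [AddCommGroup W] [Module k W]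
  [AddCommGroup U] [Module k U]

/-- A linear map of finite rank. -/
def IsFiniteRank (f : V →ₗ[k] W) : Prop := FiniteDimensional k (LinearMap.range f)

namespace IsFiniteRank

lemma of_range_le {f : V →ₗ[k] W} (M : Submodule k W) [FiniteDimensional k M]
    (h : ∀ x, f x ∈ M) : IsFiniteRank f :=
  Submodule.finiteDimensional_of_le (S₂ := M) (by rintro _ ⟨x, rfl⟩; exact h x)

lemma zero : IsFiniteRank (0 : V →ₗ[k] W) := of_range_le ⊥ (by simp)

lemma add {f g : V →ₗ[k] W} (hf : IsFiniteRank f) (hg : IsFiniteRank g) : IsFiniteRank (f + g) := by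
  have := hf; have := hg
  unfold IsFiniteRank at hf hg
  exact of_range_le (LinearMap.range f ⊔ LinearMap.range g)
    fun x => Submodule.add_mem_sup ⟨x, rfl⟩ ⟨x, rfl⟩

lemma neg {f : V →ₗ[k] W} (hf : IsFiniteRank f) : IsFiniteRank (-f) := by
  unfold IsFiniteRank at hf
  exact of_range_le (LinearMap.range f) fun x => neg_mem ⟨x, rfl⟩

lemma sub {f g : V →ₗ[k] W} (hf : IsFiniteRank f) (hg : IsFiniteRank g) : IsFiniteRank (f - g) := by
  rw [sub_eq_add_neg]; exact hf.add hg.neg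

lemma comp_left {f : V →ₗ[k] W} (hf : IsFiniteRank f) (g : W →ₗ[k] U) :
    IsFiniteRank (g ∘ₗ f) := by
  unfold IsFiniteRank at hf
  exact of_range_le ((LinearMap.range f).map g) fun x => ⟨f x, ⟨x, rfl⟩, rfl⟩

lemma comp_right {f : W →ₗ[k] U} (hf : IsFiniteRank f) (g : V →ₗ[k] W) :
    IsFiniteRank (f ∘ₗ g) := by
  unfold IsFiniteRank at hf
  exact of_range_le (LinearMap.range f) fun x => ⟨g x, rfl⟩

lemma of_finiteDimensional_domain [FiniteDimensional k V] (f : V →ₗ[k] W) : IsFiniteRank f := by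
  unfold IsFiniteRank; infer_instance

end IsFiniteRank

/-- The trace of an endomorphism of finite rank of a vector space of arbitrary dimension: the
trace of its restriction to its range. (It is `0` for endomorphisms of infinite rank.) -/
noncomputable def finiteRankTrace (f : V →ₗ[k] V) : k :=
  LinearMap.trace k (LinearMap.range f) (f.restrict fun x _ => ⟨x, rfl⟩)

/-- The trace may be computed on any finite-dimensional subspace that contains the range. -/
lemma finiteRankTrace_eq (f : V →ₗ[k] V) (M : Submodule k V) [FiniteDimensional k M]
    (h : ∀ x, f x ∈ M) :
    finiteRankTrace f = LinearMap.trace k M (f.restrict fun x _ => h x) := by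
  set N : Submodule k M := (LinearMap.range f).comap M.subtype with hN
  have key := LinearMap.trace_restrict_eq_of_forall_mem N (f.restrict fun x (_ : x ∈ M) => h x)
    (fun x => ⟨x.1, rfl⟩)
  rw [← key]
  have hle : LinearMap.range f ≤ M := by rintro _ ⟨x, rfl⟩; exact h x
  let e : N ≃ₗ[k] LinearMap.range f := Submodule.comapSubtypeEquivOfLe hle
  rw [finiteRankTrace, ← LinearMap.trace_conj' _ e]
  congr 1

lemma finiteRankTrace_eq_trace [FiniteDimensional k V] (f : V →ₗ[k] V) :
    finiteRankTrace f = LinearMap.trace k V f :=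
  LinearMap.trace_restrict_eq_of_forall_mem (LinearMap.range f) f fun x => ⟨x, rfl⟩

lemma finiteRankTrace_add {f g : V →ₗ[k] V} (hf : IsFiniteRank f) (hg : IsFiniteRank g) :
    finiteRankTrace (f + g) = finiteRankTrace f + finiteRankTrace g := by
  unfold IsFiniteRank at hf hg
  let M := LinearMap.range f ⊔ LinearMap.range g
  have hf' : ∀ x, f x ∈ M := fun x => Submodule.mem_sup_left ⟨x, rfl⟩
  have hg' : ∀ x, g x ∈ M := fun x => Submodule.mem_sup_right ⟨x, rfl⟩
  rw [finiteRankTrace_eq f M hf', finiteRankTrace_eq g M hg',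
    finiteRankTrace_eq (f + g) M fun x => add_mem (hf' x) (hg' x), ← map_add]
  congr 1

lemma finiteRankTrace_smul {f : V →ₗ[k] V} (c : k) (hf : IsFiniteRank f) :
    finiteRankTrace (c • f) = c * finiteRankTrace f := by
  unfold IsFiniteRank at hf
  have hf' : ∀ x, f x ∈ LinearMap.range f := fun x => ⟨x, rfl⟩
  rw [finiteRankTrace_eq f (LinearMap.range f) hf',
    finiteRankTrace_eq (c • f) (LinearMap.range f) fun x => Submodule.smul_mem _ c (hf' x),
    ← smul_eq_mul, ← map_smul]
  congr 1

lemma finiteRankTrace_zero : finiteRankTrace (0 : V →ₗ[k] V) = 0 := by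
  simpa using finiteRankTrace_smul (0 : k) (IsFiniteRank.zero (k := k) (V := V) (W := V))

lemma finiteRankTrace_neg {f : V →ₗ[k] V} (hf : IsFiniteRank f) :
    finiteRankTrace (-f) = -finiteRankTrace f := by
  have := finiteRankTrace_smul (-1) hf
  simpa using this

lemma finiteRankTrace_sub {f g : V →ₗ[k] V} (hf : IsFiniteRank f) (hg : IsFiniteRank g) :
    finiteRankTrace (f - g) = finiteRankTrace f - finiteRankTrace g := by
  rw [sub_eq_add_neg, finiteRankTrace_add hf hg.neg, finiteRankTrace_neg hg, sub_eq_add_neg]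

lemma finiteRankTrace_comp_comm {f : V →ₗ[k] W} (hf : IsFiniteRank f) (g : W →ₗ[k] V) :
    finiteRankTrace (g ∘ₗ f) = finiteRankTrace (f ∘ₗ g) := by
  unfold IsFiniteRank at hf
  let M := LinearMap.range f
  let N := M.map g
  have hM : ∀ x, f x ∈ M := fun x => ⟨x, rfl⟩
  have hN : ∀ x ∈ M, g x ∈ N := fun x hx => ⟨x, hx, rfl⟩
  rw [finiteRankTrace_eq (g ∘ₗ f) N fun x => hN _ (hM x),
    finiteRankTrace_eq (f ∘ₗ g) M fun x => hM _]
  exact LinearMap.trace_comp_comm' (f.restrict (p := N) (q := M) fun x _ => hM x) (g.restrict hN)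

/-- The trace of a finite-rank operator which kills a subspace of finite codimension may be computed
on the quotient. -/
lemma finiteRankTrace_eq_trace_quotient (f : V →ₗ[k] V) (M : Submodule k V)
    [FiniteDimensional k (V ⧸ M)] (h : M ≤ LinearMap.ker f) :
    finiteRankTrace f = LinearMap.trace k (V ⧸ M) (M.mkQ ∘ₗ M.liftQ f h) := by
  rw [← finiteRankTrace_eq_trace,
    finiteRankTrace_comp_comm (IsFiniteRank.of_finiteDimensional_domain _), Submodule.liftQ_mkQ]

/-- The commutator of finite-rank perturbations of two commuting operators has trace zero. -/
lemma finiteRankTrace_commutator_eq_zero {X X' Y Y' : V →ₗ[k] V} (h : IsFiniteRank (X - Y))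
    (h' : IsFiniteRank (X' - Y')) (hY : Y ∘ₗ Y' = Y' ∘ₗ Y) :
    finiteRankTrace (X ∘ₗ X' - X' ∘ₗ X) = 0 := by
  set F := X - Y with hF
  set G := X' - Y' with hG
  have e1 : X = Y + F := by simp [hF]
  have e2 : X' = Y' + G := by simp [hG]
  have e : X ∘ₗ X' - X' ∘ₗ X = (Y ∘ₗ G - G ∘ₗ Y) + (F ∘ₗ X' - X' ∘ₗ F) := by
    have : X ∘ₗ X' - X' ∘ₗ X = (Y ∘ₗ Y' - Y' ∘ₗ Y) + (Y ∘ₗ G - G ∘ₗ Y) + (F ∘ₗ X' - X' ∘ₗ F) := by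
      rw [e1, e2]; simp only [LinearMap.add_comp, LinearMap.comp_add]; abel
    rw [this, hY, sub_self, zero_add]
  rw [e, finiteRankTrace_add ((h'.comp_left Y).sub (h'.comp_right Y))
    ((h.comp_right X').sub (h.comp_left X')),
    finiteRankTrace_sub (h'.comp_left Y) (h'.comp_right Y),
    finiteRankTrace_sub (h.comp_right X') (h.comp_left X'),
    finiteRankTrace_comp_comm h' Y, finiteRankTrace_comp_comm h X']
  simp

end FiniteRank

/-! ### Toeplitz operators and the abstract residue -/

section Toeplitz

variable {k : Type*} [Field k] {R : Type*} [CommRing R] [Algebra k R]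

/-- The Toeplitz operator `x ↦ P (a x)` on a subspace `E` of a commutative algebra `R`, where `P` is
a projection of `R` onto `E`. -/
noncomputable def toeplitz {E : Submodule k R} (P : R →ₗ[k] E) (a : R) : E →ₗ[k] E :=
  P ∘ₗ LinearMap.mulLeft k a ∘ₗ E.subtype

/-- Multiplication by `a` maps `E` into `E` up to finite dimension: `(E + a E) / E` is
finite-dimensional. -/
def AlmostPreserves (E : Submodule k R) (a : R) : Prop :=
  IsFiniteRank (E.mkQ ∘ₗ LinearMap.mulLeft k a ∘ₗ E.subtype)

/-- Tate's residue of `a dg` with respect to `E`, as the trace of the commutator of the Toeplitz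
operators of `a` and `g`. It is meaningful if the commutator has finite rank, for instance if `a` and
`g` almost preserve `E`. -/
noncomputable def tateResidue {E : Submodule k R} (P : R →ₗ[k] E) (a g : R) : k :=
  finiteRankTrace (toeplitz P a ∘ₗ toeplitz P g - toeplitz P g ∘ₗ toeplitz P a)

variable {E : Submodule k R} {P : R →ₗ[k] E}

@[simp] lemma toeplitz_apply (a : R) (x : E) : toeplitz P a x = P (a * x) := rfl

lemma toeplitz_add (a b : R) : toeplitz P (a + b) = toeplitz P a + toeplitz P b := by
  ext x; simp [add_mul]

lemma toeplitz_smul (c : k) (a : R) : toeplitz P (c • a) = c • toeplitz P a := by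
  ext x; simp

/-- The part of `a x`, `x ∈ E`, that a projection onto `E` forgets depends on `x` through a
finite-rank operator. -/
lemma AlmostPreserves.isFiniteRank (hP : ∀ x : E, P x = x) {a : R} (ha : AlmostPreserves E a) :
    IsFiniteRank ((LinearMap.id - E.subtype ∘ₗ P) ∘ₗ LinearMap.mulLeft k a ∘ₗ E.subtype) := by
  have hle : E ≤ LinearMap.ker (LinearMap.id - E.subtype ∘ₗ P) := by
    intro x hx
    have := hP ⟨x, hx⟩
    simp [LinearMap.mem_ker, this]
  have : (LinearMap.id - E.subtype ∘ₗ P) ∘ₗ LinearMap.mulLeft k a ∘ₗ E.subtype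
      = E.liftQ _ hle ∘ₗ (E.mkQ ∘ₗ LinearMap.mulLeft k a ∘ₗ E.subtype) := by
    ext x; simp
  rw [this]
  exact IsFiniteRank.comp_left ha _

/-- The map from functions to Toeplitz operators is multiplicative up to finite rank. -/
lemma toeplitz_comp_sub (hP : ∀ x : E, P x = x) (a : R) {g : R} (hg : AlmostPreserves E g) :
    IsFiniteRank (toeplitz P (a * g) - toeplitz P a ∘ₗ toeplitz P g) := by
  have : toeplitz P (a * g) - toeplitz P a ∘ₗ toeplitz P g = (P ∘ₗ LinearMap.mulLeft k a) ∘ₗ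
      ((LinearMap.id - E.subtype ∘ₗ P) ∘ₗ LinearMap.mulLeft k g ∘ₗ E.subtype) := by
    ext x; simp [mul_sub, mul_assoc]
  rw [this]
  exact (hg.isFiniteRank hP).comp_left _

lemma isFiniteRank_toeplitz_commutator (hP : ∀ x : E, P x = x) {a g : R}
    (ha : AlmostPreserves E a) (hg : AlmostPreserves E g) :
    IsFiniteRank (toeplitz P a ∘ₗ toeplitz P g - toeplitz P g ∘ₗ toeplitz P a) := by
  have := (toeplitz_comp_sub hP g ha).sub (toeplitz_comp_sub hP a hg)
  rw [mul_comm a g] at this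
  convert this using 1
  abel

lemma tateResidue_add (hP : ∀ x : E, P x = x) {a b g : R} (ha : AlmostPreserves E a)
    (hb : AlmostPreserves E b) (hg : AlmostPreserves E g) :
    tateResidue P (a + b) g = tateResidue P a g + tateResidue P b g := by
  rw [tateResidue, tateResidue, tateResidue, ← finiteRankTrace_add
    (isFiniteRank_toeplitz_commutator hP ha hg) (isFiniteRank_toeplitz_commutator hP hb hg)]
  congr 1
  simp only [toeplitz_add, LinearMap.add_comp, LinearMap.comp_add]
  abel

lemma tateResidue_smul (hP : ∀ x : E, P x = x) (c : k) {a g : R} (ha : AlmostPreserves E a)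
    (hg : AlmostPreserves E g) : tateResidue P (c • a) g = c * tateResidue P a g := by
  rw [tateResidue, tateResidue, ← finiteRankTrace_smul c
    (isFiniteRank_toeplitz_commutator hP ha hg)]
  congr 1
  simp only [toeplitz_smul, LinearMap.smul_comp, LinearMap.comp_smul]
  ext x
  simpa using (smul_sub c (P (a * (P (g * x.1)).1) : R) (P (g * (P (a * x.1)).1) : R)).symm

/-- The residue theorem: if `R = E + K` with `E ∩ K` finite-dimensional, then the residue of `f dg`
vanishes whenever `f` and `g` preserve `K`. The Toeplitz operators differ by finite-rank operators
from those of a projection with kernel `K`, and the latter commute. -/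
lemma tateResidue_eq_zero_of_preserves (hP : ∀ x : E, P x = x) (K : Submodule k R)
    (hsup : E ⊔ K = ⊤) [hfin : FiniteDimensional k ↥(E ⊓ K)] {f g : R}
    (hf : AlmostPreserves E f) (hg : AlmostPreserves E g)
    (hfK : ∀ x ∈ K, f * x ∈ K) (hgK : ∀ x ∈ K, g * x ∈ K) : tateResidue P f g = 0 := by
  obtain ⟨S, hSE, hSK⟩ : ∃ S ≤ E, IsCompl S K := by
    obtain ⟨S', hS'⟩ := Submodule.exists_isCompl ((E ⊓ K).comap E.subtype)
    refine ⟨S'.map E.subtype, Submodule.map_subtype_le _ _, ?_, ?_⟩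
    · rw [Submodule.disjoint_def]
      rintro _ ⟨x, hx, rfl⟩ hxK
      have := Submodule.disjoint_def.mp hS'.disjoint x ⟨x.2, hxK⟩ hx
      simp [this]
    · rw [codisjoint_iff, eq_top_iff, ← hsup]
      refine sup_le ?_ le_sup_right
      intro x hx
      have : (⟨x, hx⟩ : E) ∈ (E ⊓ K).comap E.subtype ⊔ S' := by rw [hS'.sup_eq_top]; trivial
      obtain ⟨y, hy, z, hz, h⟩ := Submodule.mem_sup.mp this
      have h' : (y : R) + z = x := congrArg Subtype.val h
      rw [← h', add_comm]
      exact Submodule.add_mem_sup ⟨z, hz, rfl⟩ hy.2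
  set Q : R →ₗ[k] R := S.subtype ∘ₗ Submodule.projectionOnto S K hSK with hQ
  have hQS : ∀ x, Q x ∈ S := fun x => (Submodule.projectionOnto S K hSK x).2
  have hQK : ∀ x ∈ K, Q x = 0 := fun x hx => by
    simp [hQ, (Submodule.projectionOnto_apply_eq_zero_iff hSK).mpr hx]
  have hQid : ∀ x ∈ S, Q x = x := fun x hx => by
    have := Submodule.projectionOnto_apply_left hSK ⟨x, hx⟩
    simp [hQ, this]
  have hsubQ : ∀ x, x - Q x ∈ K := fun x => by
    have h0 : Submodule.projectionOnto S K hSK (x - Q x) = 0 := by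
      apply Subtype.ext
      have : Q (x - Q x) = 0 := by rw [map_sub, hQid _ (hQS x), sub_self]
      exact this
    exact (Submodule.projectionOnto_apply_eq_zero_iff hSK).mp h0
  -- `Y a` is the compression of `a` by `Q`, restricted to `E`
  let QE : R →ₗ[k] E := Q.codRestrict E fun x => hSE (hQS x)
  have hQE : ∀ x, (QE x : R) = Q x := fun x => rfl
  let Y : R → (E →ₗ[k] E) := fun a => QE ∘ₗ LinearMap.mulLeft k a ∘ₗ Q ∘ₗ E.subtype
  have hYapp : ∀ a (x : E), (Y a x : R) = Q (a * Q x) := fun a x => rfl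
  have hYY : ∀ a b : R, (∀ x ∈ K, a * x ∈ K) → Y a ∘ₗ Y b = Y (a * b) := by
    intro a b ha
    ext x
    simp only [LinearMap.comp_apply, hYapp]
    have h1 : Q (Q (b * Q x)) = Q (b * Q x) := hQid _ (hQS _)
    rw [h1, ← sub_eq_zero, ← map_sub]
    apply hQK
    have := ha _ (hsubQ (b * Q x))
    rw [← neg_mem_iff]
    convert this using 1
    ring
  have hN : IsFiniteRank (LinearMap.id - QE ∘ₗ E.subtype : E →ₗ[k] E) := by
    have : FiniteDimensional k ((E ⊓ K).comap E.subtype) :=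
      LinearEquiv.finiteDimensional (Submodule.comapSubtypeEquivOfLe (inf_le_left)).symm
    exact IsFiniteRank.of_range_le ((E ⊓ K).comap E.subtype)
      fun x => ⟨((LinearMap.id - QE ∘ₗ E.subtype : E →ₗ[k] E) x).2, hsubQ x⟩
  have hsub : ∀ a, AlmostPreserves E a → IsFiniteRank (toeplitz P a - Y a) := by
    intro a ha
    have e : toeplitz P a - Y a
        = (P ∘ₗ LinearMap.mulLeft k a ∘ₗ E.subtype) ∘ₗ (LinearMap.id - QE ∘ₗ E.subtype)
        + ((LinearMap.id - QE ∘ₗ E.subtype) ∘ₗ P ∘ₗ LinearMap.mulLeft k a ∘ₗ Q ∘ₗ E.subtype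
        - QE ∘ₗ ((LinearMap.id - E.subtype ∘ₗ P) ∘ₗ LinearMap.mulLeft k a ∘ₗ E.subtype) ∘ₗ
          (QE ∘ₗ E.subtype)) := by
      ext x
      simp [hQE, hYapp, mul_sub]
    rw [e]
    exact (hN.comp_left _).add ((hN.comp_right _).sub
      (((ha.isFiniteRank hP).comp_right _).comp_left _))
  refine finiteRankTrace_commutator_eq_zero (hsub f hf) (hsub g hg) ?_
  rw [hYY f g hfK, hYY g f hgK, mul_comm]

end Toeplitz

/-! ### Complete curves as systems of discrete valuations -/

/-- The data of a smooth complete curve over `k` with `k`-rational points, seen from its function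
field `K`: a family of normalised discrete valuations `v p` of `K`, trivial on `k` and with residue
field `k`, such that every nonzero function has finitely many zeros and poles, no valuation ring
contains another one, and the functions without poles are constant. The value `v p 0` is
meaningless. -/
structure PlaceSystem (k K P : Type*) [Field k] [Field K] [Algebra k K] where
  /-- the order of a nonzero function at a point -/
  v : P → K → ℤ
  v_mul' : ∀ p f g, f ≠ 0 → g ≠ 0 → v p (f * g) = v p f + v p g
  v_add' : ∀ p f g, f ≠ 0 → g ≠ 0 → f + g ≠ 0 → min (v p f) (v p g) ≤ v p (f + g)
  v_algebraMap' : ∀ p (c : k), c ≠ 0 → v p (algebraMap k K c) = 0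
  exists_uniformizer : ∀ p, ∃ t ≠ 0, v p t = 1
  exists_residue : ∀ p f, f ≠ 0 → v p f = 0 →
    ∃ c : k, f - algebraMap k K c ≠ 0 → 0 < v p (f - algebraMap k K c)
  finite_support : ∀ f ≠ 0, {p | v p f ≠ 0}.Finite
  separated : ∀ p q, p ≠ q → ∃ f ≠ 0, 0 ≤ v p f ∧ v q f < 0
  eq_const : ∀ f, (∀ p, f ≠ 0 → 0 ≤ v p f) → ∃ c : k, algebraMap k K c = f

/-- Induction on divisors by adding and removing points. -/
lemma Finsupp.divisor_induction {P : Type*} {C : (P →₀ ℤ) → Prop} (h0 : C 0)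
    (step : ∀ D p, C D ↔ C (D + Finsupp.single p 1)) (D : P →₀ ℤ) : C D := by
  have key : ∀ (n : ℤ) p (D : P →₀ ℤ), C D → C (D + Finsupp.single p n) := by
    intro n p
    induction n using Int.induction_on with
    | zero => intro D h; simpa using h
    | succ i ih =>
      intro D h
      rw [Finsupp.single_add, ← add_assoc, ← step]
      exact ih D h
    | pred i ih =>
      intro D h
      rw [step _ p, add_assoc, ← Finsupp.single_add, sub_add_cancel]
      exact ih D h
  induction D using Finsupp.induction with
  | zero => exact h0
  | single_add p n D _ _ ih => rw [add_comm]; exact key n p D ih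

/-- Induction on effective divisors by adding points. -/
lemma Finsupp.effective_induction {P : Type*} {C : (P →₀ ℤ) → Prop} (h0 : C 0)
    (step : ∀ D p, 0 ≤ D → C D → C (D + Finsupp.single p 1)) (D : P →₀ ℤ) (hD : 0 ≤ D) : C D := by
  have key : ∀ (n : ℕ) p (D : P →₀ ℤ), 0 ≤ D → C D → C (D + Finsupp.single p (n : ℤ)) := by
    intro n p
    induction n with
    | zero => intro D _ h; simpa using h
    | succ i ih =>
      intro D h0 h
      rw [Nat.cast_succ, Finsupp.single_add, ← add_assoc]
      refine step _ _ (add_nonneg h0 (by simp)) (ih D h0 h)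
  induction D using Finsupp.induction with
  | zero => exact h0
  | single_add p n D hp hn ih =>
    classical
    have h1 : 0 ≤ D := by
      intro q
      by_cases hq : q = p
      · subst hq; simp [Finsupp.notMem_support_iff.mp hp]
      · have := hD q
        simpa [Finsupp.single_apply, Ne.symm hq] using this
    have h2 : 0 ≤ n := by
      have := hD p
      simpa [Finsupp.notMem_support_iff.mp hp] using this
    lift n to ℕ using h2
    rw [add_comm]
    exact key n p D h1 (ih h1)

namespace PlaceSystem

variable {k K P : Type*} [Field k] [Field K] [Algebra k K] (S : PlaceSystem k K P)

lemma v_mul (p : P) {f g : K} (hf : f ≠ 0) (hg : g ≠ 0) : S.v p (f * g) = S.v p f + S.v p g :=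
  S.v_mul' p f g hf hg

@[simp] lemma v_one (p : P) : S.v p 1 = 0 := by
  have := S.v_mul p one_ne_zero (one_ne_zero (α := K))
  rw [mul_one] at this
  omega

lemma v_neg (p : P) (f : K) : S.v p (-f) = S.v p f := by
  by_cases hf : f = 0
  · simp [hf]
  have h1 : S.v p (-1) = 0 := by
    have := S.v_mul p (neg_ne_zero.mpr one_ne_zero) (neg_ne_zero.mpr (one_ne_zero (α := K)))
    simp at this
    omega
  rw [neg_eq_neg_one_mul, S.v_mul p (neg_ne_zero.mpr one_ne_zero) hf, h1, zero_add]

lemma v_inv (p : P) {f : K} (hf : f ≠ 0) : S.v p f⁻¹ = -S.v p f := by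
  have := S.v_mul p hf (inv_ne_zero hf)
  rw [mul_inv_cancel₀ hf, v_one] at this
  omega

lemma v_div (p : P) {f g : K} (hf : f ≠ 0) (hg : g ≠ 0) : S.v p (f / g) = S.v p f - S.v p g := by
  rw [div_eq_mul_inv, S.v_mul p hf (inv_ne_zero hg), S.v_inv p hg, sub_eq_add_neg]

lemma v_pow (p : P) {f : K} (hf : f ≠ 0) (n : ℕ) : S.v p (f ^ n) = n * S.v p f := by
  induction n with
  | zero => simp
  | succ n ih => rw [pow_succ, S.v_mul p (pow_ne_zero n hf) hf, ih]; push_cast; ring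

/-- The functions of order at least `n` at `p`, including the zero function. -/
def F (p : P) (n : ℤ) : Submodule k K where
  carrier := {f | f ≠ 0 → n ≤ S.v p f}
  zero_mem' := fun h => absurd rfl h
  add_mem' {f g} hf hg := by
    intro h
    by_cases hf0 : f = 0
    · subst hf0; rw [zero_add] at h ⊢; exact hg h
    by_cases hg0 : g = 0
    · subst hg0; rw [add_zero] at h ⊢; exact hf h
    exact le_trans (le_min (hf hf0) (hg hg0)) (S.v_add' p f g hf0 hg0 h)
  smul_mem' c f hf := by
    intro h
    rw [Algebra.smul_def] at h ⊢
    have hc : c ≠ 0 := by rintro rfl; simp at h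
    have hf0 : f ≠ 0 := by rintro rfl; simp at h
    have hc' : algebraMap k K c ≠ 0 := by simpa using hc
    rw [S.v_mul p hc' hf0, S.v_algebraMap' p c hc, zero_add]
    exact hf hf0

variable {S}

lemma mem_F_of_ne {p : P} {n : ℤ} {f : K} (hf : f ≠ 0) : f ∈ S.F p n ↔ n ≤ S.v p f :=
  ⟨fun h => h hf, fun h _ => h⟩

lemma F_anti (p : P) {m n : ℤ} (h : m ≤ n) : S.F p n ≤ S.F p m := fun _ hf h0 => h.trans (hf h0)

lemma mem_F_v (p : P) (f : K) : f ∈ S.F p (S.v p f) := fun _ => le_rfl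

lemma mul_mem_F {p : P} {m n : ℤ} {f g : K} (hf : f ∈ S.F p m) (hg : g ∈ S.F p n) :
    f * g ∈ S.F p (m + n) := by
  intro h
  have h1 := left_ne_zero_of_mul h
  have h2 := right_ne_zero_of_mul h
  rw [S.v_mul p h1 h2]
  exact add_le_add (hf h1) (hg h2)

lemma mul_mem_F' {p : P} {m n l : ℤ} {f g : K} (hf : f ∈ S.F p m) (hg : g ∈ S.F p n)
    (h : l ≤ m + n) : f * g ∈ S.F p l := F_anti p h (mul_mem_F hf hg)

lemma one_mem_F (p : P) : (1 : K) ∈ S.F p 0 := fun _ => by simp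

lemma algebraMap_mem_F (p : P) (c : k) : algebraMap k K c ∈ S.F p 0 := by
  rw [Algebra.algebraMap_eq_smul_one]; exact Submodule.smul_mem _ _ (one_mem_F p)

lemma pow_mem_F {p : P} {f : K} (hf : f ∈ S.F p 0) (n : ℕ) : f ^ n ∈ S.F p 0 := by
  induction n with
  | zero => simpa using one_mem_F p
  | succ n ih => rw [pow_succ]; exact mul_mem_F' ih hf (by simp)

lemma notMem_F_of_v {p : P} {f : K} (hf : f ≠ 0) {n : ℤ} (h : S.v p f < n) : f ∉ S.F p n :=
  fun h' => absurd (h' hf) (by omega)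

lemma add_ne_zero_of_v_lt {p : P} {f g : K} (hf : f ≠ 0) (hg : g ∈ S.F p (S.v p f + 1)) :
    f + g ≠ 0 := by
  intro h
  rw [eq_neg_of_add_eq_zero_right h] at hg
  have := hg (neg_ne_zero.mpr hf)
  rw [v_neg] at this
  omega

lemma v_add_of_lt {p : P} {f g : K} (hf : f ≠ 0) (hg : g ∈ S.F p (S.v p f + 1)) :
    S.v p (f + g) = S.v p f := by
  have h0 := add_ne_zero_of_v_lt hf hg
  apply le_antisymm
  · by_contra! h
    have : f ∈ S.F p (S.v p f + 1) := by
      have h2 : f + g ∈ S.F p (S.v p f + 1) := fun _ => h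
      simpa using sub_mem h2 hg
    exact notMem_F_of_v hf (by omega) this
  · exact (add_mem (mem_F_v p f) (F_anti p (by omega) hg) : f + g ∈ S.F p (S.v p f)) h0

variable (S)

lemma exists_v_eq (p : P) (n : ℤ) : ∃ e ≠ 0, S.v p e = n := by
  obtain ⟨t, ht, h1⟩ := S.exists_uniformizer p
  obtain ⟨m, rfl | rfl⟩ := n.eq_nat_or_neg
  · exact ⟨t ^ m, pow_ne_zero _ ht, by simp [S.v_pow p ht, h1]⟩
  · exact ⟨(t ^ m)⁻¹, inv_ne_zero (pow_ne_zero _ ht), by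
      simp [S.v_inv p (pow_ne_zero _ ht), S.v_pow p ht, h1]⟩

variable {S}

/-- Since the residue field is `k`, the quotient of `F p n` by `F p (n + 1)` is spanned by the class
of any function of order `n`. -/
lemma exists_sub_smul_mem {p : P} {n : ℤ} {e f : K} (he : e ≠ 0) (hn : S.v p e = n)
    (hf : f ∈ S.F p n) : ∃ c : k, f - c • e ∈ S.F p (n + 1) := by
  by_cases h : f ∈ S.F p (n + 1)
  · exact ⟨0, by simpa using h⟩
  have hf0 : f ≠ 0 := by rintro rfl; exact h (zero_mem _)
  have hv : S.v p f = n := by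
    have h1 := hf hf0
    rw [mem_F_of_ne hf0] at h
    omega
  have hfe : f / e ≠ 0 := div_ne_zero hf0 he
  obtain ⟨c, hc⟩ := S.exists_residue p (f / e) hfe (by rw [S.v_div p hf0 he]; omega)
  refine ⟨c, ?_⟩
  have : f - c • e = e * (f / e - algebraMap k K c) := by
    rw [Algebra.smul_def]; field_simp
  rw [this]
  exact mul_mem_F (hn ▸ mem_F_v p e) (fun h => hc h)

lemma exists_sub_algebraMap_mem {p : P} {f : K} (hf : f ∈ S.F p 0) :
    ∃ c : k, f - algebraMap k K c ∈ S.F p 1 := by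
  obtain ⟨c, hc⟩ := exists_sub_smul_mem (one_ne_zero) (S.v_one p) hf
  exact ⟨c, by simpa [Algebra.algebraMap_eq_smul_one] using hc⟩

/-! ### Approximation -/

variable (S)

lemma exists_pos_neg {p q : P} (h : p ≠ q) : ∃ f ≠ 0, 0 < S.v p f ∧ S.v q f < 0 := by
  obtain ⟨f, hf, h1, h2⟩ := S.separated p q h
  obtain ⟨g, hg, h3, h4⟩ := S.separated q p h.symm
  refine ⟨f / g, div_ne_zero hf hg, ?_, ?_⟩ <;> rw [S.v_div _ hf hg] <;> omega

lemma exists_pos_forall_neg (p : P) (T : Finset P) (hp : p ∉ T) :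
    ∃ f ≠ 0, 0 < S.v p f ∧ ∀ q ∈ T, S.v q f < 0 := by
  classical
  induction T using Finset.induction_on with
  | empty =>
    obtain ⟨t, ht, h1⟩ := S.exists_uniformizer p
    exact ⟨t, ht, by omega, by simp⟩
  | insert q T hq ih =>
    rw [Finset.mem_insert, not_or] at hp
    obtain ⟨h, h0, h1, h2⟩ := ih hp.2
    obtain ⟨g, g0, g1, g2⟩ := S.exists_pos_neg hp.1
    -- a power of `g` so large that its poles on `insert q T` dominate the values of `h`
    set r : ℕ := 1 + ∑ s ∈ insert q T, (S.v s h).natAbs with hr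
    have hbig : ∀ s ∈ insert q T, S.v s g < 0 → S.v s (g ^ r) < S.v s h := by
      intro s hs hneg
      have h3 : (S.v s h).natAbs ≤ ∑ s ∈ insert q T, (S.v s h).natAbs :=
        Finset.single_le_sum (f := fun s => (S.v s h).natAbs) (fun _ _ => Nat.zero_le _) hs
      rw [S.v_pow s g0]
      have h4 : (r : ℤ) * S.v s g ≤ -r := by nlinarith
      omega
    have hgr : g ^ r ≠ 0 := pow_ne_zero _ g0
    have hlt : ∀ s ∈ insert q T, S.v s (h + g ^ r) < 0 ∧ h + g ^ r ≠ 0 := by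
      intro s hs
      by_cases hneg : S.v s g < 0
      · have h5 : h ∈ S.F s (S.v s (g ^ r) + 1) := fun _ => hbig s hs hneg
        rw [add_comm]
        refine ⟨?_, add_ne_zero_of_v_lt hgr h5⟩
        rw [v_add_of_lt hgr h5, S.v_pow s g0]
        have : (0 : ℤ) < r := by omega
        nlinarith
      · have hsT : s ∈ T := by
          rcases Finset.mem_insert.mp hs with rfl | h
          · exact absurd g2 hneg
          · exact h
        have h5 : g ^ r ∈ S.F s (S.v s h + 1) := by
          intro _
          rw [S.v_pow s g0]
          have := h2 s hsT
          have : (0 : ℤ) ≤ r * S.v s g := mul_nonneg (by omega) (by omega)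
          omega
        refine ⟨?_, add_ne_zero_of_v_lt h0 h5⟩
        rw [v_add_of_lt h0 h5]
        exact h2 s hsT
    have hne := (hlt q (Finset.mem_insert_self _ _)).2
    refine ⟨h + g ^ r, hne, ?_, fun s hs => (hlt s hs).1⟩
    have h6 : h ∈ S.F p 1 := fun _ => h1
    have h7 : g ^ r ∈ S.F p 1 := by
      intro _
      rw [S.v_pow p g0]
      have : (1 : ℤ) ≤ r := by omega
      nlinarith
    exact (add_mem h6 h7 : h + g ^ r ∈ S.F p 1) hne

/-- A function close to `1` at `p` and close to `0` at the other points of a finite set. -/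
lemma exists_near_one (p : P) (T : Finset P) (hp : p ∉ T) (N : ℕ) :
    ∃ u : K, u - 1 ∈ S.F p N ∧ ∀ q ∈ T, u ∈ S.F q N := by
  obtain ⟨h, h0, h1, h2⟩ := S.exists_pos_forall_neg p T hp
  set r := N + 1
  have hr : h ^ r ≠ 0 := pow_ne_zero _ h0
  have hp1 : h ^ r ∈ S.F p (S.v p 1 + 1) := by
    intro _
    rw [S.v_pow p h0, v_one]
    push_cast [r]
    nlinarith
  have hpN : h ^ r ∈ S.F p N := by
    intro _
    rw [S.v_pow p h0]
    push_cast [r]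
    nlinarith
  have hne : 1 + h ^ r ≠ 0 := add_ne_zero_of_v_lt one_ne_zero hp1
  have hv : S.v p (1 + h ^ r) = 0 := by rw [v_add_of_lt one_ne_zero hp1, v_one]
  refine ⟨(1 + h ^ r)⁻¹, ?_, fun q hq => ?_⟩
  · have : (1 + h ^ r)⁻¹ - 1 = -(h ^ r * (1 + h ^ r)⁻¹) := by field_simp; ring
    rw [this, neg_mem_iff]
    refine mul_mem_F' hpN (mem_F_v p _) ?_
    rw [S.v_inv p hne, hv]; simp
  · intro _
    rw [S.v_inv q hne, add_comm, v_add_of_lt hr, S.v_pow q h0]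
    · have := h2 q hq
      push_cast [r]
      nlinarith
    · intro _
      rw [v_one, S.v_pow q h0]
      have := h2 q hq
      push_cast [r]
      nlinarith

/-- Weak approximation: a function may be given any order at one point and be made to vanish to any
order at finitely many others. -/
lemma exists_v_eq_and_mem (p : P) (T : Finset P) (hp : p ∉ T) (n : ℤ) (M : P → ℤ) :
    ∃ f ≠ 0, S.v p f = n ∧ ∀ q ∈ T, f ∈ S.F q (M q) := by
  obtain ⟨e, he, hen⟩ := S.exists_v_eq p n
  obtain ⟨u, hu1, hu2⟩ := S.exists_near_one p T hp (1 + ∑ q ∈ T, (M q - S.v q e).natAbs)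
  have h1 : u - 1 ∈ S.F p (S.v p 1 + 1) := by
    rw [v_one]; exact F_anti p (by omega) hu1
  have hu0 : u ≠ 0 := by simpa using add_ne_zero_of_v_lt one_ne_zero h1
  have hv : S.v p u = 0 := by simpa using v_add_of_lt one_ne_zero h1
  refine ⟨u * e, mul_ne_zero hu0 he, by rw [S.v_mul p hu0 he, hv, hen, zero_add], fun q hq => ?_⟩
  refine mul_mem_F' (hu2 q hq) (mem_F_v q e) ?_
  have h3 : (M q - S.v q e).natAbs ≤ ∑ q ∈ T, (M q - S.v q e).natAbs :=
    Finset.single_le_sum (f := fun q => (M q - S.v q e).natAbs) (fun _ _ => Nat.zero_le _) hq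
  omega

end PlaceSystem

namespace PlaceSystem

open Polynomial IntermediateField

variable {k K P : Type*} [Field k] [Field K] [Algebra k K] {S : PlaceSystem k K P}

/-! ### The degree of the divisor of zeros -/

lemma aeval_mem_F {p : P} {y : K} (hy : y ∈ S.F p 0) (c : k[X]) : aeval y c ∈ S.F p 0 := by
  induction c using Polynomial.induction_on' with
  | add f g hf hg => rw [map_add]; exact add_mem hf hg
  | monomial n a =>
    rw [aeval_monomial]
    exact mul_mem_F' (algebraMap_mem_F p a) (pow_mem_F hy n) (by simp)

lemma aeval_sub_coeff_zero_mem_F {p : P} {y : K} (hy : y ∈ S.F p 0) (c : k[X]) :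
    aeval y c - algebraMap k K (c.coeff 0) ∈ S.F p (S.v p y) := by
  have h := congrArg (aeval y) (X_mul_divX_add c)
  rw [map_add, map_mul, aeval_X, aeval_C] at h
  rw [← h, add_sub_cancel_right]
  exact mul_mem_F' (mem_F_v p y) (aeval_mem_F hy _) (by simp)

/-- A nonzero family of polynomials is a power of `X` times a family with a nonzero constant
coefficient. -/
lemma exists_eq_X_pow_mul {ι : Type*} (c : ι → k[X]) {i₀ : ι} (h : c i₀ ≠ 0) :
    ∃ (m : ℕ) (d : ι → k[X]), (∀ i, c i = X ^ m * d i) ∧ ∃ i, (d i).coeff 0 ≠ 0 := by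
  classical
  have hex : ∃ m, ∃ i, (c i).coeff m ≠ 0 := by
    by_contra! hc
    exact h (Polynomial.ext fun m => by simpa using hc m i₀)
  set m := Nat.find hex with hm
  obtain ⟨i, hi⟩ := Nat.find_spec hex
  have hdvd : ∀ i, X ^ m ∣ c i := fun i => X_pow_dvd_iff.mpr fun d hd => by
    have := Nat.find_min hex hd
    push Not at this
    exact this i
  choose d hd using hdvd
  refine ⟨m, d, hd, i, ?_⟩
  have h1 : (c i).coeff m = (d i).coeff 0 := by
    conv_lhs => rw [hd i]
    simpa using coeff_X_pow_mul (d i) m 0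
  rw [← h1]
  exact hi

/-- Linear independence over `k(y)` may be tested with polynomials in `y` that do not all vanish at
`0`. -/
lemma linearIndependent_adjoin_of_polynomial {ι : Type*} [Fintype ι] {y : K} (hy : y ≠ 0)
    (f : ι → K)
    (h : ∀ c : ι → k[X], ∑ i, aeval y (c i) * f i = 0 → ∀ i, (c i).coeff 0 = 0) :
    LinearIndependent k⟮y⟯ f := by
  classical
  rw [Fintype.linearIndependent_iff]
  intro g hg
  have hrs : ∀ i, ∃ r s : k[X], (g i : K) = aeval y r / aeval y s :=
    fun i => (mem_adjoin_simple_iff k _).mp (g i).2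
  choose r s hrs using hrs
  by_contra! hne
  obtain ⟨i₀, hi₀⟩ := hne
  -- common denominator, with `1` in place of vanishing denominators
  let s' : ι → k[X] := fun i => if aeval y (s i) = 0 then 1 else s i
  let r' : ι → k[X] := fun i => if aeval y (s i) = 0 then 0 else r i
  have hs' : ∀ i, aeval y (s' i) ≠ 0 := fun i => by
    by_cases hs : aeval y (s i) = 0 <;> simp [s', hs]
  have hgr : ∀ i, (g i : K) * aeval y (s' i) = aeval y (r' i) := fun i => by
    by_cases hs : aeval y (s i) = 0
    · simp [s', r', hs, hrs]
    · simp only [s', r', hs, if_false, hrs]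
      field_simp
  let c : ι → k[X] := fun i => r' i * ∏ j ∈ Finset.univ.erase i, s' j
  have hc : ∀ i, aeval y (c i) = g i * ∏ j, aeval y (s' j) := fun i => by
    rw [← Finset.mul_prod_erase _ _ (Finset.mem_univ i), ← mul_assoc, hgr, map_mul, map_prod]
  have hsum : ∑ i, aeval y (c i) * f i = 0 := by
    have h1 : ∑ i, aeval y (c i) * f i = (∏ j, aeval y (s' j)) * ∑ i, g i • f i := by
      rw [Finset.mul_sum]
      refine Finset.sum_congr rfl fun i _ => ?_
      rw [hc, IntermediateField.smul_def, smul_eq_mul]; ring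
    rw [h1, hg, mul_zero]
  have hc0 : c i₀ ≠ 0 := by
    intro h0
    have h1 := hc i₀
    rw [h0, map_zero, eq_comm, mul_eq_zero] at h1
    rcases h1 with h1 | h1
    · exact hi₀ (by exact_mod_cast h1)
    · exact Finset.prod_ne_zero_iff.mpr (fun j _ => hs' j) h1
  obtain ⟨m, d, hd, i, hi⟩ := exists_eq_X_pow_mul c hc0
  refine hi (h d ?_ i)
  have h2 : ∑ i, aeval y (c i) * f i = y ^ m * ∑ i, aeval y (d i) * f i := by
    rw [Finset.mul_sum]
    refine Finset.sum_congr rfl fun i _ => ?_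
    rw [hd, map_mul, map_pow, aeval_X, mul_assoc]
  rw [h2] at hsum
  exact (mul_eq_zero.mp hsum).resolve_left (pow_ne_zero m hy)

variable (S)

/-- A function `y` has at most `[K : k(y)]` zeros, counted with multiplicity: functions of orders
`0, …, v p y - 1` at each zero `p` that vanish as much as `y` at the other zeros are linearly independent
over `k(y)`. -/
lemma sum_zeros_le_finrank {y : K} (hy : y ≠ 0) [FiniteDimensional k⟮y⟯ K] (T : Finset P)
    (hT : ∀ p ∈ T, 0 < S.v p y) : ∑ p ∈ T, S.v p y ≤ Module.finrank k⟮y⟯ K := by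
  classical
  have hex : ∀ (p : T) (i : ℕ), ∃ f ≠ 0, S.v p f = i ∧ ∀ q ∈ T.erase p, f ∈ S.F q (S.v q y) :=
    fun p i => S.exists_v_eq_and_mem p (T.erase p) (Finset.notMem_erase _ _) i _
  choose f hf0 hfv hfm using hex
  let ι := Σ p : T, Fin (S.v p y).toNat
  have hli : LinearIndependent k⟮y⟯ (fun i : ι => f i.1 i.2) := by
    refine linearIndependent_adjoin_of_polynomial hy _ fun c hc => ?_
    by_contra! hne
    obtain ⟨⟨p, i⟩, hpi⟩ := hne
    -- the least index at `p` whose coefficient does not vanish at `0`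
    have hex : ∃ n : ℕ, ∃ h : n < (S.v p y).toNat, (c ⟨p, ⟨n, h⟩⟩).coeff 0 ≠ 0 := ⟨i, i.2, hpi⟩
    set n := Nat.find hex with hn
    obtain ⟨hn1, hn2⟩ := Nat.find_spec hex
    have hmin : ∀ (j : Fin (S.v p y).toNat), (j : ℕ) < n → (c ⟨p, j⟩).coeff 0 = 0 := by
      intro j hj
      have := Nat.find_min hex hj
      push Not at this
      exact this j.2
    have hyp := hT p p.2
    have hyF : y ∈ S.F p.1 0 := fun _ => hyp.le
    set i₀ : ι := ⟨p, ⟨n, hn1⟩⟩ with hi₀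
    have hrest : ∀ i ∈ Finset.univ.erase i₀, aeval y (c i) * f i.1 i.2 ∈ S.F p.1 (n + 1) := by
      rintro ⟨q, j⟩ hj
      rw [Finset.mem_erase] at hj
      have hn1' : (n : ℤ) + 1 ≤ S.v p y := by omega
      by_cases hq : q = p
      · subst hq
        rcases lt_trichotomy (j : ℕ) n with hlt | heq | hgt
        · have h1 := aeval_sub_coeff_zero_mem_F hyF (c ⟨q, j⟩)
          rw [hmin j hlt, map_zero, sub_zero] at h1
          refine mul_mem_F' h1 (mem_F_v q.1 (f q j)) ?_
          rw [hfv]; omega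
        · exact absurd (by rw [hi₀]; congr 1; exact Fin.ext heq) hj.1
        · refine mul_mem_F' (aeval_mem_F hyF _) (mem_F_v q.1 (f q j)) ?_
          rw [hfv]; omega
      · refine mul_mem_F' (aeval_mem_F hyF _) (hfm q j p ?_) (m := 0) (n := S.v p y) (by omega)
        exact Finset.mem_erase.mpr ⟨fun h => hq (Subtype.ext h.symm), p.2⟩
    rw [← Finset.add_sum_erase _ _ (Finset.mem_univ i₀)] at hc
    have h3 : ∑ i ∈ Finset.univ.erase i₀, aeval y (c i) * f i.1 i.2 ∈ S.F p.1 (n + 1) :=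
      sum_mem hrest
    have hu : aeval y (c i₀) * f p n ≠ 0 ∧ S.v p.1 (aeval y (c i₀) * f p n) = n := by
      have hc0 : algebraMap k K ((c i₀).coeff 0) ≠ 0 := by simpa using hn2
      have h4 := aeval_sub_coeff_zero_mem_F hyF (c i₀)
      have h5 : aeval y (c i₀) - algebraMap k K ((c i₀).coeff 0)
          ∈ S.F p.1 (S.v p.1 (algebraMap k K ((c i₀).coeff 0)) + 1) := by
        rw [S.v_algebraMap' _ _ hn2]
        exact F_anti p.1 (by omega) h4
      have h6 := add_ne_zero_of_v_lt hc0 h5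
      have h7 := v_add_of_lt hc0 h5
      rw [add_sub_cancel, S.v_algebraMap' _ _ hn2] at h7
      rw [add_sub_cancel] at h6
      exact ⟨mul_ne_zero h6 (hf0 _ _), by rw [S.v_mul _ h6 (hf0 _ _), h7, hfv, zero_add]⟩
    refine add_ne_zero_of_v_lt (S := S) (p := p.1) hu.1 ?_ hc
    rw [hu.2]
    exact h3
  have h1 := hli.fintype_card_le_finrank
  have h2 : Fintype.card ι = ∑ p ∈ T, (S.v p y).toNat := by
    simp only [ι, Fintype.card_sigma, Fintype.card_fin]
    exact Finset.sum_coe_sort T fun p => (S.v p y).toNat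
  rw [h2] at h1
  calc ∑ p ∈ T, S.v p y = ∑ p ∈ T, ((S.v p y).toNat : ℤ) :=
        Finset.sum_congr rfl fun p hp => (Int.toNat_of_nonneg (hT p hp).le).symm
    _ ≤ _ := by exact_mod_cast h1

end PlaceSystem

/-! ### Enlarging a subspace by one dimension -/

section OneStep

variable {k V W : Type*} [Field k] [AddCommGroup V] [Module k V] [AddCommGroup W] [Module k W]

/-- Enlarging a subspace `A` by one dimension either enlarges the preimage of `A` under a linear map
`δ`, or the sum of `A` and the range of `δ`, by one dimension. -/
lemma Submodule.comap_or_sup_range_of_sup_span (δ : W →ₗ[k] V) (A : Submodule k V) {e : V}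
    (he : e ∉ A) :
    (∃ x, x ∉ A.comap δ ∧ (A ⊔ k ∙ e).comap δ = A.comap δ ⊔ k ∙ x ∧
      (A ⊔ k ∙ e) ⊔ LinearMap.range δ = A ⊔ LinearMap.range δ) ∨
    ((A ⊔ k ∙ e).comap δ = A.comap δ ∧ e ∉ A ⊔ LinearMap.range δ ∧
      (A ⊔ k ∙ e) ⊔ LinearMap.range δ = (A ⊔ LinearMap.range δ) ⊔ k ∙ e) := by
  by_cases h : e ∈ A ⊔ LinearMap.range δ
  · left
    obtain ⟨a, ha, _, ⟨x, rfl⟩, hax⟩ := Submodule.mem_sup.mp h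
    have hx : δ x = e - a := by rw [← hax]; abel
    refine ⟨x, ?_, ?_, ?_⟩
    · intro hxA
      exact he (hax ▸ add_mem ha hxA)
    · apply le_antisymm
      · intro y hy
        obtain ⟨b, hb, z, hz, hbz⟩ := Submodule.mem_sup.mp (Submodule.mem_comap.mp hy)
        obtain ⟨c, rfl⟩ := Submodule.mem_span_singleton.mp hz
        rw [← sub_add_cancel y (c • x)]
        refine Submodule.add_mem_sup ?_ (Submodule.smul_mem _ _ (mem_span_singleton_self x))
        rw [Submodule.mem_comap, map_sub, map_smul, hx, ← hbz, smul_sub]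
        have : b + c • e - (c • e - c • a) = b + c • a := by abel
        rw [this]
        exact add_mem hb (Submodule.smul_mem _ _ ha)
      · refine sup_le (Submodule.comap_mono le_sup_left) ?_
        rw [Submodule.span_singleton_le_iff_mem, Submodule.mem_comap, hx, sub_eq_add_neg, add_comm]
        exact Submodule.add_mem_sup (neg_mem ha) (mem_span_singleton_self e)
    · refine le_antisymm (sup_le (sup_le le_sup_left ?_) le_sup_right)
        (sup_le (le_sup_left.trans le_sup_left) le_sup_right)
      rwa [Submodule.span_singleton_le_iff_mem]
  · right
    refine ⟨le_antisymm ?_ (Submodule.comap_mono le_sup_left), h, sup_right_comm _ _ _⟩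
    intro y hy
    obtain ⟨b, hb, z, hz, hbz⟩ := Submodule.mem_sup.mp (Submodule.mem_comap.mp hy)
    obtain ⟨c, rfl⟩ := Submodule.mem_span_singleton.mp hz
    by_cases hc : c = 0
    · rw [hc, zero_smul, add_zero] at hbz
      rw [Submodule.mem_comap, ← hbz]; exact hb
    · refine absurd ?_ h
      have : e = -(c⁻¹ • b) + δ (c⁻¹ • y) := by
        rw [map_smul, ← hbz, smul_add, smul_smul, inv_mul_cancel₀ hc, one_smul]; abel
      rw [this]
      exact Submodule.add_mem_sup (neg_mem (Submodule.smul_mem _ _ hb)) ⟨_, rfl⟩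

lemma Submodule.finite_sup_span_singleton_iff (U : Submodule k V) (x : V) :
    FiniteDimensional k ↥(U ⊔ k ∙ x) ↔ FiniteDimensional k U :=
  ⟨fun _ => Submodule.finiteDimensional_of_le (S₂ := U ⊔ k ∙ x) le_sup_left, fun _ => inferInstance⟩

lemma Submodule.finrank_sup_span_singleton_of_notMem (U : Submodule k V) [FiniteDimensional k U]
    {x : V} (hx : x ∉ U) : Module.finrank k ↥(U ⊔ k ∙ x) = Module.finrank k U + 1 := by
  have h := Submodule.finrank_sup_add_finrank_inf_eq U (k ∙ x)
  have hd : U ⊓ k ∙ x = ⊥ := by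
    rw [← disjoint_iff, Submodule.disjoint_span_singleton' (by rintro rfl; exact hx (zero_mem _))]
    exact hx
  rw [hd, finrank_bot, finrank_span_singleton (by rintro rfl; exact hx (zero_mem _))] at h
  omega

lemma Submodule.finite_quotient_sup_span_singleton_iff (U : Submodule k V) (x : V) :
    FiniteDimensional k (V ⧸ U ⊔ k ∙ x) ↔ FiniteDimensional k (V ⧸ U) := by
  have e := Submodule.quotientQuotientEquivQuotientSup U (k ∙ x)
  refine (Module.Finite.equiv_iff e).symm.trans ?_
  have : FiniteDimensional k ((k ∙ x).map U.mkQ) := inferInstance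
  exact ⟨fun h => Module.Finite.of_submodule_quotient ((k ∙ x).map U.mkQ), fun h => inferInstance⟩

lemma Submodule.finrank_quotient_sup_span_singleton (U : Submodule k V)
    [FiniteDimensional k (V ⧸ U)] {x : V} (hx : x ∉ U) :
    Module.finrank k (V ⧸ U ⊔ k ∙ x) + 1 = Module.finrank k (V ⧸ U) := by
  have e := Submodule.quotientQuotientEquivQuotientSup U (k ∙ x)
  rw [← e.finrank_eq, ← Submodule.finrank_quotient_add_finrank ((k ∙ x).map U.mkQ)]
  congr 1
  rw [Submodule.map_span, Set.image_singleton, finrank_span_singleton]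
  rw [Submodule.mkQ_apply, ne_eq, Submodule.Quotient.mk_eq_zero]
  exact hx

end OneStep

namespace PlaceSystem

variable {k K P : Type*} [Field k] [Field K] [Algebra k K] (S : PlaceSystem k K P)

/-! ### Adeles and Riemann–Roch spaces -/

/-- The ring of (pre-)adeles: families of functions almost all of which are regular at their
point. -/
def adele : Subalgebra k (P → K) where
  carrier := {a | {p | a p ∉ S.F p 0}.Finite}
  mul_mem' {a b} ha hb := by
    refine (ha.union hb).subset fun p hp => ?_
    by_contra h
    simp only [Set.mem_union, Set.mem_ofPred_eq, not_or, not_not] at h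
    exact hp (mul_mem_F' h.1 h.2 (by simp))
  add_mem' {a b} ha hb := by
    refine (ha.union hb).subset fun p hp => ?_
    by_contra h
    simp only [Set.mem_union, Set.mem_ofPred_eq, not_or, not_not] at h
    exact hp (add_mem h.1 h.2)
  algebraMap_mem' c := by
    have : {p | (algebraMap k (P → K) c) p ∉ S.F p 0} = ∅ := by
      ext p; simpa using algebraMap_mem_F p c
    change {p | (algebraMap k (P → K) c) p ∉ S.F p 0}.Finite
    rw [this]
    exact Set.finite_empty

/-- The adeles of order at least `-D p` at every point `p`. -/
def A (D : P → ℤ) : Submodule k S.adele where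
  carrier := {a | ∀ p, a.1 p ∈ S.F p (-D p)}
  zero_mem' _ := zero_mem _
  add_mem' ha hb p := add_mem (ha p) (hb p)
  smul_mem' c _ ha p := Submodule.smul_mem _ c (ha p)

variable {S}

lemma mem_adele {a : P → K} : a ∈ S.adele ↔ {p | a p ∉ S.F p 0}.Finite := Iff.rfl

lemma A_mono {D E : P → ℤ} (h : D ≤ E) : S.A D ≤ S.A E :=
  fun _ ha p => F_anti p (neg_le_neg (h p)) (ha p)

lemma finite_notMem_F (f : K) : {p | f ∉ S.F p 0}.Finite := by
  by_cases hf : f = 0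
  · simp [hf]
  · refine (S.finite_support f hf).subset fun p hp => ?_
    rw [Set.mem_ofPred_eq, mem_F_of_ne hf] at hp
    exact fun h => hp h.ge

variable (S)

/-- The embedding of the functions as principal adeles. -/
def diag : K →ₐ[k] S.adele :=
  AlgHom.codRestrict (AlgHom.pi fun _ : P => AlgHom.id k K) S.adele
    fun f => finite_notMem_F f

open Classical in
/-- The adele with the given value at `p` and the value `0` elsewhere. -/
noncomputable def single (p : P) : K →ₗ[k] S.adele :=
  LinearMap.codRestrict (Subalgebra.toSubmodule S.adele) (LinearMap.single k (fun _ => K) p)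
    fun f => by
      refine (Set.finite_singleton p).subset fun q hq => ?_
      by_contra h
      refine hq ?_
      have : (LinearMap.single k (fun _ : P => K) p) f q = 0 := by
        simp [Pi.single_eq_of_ne (show q ≠ p from h)]
      rw [this]
      exact zero_mem _

/-- The Riemann–Roch space `H⁰(D)`: the functions of order at least `-D p` at every point `p`. It is
defined for arbitrary integer-valued functions `D` on the set of points. -/
def L (D : P → ℤ) : Submodule k K := (S.A D).comap S.diag.toLinearMap

/-- The first cohomology group of a divisor: the adeles modulo those of order at least `-D` and the
principal ones. -/
abbrev H1 (D : P → ℤ) : Type _ := S.adele ⧸ S.A D ⊔ LinearMap.range S.diag.toLinearMap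

variable {S}

lemma single_same (p : P) (f : K) : (S.single p f).1 p = f := by
  classical exact Pi.single_eq_same (M := fun _ => K) p f

lemma single_of_ne {p q : P} (h : q ≠ p) (f : K) : (S.single p f).1 q = 0 := by
  classical exact Pi.single_eq_of_ne (M := fun _ => K) h f

lemma mem_L {D : P → ℤ} {f : K} : f ∈ S.L D ↔ ∀ p, f ∈ S.F p (-D p) := Iff.rfl

lemma single_mem_A {D : P → ℤ} {p : P} {f : K} : S.single p f ∈ S.A D ↔ f ∈ S.F p (-D p) := by
  refine ⟨fun h => by simpa [single_same] using h p, fun h q => ?_⟩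
  by_cases hq : q = p
  · subst hq; rwa [single_same]
  · rw [single_of_ne hq]; exact zero_mem _

lemma L_mono {D E : P → ℤ} (h : D ≤ E) : S.L D ≤ S.L E := Submodule.comap_mono (A_mono h)

/-- Adding a point to a divisor enlarges the space of adeles by one dimension. -/
lemma exists_A_add_single (D : P →₀ ℤ) (p : P) :
    ∃ e, e ∉ S.A D ∧ S.A ⇑(D + Finsupp.single p 1 : P →₀ ℤ) = S.A D ⊔ k ∙ e := by
  classical
  obtain ⟨f, hf, hv⟩ := S.exists_v_eq p (-(D + Finsupp.single p 1 : P →₀ ℤ) p)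
  have hDp : (D + Finsupp.single p 1 : P →₀ ℤ) p = D p + 1 := by simp
  have hDq : ∀ q ≠ p, (D + Finsupp.single p 1 : P →₀ ℤ) q = D q := fun q hq => by
    simp [Finsupp.single_eq_of_ne hq]
  refine ⟨S.single p f, ?_, le_antisymm ?_ ?_⟩
  · rw [single_mem_A]
    exact notMem_F_of_v hf (by omega)
  · intro a ha
    obtain ⟨c, hc⟩ := exists_sub_smul_mem hf hv (ha p)
    rw [← sub_add_cancel a (c • S.single p f)]
    refine Submodule.add_mem_sup (fun q => ?_)
      (Submodule.smul_mem _ _ (Submodule.mem_span_singleton_self _))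
    by_cases hq : q = p
    · subst hq
      have : (a - c • S.single q f).1 q = a.1 q - c • f := by
        change a.1 q - c • (S.single q f).1 q = _
        rw [single_same]
      rw [this]
      refine F_anti q ?_ hc
      omega
    · have : (a - c • S.single p f).1 q = a.1 q := by
        change a.1 q - c • (S.single p f).1 q = _
        rw [single_of_ne hq, smul_zero, sub_zero]
      rw [this, ← hDq q hq]
      exact ha q
  · refine sup_le (A_mono fun q => ?_) ?_
    · by_cases hq : q = p
      · subst hq; change D q ≤ _; rw [hDp]; omega
      · exact (hDq q hq).ge
    rw [Submodule.span_singleton_le_iff_mem, single_mem_A]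
    exact hv ▸ mem_F_v p f

lemma A_zero_le {D : P →₀ ℤ} (hD : 0 ≤ D) : S.A 0 ≤ S.A D := A_mono fun p => hD p

lemma L_zero : S.L (0 : P → ℤ) = k ∙ (1 : K) := by
  ext f
  rw [mem_L, Submodule.mem_span_singleton]
  constructor
  · intro h
    obtain ⟨c, hc⟩ := S.eq_const f fun p hf => by simpa using h p hf
    exact ⟨c, by rw [← hc, Algebra.algebraMap_eq_smul_one]⟩
  · rintro ⟨c, rfl⟩ p
    simpa using Submodule.smul_mem _ c (one_mem_F p)

/-! ### Riemann's inequality -/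

variable (S)

/-- The image of `A(D)` in `H¹(0)`, that is, `(A(D) + K) / (A(0) + K)` for effective `D`. -/
def excess (D : P → ℤ) : Submodule k (S.H1 0) := (S.A D).map (Submodule.mkQ _)

variable {S}

lemma excess_mono {D E : P → ℤ} (h : D ≤ E) : S.excess D ≤ S.excess E :=
  Submodule.map_mono (A_mono h)

/-- For an effective divisor, the dimensions of `L(D)` and of the image of `A(D)` in `H¹(0)` add up to
`deg D + 1`: adding a point to `D` increases exactly one of them by one. -/
lemma finrank_L_add_finrank_excess (D : P →₀ ℤ) (hD : 0 ≤ D) :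
    FiniteDimensional k (S.L D) ∧ FiniteDimensional k (S.excess D) ∧
      (Module.finrank k (S.L D) : ℤ) + Module.finrank k (S.excess D) = D.degree + 1 := by
  refine Finsupp.effective_induction (C := fun D => FiniteDimensional k (S.L D) ∧
    FiniteDimensional k (S.excess D) ∧
      (Module.finrank k (S.L D) : ℤ) + Module.finrank k (S.excess D) = D.degree + 1) ?_ ?_ D hD
  · have h0 : S.excess ⇑(0 : P →₀ ℤ) = ⊥ := by
      rw [excess, eq_bot_iff, Submodule.map_le_iff_le_comap, Submodule.comap_bot, Submodule.ker_mkQ,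
        Finsupp.coe_zero]
      exact le_sup_left
    rw [h0, Finsupp.coe_zero, L_zero]
    exact ⟨inferInstance, inferInstance, by rw [finrank_span_singleton one_ne_zero]; simp⟩
  · intro D p hD ih
    obtain ⟨h1, h2, h3⟩ := ih
    obtain ⟨e, he, hA⟩ := exists_A_add_single (S := S) D p
    have hdeg : (D + Finsupp.single p 1).degree = D.degree + 1 := by simp
    have hmap : ∀ B : Submodule k S.adele,
        (B ⊔ LinearMap.range S.diag.toLinearMap).map
          (S.A 0 ⊔ LinearMap.range S.diag.toLinearMap).mkQ
        = B.map (S.A 0 ⊔ LinearMap.range S.diag.toLinearMap).mkQ := by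
      intro B
      rw [Submodule.map_sup, sup_eq_left]
      refine le_trans ?_ bot_le
      rw [Submodule.map_le_iff_le_comap, Submodule.comap_bot, Submodule.ker_mkQ]
      exact le_sup_right
    rw [hdeg, L, excess, hA]
    rcases Submodule.comap_or_sup_range_of_sup_span S.diag.toLinearMap (S.A D) he with
      ⟨x, hx, hx1, hx2⟩ | ⟨hx1, hx, hx2⟩
    · rw [hx1, ← hmap, hx2, hmap]
      change FiniteDimensional k ↥(S.L D ⊔ k ∙ x) ∧ FiniteDimensional k (S.excess D) ∧
        (Module.finrank k ↥(S.L D ⊔ k ∙ x) : ℤ) + Module.finrank k (S.excess D) = _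
      refine ⟨inferInstance, h2, ?_⟩
      rw [Submodule.finrank_sup_span_singleton_of_notMem (S.L D) hx]
      push_cast; omega
    · rw [hx1, ← hmap, hx2, Submodule.map_sup, hmap, Submodule.map_span, Set.image_singleton]
      set e' := (S.A 0 ⊔ LinearMap.range S.diag.toLinearMap).mkQ e with he'
      change FiniteDimensional k (S.L D) ∧ FiniteDimensional k ↥(S.excess D ⊔ k ∙ e') ∧
        (Module.finrank k (S.L D) : ℤ) + Module.finrank k ↥(S.excess D ⊔ k ∙ e') = _
      have he'' : e' ∉ S.excess D := by
        rintro ⟨a, ha, hae⟩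
        rw [he', ← sub_eq_zero, ← map_sub, Submodule.mkQ_apply, Submodule.Quotient.mk_eq_zero] at hae
        refine hx ?_
        have h4 : a - (a - e) ∈ S.A D ⊔ LinearMap.range S.diag.toLinearMap :=
          sub_mem (Submodule.mem_sup_left ha)
            ((sup_le_sup_right (A_zero_le hD) _ : S.A 0 ⊔ LinearMap.range S.diag.toLinearMap ≤ _) hae)
        rwa [sub_sub_cancel] at h4
      refine ⟨h1, inferInstance, ?_⟩
      rw [Submodule.finrank_sup_span_singleton_of_notMem _ he'']
      push_cast
      rw [← add_assoc]
      exact congrArg (· + 1) h3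

variable (S)

/-- The divisor of a nonzero function. -/
noncomputable def div (f : K) (hf : f ≠ 0) : P →₀ ℤ :=
  Finsupp.ofSupportFinite (fun p => S.v p f) (S.finite_support f hf)

@[simp] lemma div_apply (f : K) (hf : f ≠ 0) (p : P) : S.div f hf p = S.v p f := rfl

/-- The divisor of zeros of a nonzero function. -/
noncomputable def zeroDiv (f : K) (hf : f ≠ 0) : P →₀ ℤ :=
  Finsupp.ofSupportFinite (fun p => max 0 (S.v p f)) <|
    (S.finite_support f hf).subset fun p hp h => hp (by simp [h])

@[simp] lemma zeroDiv_apply (f : K) (hf : f ≠ 0) (p : P) :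
    S.zeroDiv f hf p = max 0 (S.v p f) := rfl

lemma div_eq_sub (f : K) (hf : f ≠ 0) :
    S.div f hf = S.zeroDiv f hf - S.zeroDiv f⁻¹ (inv_ne_zero hf) := by
  ext p
  simp only [div_apply, Finsupp.coe_sub, Pi.sub_apply, zeroDiv_apply, S.v_inv p hf]
  omega

lemma zeroDiv_nonneg (f : K) (hf : f ≠ 0) : 0 ≤ S.zeroDiv f hf := fun p => by simp

lemma degree_zeroDiv_le (f : K) (hf : f ≠ 0) [FiniteDimensional (IntermediateField.adjoin k {f}) K] :
    (S.zeroDiv f hf).degree ≤ Module.finrank (IntermediateField.adjoin k {f}) K := by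
  have hpos : ∀ p ∈ (S.zeroDiv f hf).support, 0 < S.v p f := by
    intro p hp
    rw [Finsupp.mem_support_iff, zeroDiv_apply] at hp
    omega
  refine le_trans (le_of_eq ?_) (S.sum_zeros_le_finrank hf _ hpos)
  rw [Finsupp.degree_apply]
  refine Finset.sum_congr rfl fun p hp => ?_
  have := hpos p hp
  rw [zeroDiv_apply]
  omega

/-- Multiplication by `f` identifies `L(D)` with `L(D - div f)`. -/
noncomputable def mulL (D : P → ℤ) (f : K) (hf : f ≠ 0) :
    S.L D ≃ₗ[k] S.L (D - S.div f hf) where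
  toFun x := ⟨f * x.1, fun p => mul_mem_F' (mem_F_v p f) (x.2 p) (by simp)⟩
  map_add' x y := Subtype.ext (mul_add _ _ _)
  map_smul' c x := Subtype.ext (mul_smul_comm c f x.1)
  invFun y := ⟨f⁻¹ * y.1, fun p => mul_mem_F' (mem_F_v p f⁻¹) (y.2 p) (by
    rw [S.v_inv p hf]; simp)⟩
  left_inv x := Subtype.ext (by simp [hf])
  right_inv y := Subtype.ext (by simp [hf])

end PlaceSystem

namespace PlaceSystem

open IntermediateField

variable {k K P : Type*} [Field k] [Field K] [Algebra k K] {S : PlaceSystem k K P}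

lemma finiteDimensional_L_of_nonneg (D : P →₀ ℤ) (hD : 0 ≤ D) : FiniteDimensional k (S.L D) :=
  (finrank_L_add_finrank_excess D hD).1

lemma finrank_L_le (D : P →₀ ℤ) (hD : 0 ≤ D) : (Module.finrank k (S.L D) : ℤ) ≤ D.degree + 1 := by
  have := (finrank_L_add_finrank_excess (S := S) D hD).2.2
  omega

/-- The poles of an adele are bounded by an effective divisor. -/
lemma exists_mem_A (a : S.adele) : ∃ D : P →₀ ℤ, 0 ≤ D ∧ a ∈ S.A D := by
  classical
  let D : P →₀ ℤ := Finsupp.ofSupportFinite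
    (fun p => if a.1 p ∈ S.F p 0 then 0 else max 0 (-S.v p (a.1 p)))
    (Set.Finite.subset (mem_adele.mp a.2) fun p hp h => hp (if_pos h))
  have hD : ∀ p, D p = if a.1 p ∈ S.F p 0 then 0 else max 0 (-S.v p (a.1 p)) := fun p => rfl
  refine ⟨D, fun p => ?_, fun p => ?_⟩
  · rw [hD]; split_ifs
    · exact le_rfl
    · exact le_max_left _ _
  · rw [hD]; split_ifs with h
    · simpa using h
    · refine F_anti p ?_ (mem_F_v p _)
      have := le_max_right 0 (-S.v p (a.1 p))
      omega

/-- If `u` is linearly independent over `k(x)`, then the products `x ^ i * u j` are linearly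
independent over `k`; hence the Riemann–Roch spaces of the multiples of the polar divisor of `x` are
large. -/
lemma le_finrank_L {x : K} (hx0 : x ≠ 0) (hx : Transcendental k x) {n : ℕ} (u : Fin n → K)
    (hu : LinearIndependent k⟮x⟯ u) (B : P →₀ ℤ) (hB0 : 0 ≤ B) (hB : ∀ j, u j ∈ S.L B) (l : ℕ) :
    n * (l + 1) ≤ Module.finrank k (S.L ⇑(l • S.zeroDiv x⁻¹ (inv_ne_zero hx0) + B)) := by
  have hD : 0 ≤ l • S.zeroDiv x⁻¹ (inv_ne_zero hx0) + B :=
    add_nonneg (nsmul_nonneg (S.zeroDiv_nonneg _ _) l) hB0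
  have := finiteDimensional_L_of_nonneg (S := S) _ hD
  have hpow : LinearIndependent k (fun i : Fin (l + 1) => (AdjoinSimple.gen k x) ^ (i : ℕ)) := by
    have h1 : LinearIndependent k (fun i : ℕ => x ^ i) := by
      rw [transcendental_iff_injective, injective_iff_map_eq_zero] at hx
      have h2 := (Polynomial.basisMonomials k).linearIndependent.map' (Polynomial.aeval x).toLinearMap
        (LinearMap.ker_eq_bot.mpr ((injective_iff_map_eq_zero _).mpr hx))
      have h4 : (fun i : ℕ => x ^ i)
          = (Polynomial.aeval x).toLinearMap ∘ Polynomial.basisMonomials k := by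
        ext i
        simp [Polynomial.coe_basisMonomials]
      rwa [h4]
    have h3 : LinearIndependent k (fun i : Fin (l + 1) => x ^ (i : ℕ)) :=
      h1.comp (fun i : Fin (l + 1) => (i : ℕ)) Fin.val_injective
    refine LinearIndependent.of_comp (IsScalarTower.toAlgHom k k⟮x⟯ K).toLinearMap ?_
    have h4 : (IsScalarTower.toAlgHom k k⟮x⟯ K).toLinearMap ∘
        (fun i : Fin (l + 1) => (AdjoinSimple.gen k x) ^ (i : ℕ))
          = fun i : Fin (l + 1) => x ^ (i : ℕ) := by
      ext i
      simp only [Function.comp_apply, AlgHom.toLinearMap_apply, map_pow]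
      rfl
    rwa [h4]
  have hli := linearIndependent_smul hpow hu
  have hmem : ∀ i : Fin (l + 1) × Fin n,
      ((AdjoinSimple.gen k x) ^ (i.1 : ℕ)) • u i.2 ∈
        S.L ⇑(l • S.zeroDiv x⁻¹ (inv_ne_zero hx0) + B) := by
    intro i p
    have h1 : ((AdjoinSimple.gen k x) ^ (i.1 : ℕ)) • u i.2 = x ^ (i.1 : ℕ) * u i.2 := by
      rw [IntermediateField.smul_def]; simp
    have h2 : (S.diag.toLinearMap (((AdjoinSimple.gen k x) ^ (i.1 : ℕ)) • u i.2)).1 p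
        = x ^ (i.1 : ℕ) * u i.2 := h1
    rw [h2]
    refine mul_mem_F' (mem_F_v p _) (hB i.2 p) ?_
    rw [S.v_pow p hx0]
    have h3 : (l • S.zeroDiv x⁻¹ (inv_ne_zero hx0) + B : P →₀ ℤ) p
        = l * max 0 (-S.v p x) + B p := by
      simp [S.v_inv p hx0]
    rw [h3]
    have h4 : ((i.1 : ℕ) : ℤ) ≤ l := by have := i.1.2; omega
    have h5 : ((i.1 : ℕ) : ℤ) * -S.v p x ≤ l * max 0 (-S.v p x) :=
      (mul_le_mul_of_nonneg_left (le_max_right 0 _) (by omega)).trans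
        (mul_le_mul_of_nonneg_right h4 (le_max_left 0 _))
    nlinarith
  have hli' : LinearIndependent k (fun i : Fin (l + 1) × Fin n =>
      (⟨_, hmem i⟩ : S.L ⇑(l • S.zeroDiv x⁻¹ (inv_ne_zero hx0) + B))) :=
    LinearIndependent.of_comp (Submodule.subtype _) hli
  have := hli'.fintype_card_le_finrank
  rw [Fintype.card_prod, Fintype.card_fin, Fintype.card_fin] at this
  linarith

lemma adjoin_inv (x : K) : k⟮x⁻¹⟯ = k⟮x⟯ := by
  apply le_antisymm <;> rw [adjoin_simple_le_iff]
  · exact inv_mem (mem_adjoin_simple_self k x)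
  · simpa using inv_mem (mem_adjoin_simple_self k x⁻¹)

lemma adjoin_sub_algebraMap (x : K) (c : k) : k⟮x - algebraMap k K c⟯ = k⟮x⟯ := by
  apply le_antisymm <;> rw [adjoin_simple_le_iff]
  · exact sub_mem (mem_adjoin_simple_self k x) (_root_.algebraMap_mem k⟮x⟯ c)
  · have := add_mem (mem_adjoin_simple_self k (x - algebraMap k K c))
      (_root_.algebraMap_mem k⟮x - algebraMap k K c⟯ c)
    simpa using this

lemma sub_algebraMap_ne_zero {x : K} (hx : Transcendental k x) (c : k) :
    x - algebraMap k K c ≠ 0 := by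
  intro h
  rw [sub_eq_zero] at h
  exact hx (h ▸ isAlgebraic_algebraMap c)

lemma ne_zero_of_transcendental {x : K} (hx : Transcendental k x) : x ≠ 0 := by
  simpa using sub_algebraMap_ne_zero hx 0

section Riemann

variable {x : K} (hx : Transcendental k x) [FiniteDimensional k⟮x⟯ K]

include hx

/-- The polar divisor of `x` has degree `n = [K : k(x)]`, and the spaces `L(l (x)_∞ + B)` grow as fast
as they can, where `B` bounds the poles of a basis of `K` over `k(x)`: the dimension is at least
`n (l + 1)`, and it is at most one more than the degree of the divisor. -/
lemma exists_riemann_bound (hx0 : x ≠ 0) : ∃ (n : ℕ) (B : P →₀ ℤ), 0 ≤ B ∧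
    (S.zeroDiv x⁻¹ (inv_ne_zero hx0)).degree = n ∧ n = Module.finrank k⟮x⟯ K ∧
    ∀ l : ℕ, n * (l + 1) ≤
      Module.finrank k (S.L ⇑(l • S.zeroDiv x⁻¹ (inv_ne_zero hx0) + B)) := by
  set n := Module.finrank k⟮x⟯ K with hn
  let b := Module.finBasis k⟮x⟯ K
  have hb0 : ∀ j, b j ≠ 0 := fun j => b.ne_zero j
  set B : P →₀ ℤ := ∑ j, S.zeroDiv (b j)⁻¹ (inv_ne_zero (hb0 j)) with hB
  have hB0 : 0 ≤ B := Finset.sum_nonneg fun j _ => S.zeroDiv_nonneg _ _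
  have hbB : ∀ j, b j ∈ S.L B := by
    intro j p
    have h1 : S.zeroDiv (b j)⁻¹ (inv_ne_zero (hb0 j)) ≤ B :=
      Finset.single_le_sum (f := fun j => S.zeroDiv (b j)⁻¹ (inv_ne_zero (hb0 j)))
        (fun j _ => S.zeroDiv_nonneg _ _) (Finset.mem_univ j)
    have h2 := h1 p
    rw [zeroDiv_apply, S.v_inv p (hb0 j)] at h2
    refine F_anti p ?_ (mem_F_v p (b j))
    have := le_max_right 0 (-S.v p (b j))
    omega
  have hlow := fun l => le_finrank_L (S := S) hx0 hx b b.linearIndependent B hB0 hbB l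
  refine ⟨n, B, hB0, le_antisymm ?_ ?_, rfl, hlow⟩
  · have h1 : FiniteDimensional k⟮x⁻¹⟯ K := by rw [adjoin_inv]; infer_instance
    have h2 := S.degree_zeroDiv_le x⁻¹ (inv_ne_zero hx0)
    rwa [adjoin_inv] at h2
  · by_contra! hlt
    set d := (S.zeroDiv x⁻¹ (inv_ne_zero hx0)).degree
    set l := (B.degree + 2).toNat
    have h1 := hlow l
    have h2 := finrank_L_le (S := S) (l • S.zeroDiv x⁻¹ (inv_ne_zero hx0) + B)
      (add_nonneg (nsmul_nonneg (S.zeroDiv_nonneg _ _) l) hB0)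
    rw [map_add, map_nsmul] at h2
    have h3 : (n : ℤ) * (l + 1) ≤ l * d + B.degree + 1 := by
      refine le_trans ?_ (h2.trans (le_of_eq ?_))
      · exact_mod_cast h1
      · simp [d]
    have h4 : (l : ℤ) ≥ B.degree + 2 := Int.self_le_toNat _
    have h5 : (l : ℤ) * d ≤ l * (n - 1) := mul_le_mul_of_nonneg_left (by omega) (by omega)
    nlinarith

/-- Every effective divisor is bounded by the sum of a multiple of the polar divisor of `x` and the
divisor of a function: a point `p` where `x` takes the finite value `c` is a zero of `x - c`,
whose poles are those of `x`. -/
lemma exists_le_add_div (hx0 : x ≠ 0) (hdeg : (S.zeroDiv x⁻¹ (inv_ne_zero hx0)).degree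
      = Module.finrank k⟮x⟯ K) (D : P →₀ ℤ) (hD : 0 ≤ D) :
    ∃ (l : ℕ) (f : K) (hf : f ≠ 0), (S.div f hf).degree ≤ 0 ∧
      D ≤ l • S.zeroDiv x⁻¹ (inv_ne_zero hx0) + S.div f hf := by
  set X := S.zeroDiv x⁻¹ (inv_ne_zero hx0) with hX
  have hXp : ∀ p, X p = max 0 (-S.v p x) := fun p => by rw [hX, zeroDiv_apply, S.v_inv p hx0]
  refine Finsupp.effective_induction (C := fun D => ∃ (l : ℕ) (f : K) (hf : f ≠ 0),
    (S.div f hf).degree ≤ 0 ∧ D ≤ l • X + S.div f hf) ?_ ?_ D hD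
  · refine ⟨0, 1, one_ne_zero, ?_, ?_⟩
    · have : S.div 1 one_ne_zero = 0 := by ext p; simp
      simp [this]
    · intro p; simp
  · rintro D p hD ⟨l, f, hf, hdegf, hle⟩
    by_cases hp : S.v p x < 0
    · refine ⟨l + 1, f, hf, hdegf, fun q => ?_⟩
      have h1 := hle q
      have h2 := hXp q
      simp only [Finsupp.add_apply, Finsupp.smul_apply, div_apply, add_smul, one_smul] at h1 ⊢
      by_cases hq : q = p
      · subst hq; rw [Finsupp.single_eq_same]; omega
      · rw [Finsupp.single_eq_of_ne hq]; omega
    · obtain ⟨c, hc⟩ := exists_sub_algebraMap_mem (S := S) (p := p) (f := x)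
        fun _ => not_lt.mp hp
      set y := x - algebraMap k K c with hy
      have hy0 : y ≠ 0 := sub_algebraMap_ne_zero hx c
      have hvy : ∀ q, 0 ≤ X q + S.v q y := by
        intro q
        have h1 : y ∈ S.F q (min 0 (S.v q x)) :=
          sub_mem (F_anti q (min_le_right _ _) (mem_F_v q x))
            (F_anti q (min_le_left _ _) (algebraMap_mem_F q c))
        have h2 := h1 hy0
        rw [hXp]; omega
      have hpole : ∀ q, S.zeroDiv y⁻¹ (inv_ne_zero hy0) q = X q := by
        intro q
        have h1 : x ∈ S.F q (min 0 (S.v q y)) := by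
          have := add_mem (F_anti q (min_le_right 0 _) (mem_F_v q y))
            (F_anti q (min_le_left _ (S.v q y)) (algebraMap_mem_F q c))
          simpa [hy] using this
        have h2 := h1 hx0
        have h3 := hvy q
        rw [zeroDiv_apply, S.v_inv q hy0]
        rw [hXp] at h3 ⊢
        omega
      have hdy : (S.div y hy0).degree ≤ 0 := by
        have h1 : FiniteDimensional k⟮y⟯ K := by rw [hy, adjoin_sub_algebraMap]; infer_instance
        have h2 := S.degree_zeroDiv_le y hy0
        rw [show k⟮y⟯ = k⟮x⟯ from adjoin_sub_algebraMap x c, ← hdeg] at h2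
        rw [div_eq_sub, map_sub, show S.zeroDiv y⁻¹ (inv_ne_zero hy0) = X from Finsupp.ext hpole]
        exact sub_nonpos.mpr h2
      refine ⟨l + 1, f * y, mul_ne_zero hf hy0, ?_, fun q => ?_⟩
      · have : S.div (f * y) (mul_ne_zero hf hy0) = S.div f hf + S.div y hy0 := by
          ext q; simp [S.v_mul q hf hy0]
        rw [this, map_add]; omega
      · have h1 := hle q
        have h2 := hvy q
        simp only [Finsupp.add_apply, Finsupp.smul_apply, div_apply, add_smul, one_smul,
          S.v_mul q hf hy0] at h1 ⊢
        by_cases hq : q = p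
        · subst hq
          have h3 := hc hy0
          have h4 := hXp q
          rw [Finsupp.single_eq_same]; omega
        · rw [Finsupp.single_eq_of_ne hq]; omega

/-- The images of the `A(D)` in `H¹(0)` have bounded dimension. -/
lemma exists_finrank_excess_le : ∃ γ : ℤ, ∀ D : P →₀ ℤ, 0 ≤ D →
    (Module.finrank k (S.excess D) : ℤ) ≤ γ := by
  have hx0 := ne_zero_of_transcendental hx
  obtain ⟨n, B, hB0, hdeg, hn, hlow⟩ := exists_riemann_bound (S := S) hx hx0
  refine ⟨B.degree - n + 1, fun D hD => ?_⟩
  obtain ⟨l, f, hf, hdegf, hle⟩ := exists_le_add_div (S := S) hx hx0 (by rw [hdeg, hn]) D hD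
  set X := S.zeroDiv x⁻¹ (inv_ne_zero hx0) with hX
  set E := l • X + B + S.div f hf with hE
  have hDE : D ≤ E := by
    rw [hE, add_right_comm]; exact hle.trans (le_add_of_nonneg_right hB0)
  obtain ⟨-, h2, h3⟩ := finrank_L_add_finrank_excess (S := S) E (hD.trans hDE)
  have h4 : Module.finrank k (S.excess D) ≤ Module.finrank k (S.excess E) :=
    Submodule.finrank_mono (excess_mono hDE)
  have h5 : Module.finrank k (S.L E) = Module.finrank k (S.L ⇑(l • X + B)) := by
    rw [(S.mulL E f hf).finrank_eq]
    have : ⇑E - ⇑(S.div f hf) = ⇑(l • X + B) := by ext p; simp [hE]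
    rw [this]
  have h6 := hlow l
  have h7 : E.degree ≤ l * n + B.degree := by
    rw [hE, map_add, map_add, map_nsmul, hdeg]
    simp only [nsmul_eq_mul]
    omega
  have h8 : (n : ℤ) * (l + 1) ≤ Module.finrank k (S.L E) := by rw [h5]; exact_mod_cast h6
  have h9 : (n : ℤ) * (l + 1) = l * n + n := by ring
  omega

/-- If `D` is large enough, then `A(D)` maps onto `H¹(0)`. -/
lemma exists_excess_eq_top : ∃ D : P →₀ ℤ, 0 ≤ D ∧ S.excess D = ⊤ := by
  obtain ⟨γ, hγ⟩ := exists_finrank_excess_le (S := S) hx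
  -- an effective divisor with the largest possible excess
  obtain ⟨D₀, hD₀, hmax⟩ : ∃ D₀ : P →₀ ℤ, 0 ≤ D₀ ∧ ∀ D : P →₀ ℤ, 0 ≤ D →
      Module.finrank k (S.excess D) ≤ Module.finrank k (S.excess D₀) := by
    by_contra! hcon
    have : ∀ m : ℕ, ∃ D : P →₀ ℤ, 0 ≤ D ∧ m ≤ Module.finrank k (S.excess D) := by
      intro m
      induction m with
      | zero => exact ⟨0, le_rfl, Nat.zero_le _⟩
      | succ m ih =>
        obtain ⟨D, hD, hm⟩ := ih
        obtain ⟨D', hD', hlt⟩ := hcon D hD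
        exact ⟨D', hD', by omega⟩
    obtain ⟨D, hD, hm⟩ := this (γ.toNat + 1)
    have := hγ D hD
    omega
  refine ⟨D₀, hD₀, ?_⟩
  rw [eq_top_iff]
  rintro y -
  obtain ⟨a, rfl⟩ := Submodule.mkQ_surjective _ y
  obtain ⟨Da, hDa0, haA⟩ := exists_mem_A a
  have h1 : S.excess D₀ ≤ S.excess ⇑(D₀ + Da : P →₀ ℤ) :=
    excess_mono (le_add_of_nonneg_right hDa0 : D₀ ≤ D₀ + Da)
  have h2 := (finrank_L_add_finrank_excess (S := S) (D₀ + Da) (add_nonneg hD₀ hDa0)).2.1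
  have h3 : S.excess D₀ = S.excess ⇑(D₀ + Da : P →₀ ℤ) :=
    Submodule.eq_of_le_of_finrank_le h1 (hmax _ (add_nonneg hD₀ hDa0))
  rw [h3]
  exact ⟨a, A_mono (le_add_of_nonneg_left hD₀ : Da ≤ D₀ + Da) haA, rfl⟩

theorem finiteDimensional_H1_zero : FiniteDimensional k (S.H1 0) := by
  obtain ⟨D, hD, htop⟩ := exists_excess_eq_top (S := S) hx
  have hfin := (finrank_L_add_finrank_excess (S := S) D hD).2.1
  rw [htop] at hfin
  exact Module.finite_def.mpr ((Submodule.fg_top _).mp (Module.finite_def.mp hfin))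

lemma exists_A_sup_range_eq_top :
    ∃ D : P →₀ ℤ, S.A D ⊔ LinearMap.range S.diag.toLinearMap = ⊤ := by
  obtain ⟨D, hD, htop⟩ := exists_excess_eq_top (S := S) hx
  refine ⟨D, ?_⟩
  rw [eq_top_iff]
  intro a _
  have h1 : (S.A 0 ⊔ LinearMap.range S.diag.toLinearMap).mkQ a ∈ S.excess D := htop ▸ trivial
  obtain ⟨b, hb, hab⟩ := h1
  rw [← sub_eq_zero, ← map_sub, Submodule.mkQ_apply, Submodule.Quotient.mk_eq_zero] at hab
  have h2 : b - (b - a) ∈ S.A D ⊔ LinearMap.range S.diag.toLinearMap :=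
    sub_mem (Submodule.mem_sup_left hb) ((sup_le_sup_right (A_zero_le hD) _ :
      S.A 0 ⊔ LinearMap.range S.diag.toLinearMap ≤ _) hab)
  rwa [sub_sub_cancel] at h2

/-! ### The theorem of Riemann–Roch -/

/-- The theorem of Riemann–Roch, in the form `χ(D) = deg D + χ(0)`. -/
theorem riemannRoch_aux (D : P →₀ ℤ) : FiniteDimensional k (S.L D) ∧ FiniteDimensional k (S.H1 D) ∧
    (Module.finrank k (S.L D) : ℤ) - Module.finrank k (S.H1 D)
      = D.degree + 1 - Module.finrank k (S.H1 0) := by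
  refine Finsupp.divisor_induction (C := fun D => FiniteDimensional k (S.L D) ∧
    FiniteDimensional k (S.H1 D) ∧ (Module.finrank k (S.L D) : ℤ) - Module.finrank k (S.H1 D)
      = D.degree + 1 - Module.finrank k (S.H1 0)) ?_ ?_ D
  · rw [Finsupp.coe_zero, L_zero]
    refine ⟨inferInstance, finiteDimensional_H1_zero hx, ?_⟩
    rw [finrank_span_singleton one_ne_zero]
    simp
  · intro D p
    obtain ⟨e, he, hA⟩ := exists_A_add_single (S := S) D p
    have hdeg : (D + Finsupp.single p 1).degree = D.degree + 1 := by simp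
    change _ ↔ FiniteDimensional k
        ↥((S.A ⇑(D + Finsupp.single p 1 : P →₀ ℤ)).comap S.diag.toLinearMap) ∧
      FiniteDimensional k (S.adele ⧸ S.A ⇑(D + Finsupp.single p 1 : P →₀ ℤ) ⊔
        LinearMap.range S.diag.toLinearMap) ∧
      (Module.finrank k ↥((S.A ⇑(D + Finsupp.single p 1 : P →₀ ℤ)).comap S.diag.toLinearMap) : ℤ)
      - Module.finrank k (S.adele ⧸ S.A ⇑(D + Finsupp.single p 1 : P →₀ ℤ) ⊔
        LinearMap.range S.diag.toLinearMap) = _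
    rw [hdeg, hA]
    rcases Submodule.comap_or_sup_range_of_sup_span S.diag.toLinearMap (S.A D) he with
      ⟨y, hy, hy1, hy2⟩ | ⟨hy1, hy, hy2⟩
    · rw [hy1, hy2]
      change _ ↔ FiniteDimensional k ↥(S.L D ⊔ k ∙ y) ∧ FiniteDimensional k (S.H1 D) ∧
        (Module.finrank k ↥(S.L D ⊔ k ∙ y) : ℤ) - Module.finrank k (S.H1 D) = _
      rw [Submodule.finite_sup_span_singleton_iff]
      refine and_congr_right fun h1 => and_congr_right fun h2 => ?_
      rw [Submodule.finrank_sup_span_singleton_of_notMem (S.L D) hy]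
      push_cast
      constructor <;> intro h <;> linarith
    · rw [hy1, hy2]
      change _ ↔ FiniteDimensional k ↥(S.L D) ∧ _ ∧ (Module.finrank k ↥(S.L D) : ℤ) - _ = _
      rw [Submodule.finite_quotient_sup_span_singleton_iff]
      refine and_congr_right fun h1 => and_congr_right fun h2 => ?_
      have h3 := Submodule.finrank_quotient_sup_span_singleton _ hy
      rw [show Module.finrank k (S.H1 D) = _ from h3.symm]
      push_cast
      constructor <;> intro h <;> linarith

end Riemann

end PlaceSystem

/-- Every subspace of a vector space is the image of a projection. -/
lemma Submodule.exists_projection {k V : Type*} [Field k] [AddCommGroup V] [Module k V]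
    (E : Submodule k V) : ∃ Q : V →ₗ[k] E, ∀ x : E, Q x = x := by
  obtain ⟨Q, hQ⟩ := LinearMap.exists_leftInverse_of_injective E.subtype (Submodule.ker_subtype E)
  exact ⟨Q, fun x => LinearMap.congr_fun hQ x⟩

namespace PlaceSystem

open IntermediateField

variable {k K P : Type*} [Field k] [Field K] [Algebra k K] {S : PlaceSystem k K P}

/-! ### The local residue -/

/-- `F p m / F p (m + j)` has dimension `j`. -/
lemma finrank_F_quotient (p : P) (m : ℤ) (j : ℕ) :
    FiniteDimensional k (S.F p m ⧸ (S.F p (m + j)).comap (S.F p m).subtype) ∧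
    Module.finrank k (S.F p m ⧸ (S.F p (m + j)).comap (S.F p m).subtype) = j := by
  induction j with
  | zero =>
    have : (S.F p (m + (0 : ℕ))).comap (S.F p m).subtype = ⊤ := by
      rw [eq_top_iff]; intro x _; simp
    rw [this]
    exact ⟨inferInstance, Module.finrank_zero_of_subsingleton⟩
  | succ j ih =>
    obtain ⟨h1, h2⟩ := ih
    obtain ⟨e, he, hv⟩ := S.exists_v_eq p (m + j)
    have heF : e ∈ S.F p m := F_anti p (by omega) (mem_F_v p e)
    have hnot : (⟨e, heF⟩ : S.F p m) ∉ (S.F p (m + j + 1)).comap (S.F p m).subtype :=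
      notMem_F_of_v he (by omega)
    have hsup : (S.F p (m + j)).comap (S.F p m).subtype
        = (S.F p (m + j + 1)).comap (S.F p m).subtype ⊔ k ∙ (⟨e, heF⟩ : S.F p m) := by
      apply le_antisymm
      · intro x hx
        obtain ⟨c, hc⟩ := exists_sub_smul_mem he hv hx
        rw [← sub_add_cancel x (c • ⟨e, heF⟩)]
        exact Submodule.add_mem_sup hc
          (Submodule.smul_mem _ _ (Submodule.mem_span_singleton_self _))
      · refine sup_le (Submodule.comap_mono (F_anti p (by omega))) ?_
        rw [Submodule.span_singleton_le_iff_mem]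
        exact F_anti p (by omega) (mem_F_v p e)
    rw [Nat.cast_succ, ← add_assoc]
    rw [hsup, Submodule.finite_quotient_sup_span_singleton_iff] at h1
    refine ⟨h1, ?_⟩
    rw [← Submodule.finrank_quotient_sup_span_singleton _ hnot, ← hsup, h2]

/-- If `h` has order at least `j`, `f` has order at least `-j`, and `f h` takes the value `c` at
`p`, then the residue of `f dh` is `j c`. -/
lemma tateResidue_local {p : P} {m : ℤ} {Q : K →ₗ[k] S.F p m} (hQ : ∀ x : S.F p m, Q x = x)
    {j : ℕ} {f h : K} (hf : f ∈ S.F p (-j)) (hh : h ∈ S.F p j) {c : k}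
    (hc : f * h - algebraMap k K c ∈ S.F p 1) :
    IsFiniteRank (toeplitz Q f ∘ₗ toeplitz Q h - toeplitz Q h ∘ₗ toeplitz Q f) ∧
      tateResidue Q f h = j * c := by
  set Z := toeplitz Q f ∘ₗ toeplitz Q h - toeplitz Q h ∘ₗ toeplitz Q f with hZ
  set M := (S.F p (m + j)).comap (S.F p m).subtype with hM
  obtain ⟨hfin, hrank⟩ := finrank_F_quotient (S := S) p m j
  have hQ' : ∀ y (hy : y ∈ S.F p m), (Q y : K) = y := fun y hy => by
    rw [hQ ⟨y, hy⟩]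
  have hZapp : ∀ x : S.F p m, (Z x : K) = f * h * x - h * Q (f * x) := by
    intro x
    have h1 : h * x.1 ∈ S.F p m := mul_mem_F' hh x.2 (by omega)
    have h2 : f * (h * x.1) ∈ S.F p m := mul_mem_F' hf (mul_mem_F hh x.2) (by omega)
    have h3 : h * (Q (f * x.1)).1 ∈ S.F p m := mul_mem_F' hh (Q (f * x.1)).2 (by omega)
    simp only [hZ, LinearMap.sub_apply, LinearMap.comp_apply, toeplitz_apply,
      AddSubgroupClass.coe_sub]
    rw [hQ' _ h1, hQ' _ h2, hQ' _ h3, mul_assoc]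
  have hker : M ≤ LinearMap.ker Z := by
    intro x hx
    rw [LinearMap.mem_ker]
    apply Subtype.ext
    have h1 : f * x.1 ∈ S.F p m := mul_mem_F' hf hx (by omega)
    rw [hZapp, hQ' _ h1]
    simp only [ZeroMemClass.coe_zero]; ring
  have hfr : IsFiniteRank Z := by
    rw [← Submodule.liftQ_mkQ M Z hker]
    exact (IsFiniteRank.of_finiteDimensional_domain _).comp_right _
  refine ⟨hfr, ?_⟩
  rw [tateResidue, ← hZ, finiteRankTrace_eq_trace_quotient Z M hker]
  set Y := M.mkQ ∘ₗ M.liftQ Z hker with hY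
  -- on the quotient, `Y` is multiplication by `f h`, hence the sum of `c` and a nilpotent operator
  have hu : f * h - algebraMap k K c ∈ S.F p 0 := F_anti p (by omega) hc
  set N : Module.End k (S.F p m ⧸ M) := Y - c • LinearMap.id with hNdef
  have hN : ∀ x : S.F p m, N (M.mkQ x)
      = M.mkQ ⟨(f * h - algebraMap k K c) * x, mul_mem_F' hu x.2 (by omega)⟩ := by
    intro x
    have h1 : N (M.mkQ x) = M.mkQ (Z x - c • x) := by
      simp [hNdef, hY]
    rw [h1, ← sub_eq_zero, ← map_sub, Submodule.mkQ_apply, Submodule.Quotient.mk_eq_zero]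
    have h2 : ((Z x - c • x - ⟨(f * h - algebraMap k K c) * x, mul_mem_F' hu x.2 (by omega)⟩ :
        S.F p m) : K) = -(h * Q (f * x)) := by
      simp only [AddSubgroupClass.coe_sub, hZapp, SetLike.val_smul, Algebra.smul_def]; ring
    change (_ : K) ∈ S.F p (m + j)
    rw [Submodule.subtype_apply, h2]
    exact neg_mem (mul_mem_F' hh (Q (f * x.1)).2 (by omega))
  have hpow : ∀ (i : ℕ) (x : S.F p m), ∃ y : S.F p m, (y : K) ∈ S.F p (m + i) ∧
      (N ^ i) (M.mkQ x) = M.mkQ y := by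
    intro i x
    induction i with
    | zero => exact ⟨x, by simp, by simp⟩
    | succ i ih =>
      obtain ⟨y, hy, hxy⟩ := ih
      refine ⟨⟨(f * h - algebraMap k K c) * y, mul_mem_F' hu y.2 (by omega)⟩,
        mul_mem_F' hc hy (by push_cast; omega), ?_⟩
      rw [pow_succ', Module.End.mul_apply, hxy, hN]
  have hnil : IsNilpotent N := by
    refine ⟨j, ?_⟩
    ext x
    obtain ⟨y, hy, hxy⟩ := hpow j x
    rw [LinearMap.comp_apply, hxy, Submodule.mkQ_apply]
    exact (Submodule.Quotient.mk_eq_zero _).mpr hy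
  have htr := (LinearMap.isNilpotent_trace_of_isNilpotent hnil).eq_zero
  rw [hNdef, map_sub, map_smul, LinearMap.trace_id, hrank, sub_eq_zero] at htr
  rw [htr, smul_eq_mul, mul_comm]

lemma tateResidue_swap {R : Type*} [CommRing R] [Algebra k R] {E : Submodule k R} {Q : R →ₗ[k] E}
    {f g : R} (h : IsFiniteRank (toeplitz Q f ∘ₗ toeplitz Q g - toeplitz Q g ∘ₗ toeplitz Q f)) :
    IsFiniteRank (toeplitz Q g ∘ₗ toeplitz Q f - toeplitz Q f ∘ₗ toeplitz Q g) ∧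
    tateResidue Q g f = -tateResidue Q f g := by
  have e : toeplitz Q g ∘ₗ toeplitz Q f - toeplitz Q f ∘ₗ toeplitz Q g
      = -(toeplitz Q f ∘ₗ toeplitz Q g - toeplitz Q g ∘ₗ toeplitz Q f) := by
    ext x; simp
  rw [tateResidue, tateResidue, ← finiteRankTrace_neg h, e]
  exact ⟨h.neg, rfl⟩

lemma toeplitz_commutator_sub_algebraMap {R : Type*} [CommRing R] [Algebra k R] {E : Submodule k R}
    {Q : R →ₗ[k] E} (hQ : ∀ x : E, Q x = x) (f g : R) (c : k) :
    toeplitz Q f ∘ₗ toeplitz Q (g - algebraMap k R c) -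
      toeplitz Q (g - algebraMap k R c) ∘ₗ toeplitz Q f
    = toeplitz Q f ∘ₗ toeplitz Q g - toeplitz Q g ∘ₗ toeplitz Q f := by
  have h : toeplitz Q (g - algebraMap k R c) = toeplitz Q g - c • LinearMap.id := by
    ext x
    simp only [toeplitz_apply, LinearMap.sub_apply, LinearMap.smul_apply, LinearMap.id_apply, sub_mul,
      map_sub, ← Algebra.smul_def, map_smul, hQ]
  rw [h, LinearMap.comp_sub, LinearMap.sub_comp, LinearMap.comp_smul, LinearMap.smul_comp,
    LinearMap.comp_id, LinearMap.id_comp]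
  abel

/-- After subtraction of a constant, a nonconstant function has a zero or a pole at a given point. -/
lemma exists_sub_const {g : K} (hg : Transcendental k g) (p : P) :
    ∃ c : k, S.v p (g - algebraMap k K c) ≠ 0 := by
  by_cases h : S.v p g < 0
  · exact ⟨0, by simpa using h.ne⟩
  · obtain ⟨c, hc⟩ := exists_sub_algebraMap_mem (S := S) (p := p) (f := g) fun _ => not_lt.mp h
    have := hc (sub_algebraMap_ne_zero hg c)
    exact ⟨c, by omega⟩

/-- If `g - c` has order `e ≠ 0`, then the residue of `f dg` vanishes for `f` of order at least
`1 - e`, and the residue of `(g - c)⁻¹ dg` is `e`. -/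
lemma tateResidue_local_of_sub {p : P} {m : ℤ} {Q : K →ₗ[k] S.F p m}
    (hQ : ∀ x : S.F p m, Q x = x) {g : K} {c : k} (hg : g - algebraMap k K c ≠ 0) {f : K} :
    (f ∈ S.F p (1 - S.v p (g - algebraMap k K c)) →
      IsFiniteRank (toeplitz Q f ∘ₗ toeplitz Q g - toeplitz Q g ∘ₗ toeplitz Q f) ∧
      tateResidue Q f g = 0) ∧
    (f = (g - algebraMap k K c)⁻¹ →
      IsFiniteRank (toeplitz Q f ∘ₗ toeplitz Q g - toeplitz Q g ∘ₗ toeplitz Q f) ∧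
      tateResidue Q f g = (S.v p (g - algebraMap k K c) : ℤ)) := by
  set h := g - algebraMap k K c with hh
  have hcomm := toeplitz_commutator_sub_algebraMap hQ f g c
  rw [tateResidue, ← hcomm, ← hh, ← tateResidue]
  have hhv := S.mem_F_v p h
  obtain ⟨j, hj | hj⟩ := (S.v p h).eq_nat_or_neg <;> rw [hj] at hhv ⊢
  · constructor
    · intro hf
      simpa using tateResidue_local hQ (c := 0) (F_anti p (by omega) hf) hhv
        (by simpa using mul_mem_F' hf hhv (by omega))
    · rintro rfl
      have h1 : h⁻¹ ∈ S.F p (-j) := fun _ => by rw [S.v_inv p hg, hj]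
      simpa using tateResidue_local hQ (c := 1) h1 hhv (by simp [inv_mul_cancel₀ hg])
  · constructor
    · intro hf
      have := tateResidue_local hQ (c := 0) hhv (F_anti p (by omega) hf)
        (by simpa using mul_mem_F' hhv hf (by omega))
      obtain ⟨h2, h3⟩ := tateResidue_swap this.1
      exact ⟨h2, by rw [h3, this.2]; simp⟩
    · rintro rfl
      have h1 : h⁻¹ ∈ S.F p j := fun _ => by rw [S.v_inv p hg, hj]; simp
      have := tateResidue_local hQ (c := 1) hhv h1 (by simp [mul_inv_cancel₀ hg])
      obtain ⟨h2, h3⟩ := tateResidue_swap this.1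
      exact ⟨h2, by rw [h3, this.2]; simp⟩

/-! ### The residue functional on the adeles -/

/-- A commutator of Toeplitz operators that factors through a direct summand has the trace of its
restriction to the summand. -/
lemma tateResidue_eq_of_factor {R V : Type*} [CommRing R] [Algebra k R] [AddCommGroup V]
    [Module k V] {E : Submodule k R} {Q : R →ₗ[k] E} {a g : R} {ι : V →ₗ[k] E} {π : E →ₗ[k] V}
    {Z : V →ₗ[k] V} (hZ : IsFiniteRank Z) (hπι : ∀ x, π (ι x) = x)
    (h : ∀ x : E, Q (a * Q (g * x)) - Q (g * Q (a * x)) = ι (Z (π x))) :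
    tateResidue Q a g = finiteRankTrace Z := by
  have hcomm : toeplitz Q a ∘ₗ toeplitz Q g - toeplitz Q g ∘ₗ toeplitz Q a = ι ∘ₗ (Z ∘ₗ π) :=
    LinearMap.ext h
  have e : π ∘ₗ ι = LinearMap.id := LinearMap.ext hπι
  rw [tateResidue, hcomm, finiteRankTrace_comp_comm (hZ.comp_right π), LinearMap.comp_assoc, e,
    LinearMap.comp_id]

lemma tateResidue_eq_zero_of_commute {R : Type*} [CommRing R] [Algebra k R] {E : Submodule k R}
    {Q : R →ₗ[k] E} {a g : R} (h : ∀ x : E, Q (a * Q (g * x)) = Q (g * Q (a * x))) :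
    tateResidue Q a g = 0 := by
  have hcomm : toeplitz Q a ∘ₗ toeplitz Q g - toeplitz Q g ∘ₗ toeplitz Q a = 0 :=
    LinearMap.ext fun x => sub_eq_zero.mpr (h x)
  rw [tateResidue, hcomm, finiteRankTrace_zero]

/-- Spaces of adeles of order bounded below are commensurable. -/
lemma finiteDimensional_map_A (D E : P →₀ ℤ) :
    FiniteDimensional k ((S.A E).map (S.A D).mkQ) := by
  have key : ∀ B : P →₀ ℤ, 0 ≤ B →
      FiniteDimensional k ((S.A ⇑(D + B : P →₀ ℤ)).map (S.A D).mkQ) := by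
    intro B hB
    refine Finsupp.effective_induction (C := fun B =>
      FiniteDimensional k ((S.A ⇑(D + B : P →₀ ℤ)).map (S.A D).mkQ)) ?_ ?_ B hB
    · have : (S.A ⇑(D + 0 : P →₀ ℤ)).map (S.A D).mkQ = ⊥ := by
        rw [add_zero, eq_bot_iff, Submodule.map_le_iff_le_comap, Submodule.comap_bot,
          Submodule.ker_mkQ]
      rw [this]
      infer_instance
    · intro B p _ ih
      obtain ⟨e, -, he⟩ := exists_A_add_single (S := S) (D + B) p
      rw [← add_assoc, he, Submodule.map_sup, Submodule.map_span, Set.image_singleton]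
      infer_instance
  have h1 : 0 ≤ (D ⊔ E) - D := sub_nonneg.mpr le_sup_left
  have h2 := key _ h1
  rw [add_sub_cancel] at h2
  exact Submodule.finiteDimensional_of_le (S₂ := (S.A ⇑(D ⊔ E : P →₀ ℤ)).map (S.A D).mkQ)
    (Submodule.map_mono (A_mono (le_sup_right : E ≤ D ⊔ E)))

lemma mul_mem_A {D E : P → ℤ} {a b : S.adele} (ha : a ∈ S.A D) (hb : b ∈ S.A E) :
    a * b ∈ S.A (D + E) := fun p => mul_mem_F' (ha p) (hb p) (by simp [add_comm])

lemma almostPreserves_A (D : P →₀ ℤ) (a : S.adele) : AlmostPreserves (S.A D) a := by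
  obtain ⟨E, hE, ha⟩ := exists_mem_A a
  have := finiteDimensional_map_A (S := S) D (E + D)
  refine IsFiniteRank.of_range_le ((S.A ⇑(E + D : P →₀ ℤ)).map (S.A D).mkQ) fun x => ?_
  exact ⟨a * x.1, mul_mem_A ha x.2, rfl⟩

variable (S)

/-- A chosen projection onto `F p m`. -/
noncomputable def proj (p : P) (m : ℤ) : K →ₗ[k] S.F p m :=
  (S.F p m).exists_projection.choose

lemma proj_apply (p : P) (m : ℤ) (x : S.F p m) : S.proj p m x = x :=
  (S.F p m).exists_projection.choose_spec x

/-- The projection onto `A(D)` with components the chosen projections. -/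
noncomputable def projA (D : P →₀ ℤ) : S.adele →ₗ[k] S.A D where
  toFun a := ⟨⟨fun p => S.proj p (-D p) (a.1 p), by
    refine D.support.finite_toSet.subset fun p hp => ?_
    by_contra h
    have h0 : D p = 0 := Finsupp.notMem_support_iff.mp h
    have := (S.proj p (-D p) (a.1 p)).2
    rw [Set.mem_ofPred_eq] at hp
    exact hp (F_anti p (by omega) this)⟩, fun p => (S.proj p (-D p) (a.1 p)).2⟩
  map_add' a b := by
    apply Subtype.ext; apply Subtype.ext; funext p
    exact congrArg Subtype.val (map_add (S.proj p (-D p)) (a.1 p) (b.1 p))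
  map_smul' c a := by
    apply Subtype.ext; apply Subtype.ext; funext p
    exact congrArg Subtype.val (map_smul (S.proj p (-D p)) c (a.1 p))

variable {S}

lemma projA_val (D : P →₀ ℤ) (a : S.adele) (p : P) :
    (S.projA D a).1.1 p = S.proj p (-D p) (a.1 p) := rfl

lemma projA_apply (D : P →₀ ℤ) (x : S.A D) : S.projA D x = x := by
  apply Subtype.ext; apply Subtype.ext; funext p
  rw [projA_val, S.proj_apply p (-D p) ⟨x.1.1 p, x.2 p⟩]

/-- The residue of an adele concentrated at `p` is the local residue. -/
lemma tateResidue_single (D : P →₀ ℤ) (p : P) (f g : K)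
    (h : IsFiniteRank (toeplitz (S.proj p (-D p)) f ∘ₗ toeplitz (S.proj p (-D p)) g -
      toeplitz (S.proj p (-D p)) g ∘ₗ toeplitz (S.proj p (-D p)) f)) :
    tateResidue (S.projA D) (S.single p f) (S.diag g) = tateResidue (S.proj p (-D p)) f g := by
  set Z := toeplitz (S.proj p (-D p)) f ∘ₗ toeplitz (S.proj p (-D p)) g -
      toeplitz (S.proj p (-D p)) g ∘ₗ toeplitz (S.proj p (-D p)) f with hZ
  let ι : S.F p (-D p) →ₗ[k] S.A D :=
    ((S.single p).comp (S.F p (-D p)).subtype).codRestrict (S.A D) fun x => single_mem_A.mpr x.2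
  let π : S.A D →ₗ[k] S.F p (-D p) :=
    { toFun := fun x => ⟨x.1.1 p, x.2 p⟩
      map_add' := fun _ _ => rfl
      map_smul' := fun _ _ => rfl }
  have hπι : ∀ x, π (ι x) = x := fun x => Subtype.ext (single_same (S := S) p x.1)
  refine tateResidue_eq_of_factor h hπι fun x => ?_
  apply Subtype.ext; apply Subtype.ext; funext q
  change ((S.proj q (-D q) ((S.single p f).1 q * (S.proj q (-D q) (g * x.1.1 q)).1)).1
    - (S.proj q (-D q) (g * (S.proj q (-D q) ((S.single p f).1 q * x.1.1 q)).1)).1 : K)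
    = (S.single p (Z (π x)).1).1 q
  by_cases hq : q = p
  · subst hq
    rw [single_same, single_same]
    rfl
  · rw [single_of_ne hq, single_of_ne hq]
    simp

/-- The residue of `a dg` vanishes if at every point `a` is zero or both `a` and `g` are regular. -/
lemma tateResidue_eq_zero_of_regular (D : P →₀ ℤ) (a : S.adele) (g : K)
    (h : ∀ p, a.1 p = 0 ∨ (a.1 p ∈ S.F p 0 ∧ g ∈ S.F p 0)) :
    tateResidue (S.projA D) a (S.diag g) = 0 := by
  have e : ∀ q, ∀ y ∈ S.F q (-D q), (S.proj q (-D q) y : K) = y := fun q y hy => by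
    rw [S.proj_apply q (-D q) ⟨y, hy⟩]
  refine tateResidue_eq_zero_of_commute fun x => ?_
  apply Subtype.ext; apply Subtype.ext; funext q
  change ((S.proj q (-D q) (a.1 q * (S.proj q (-D q) (g * x.1.1 q)).1)).1 : K)
    = (S.proj q (-D q) (g * (S.proj q (-D q) (a.1 q * x.1.1 q)).1)).1
  rcases h q with h0 | ⟨h1, h2⟩
  · rw [h0]; simp
  · have hx := x.2 q
    have hgx := mul_mem_F' h2 hx (l := -D q) (by omega)
    have hax := mul_mem_F' h1 hx (l := -D q) (by omega)
    rw [e q _ hgx, e q _ hax, e q _ (mul_mem_F' h2 hax (by omega)),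
      e q _ (mul_mem_F' h1 hgx (by omega))]
    ring

variable (S)

/-- The order of the differential `dg` at `p`, described without differentials: it is one less than
the order of `g - c`, where the constant `c` is such that `g - c` has a zero or a pole at `p`. -/
noncomputable def ordD (g : K) (hg : Transcendental k g) (p : P) : ℤ :=
  S.v p (g - algebraMap k K (S.exists_sub_const hg p).choose) - 1

/-- The functional `a ↦ ∑ res (a dg)` on the adeles: it vanishes on principal adeles by the
residue theorem, it vanishes on the adeles `a` for which `a dg` is regular, and it detects simple
poles of `a dg`. -/
theorem exists_residue_functional [CharZero k] {g : K} (hg : Transcendental k g)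
    [FiniteDimensional k⟮g⟯ K] :
    ∃ r : S.adele →ₗ[k] k, (∀ f, r (S.diag f) = 0) ∧ (∀ a ∈ S.A (S.ordD g hg), r a = 0) ∧
      ∀ p, ∃ f ∈ S.F p (-S.ordD g hg p - 1), r (S.single p f) ≠ 0 := by
  classical
  obtain ⟨D, hD⟩ := exists_A_sup_range_eq_top (S := S) hg
  have hP := projA_apply (S := S) D
  have hA := almostPreserves_A (S := S) D
  let r : S.adele →ₗ[k] k :=
    { toFun := fun a => tateResidue (S.projA D) a (S.diag g)
      map_add' := fun a b => tateResidue_add hP (hA a) (hA b) (hA _)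
      map_smul' := fun c a => tateResidue_smul hP c (hA a) (hA _) }
  have hr : ∀ a, r a = tateResidue (S.projA D) a (S.diag g) := fun _ => rfl
  have hloc := fun p f => tateResidue_local_of_sub (S := S) (p := p) (m := -D p) (f := f)
    (S.proj_apply p (-D p)) (sub_algebraMap_ne_zero hg (S.exists_sub_const hg p).choose)
  refine ⟨r, fun f => ?_, fun a ha => ?_, fun p => ?_⟩
  · have hfin : FiniteDimensional k ↥(S.A D ⊓ LinearMap.range S.diag.toLinearMap) := by
      have : FiniteDimensional k (S.L D) := (riemannRoch_aux (S := S) hg D).1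
      refine Submodule.finiteDimensional_of_le (S₂ := (S.L D).map S.diag.toLinearMap) ?_
      rintro _ ⟨h1, ⟨f, rfl⟩⟩
      exact ⟨f, h1, rfl⟩
    refine tateResidue_eq_zero_of_preserves hP (LinearMap.range S.diag.toLinearMap) hD
      (hA _) (hA _) ?_ ?_ <;>
    · rintro _ ⟨y, rfl⟩
      exact ⟨_, map_mul S.diag _ _⟩
  · -- split off the components at the poles of `a` and `g`
    set T : Finset P := ((mem_adele.mp a.2).union (finite_notMem_F (S := S) g)).toFinset with hT
    set b := a - ∑ p ∈ T, S.single p (a.1 p) with hb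
    have hbp : ∀ q, b.1 q = if q ∈ T then 0 else a.1 q := by
      intro q
      have h1 : b.1 q = a.1 q - ∑ p ∈ T, (S.single p (a.1 p)).1 q := by
        have h2 : (∑ p ∈ T, S.single p (a.1 p)).1 = ∑ p ∈ T, (S.single p (a.1 p)).1 :=
          map_sum S.adele.val _ _
        rw [hb]
        change a.1 q - (∑ p ∈ T, S.single p (a.1 p)).1 q = _
        rw [h2, Finset.sum_apply]
      rw [h1]
      split_ifs with hq
      · rw [Finset.sum_eq_single q (fun p _ hp => single_of_ne hp.symm _) (fun h => absurd hq h),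
          single_same, sub_self]
      · rw [Finset.sum_eq_zero, sub_zero]
        intro p hp
        exact single_of_ne (fun h : q = p => hq (h ▸ hp)) _
    have hb0 : r b = 0 := by
      refine tateResidue_eq_zero_of_regular D b g fun p => ?_
      rw [hbp]
      split_ifs with hp
      · exact Or.inl rfl
      · right
        rw [hT, Set.Finite.mem_toFinset, Set.mem_union, not_or] at hp
        exact ⟨not_not.mp hp.1, not_not.mp hp.2⟩
    have ha' : a = b + ∑ p ∈ T, S.single p (a.1 p) := by rw [hb, sub_add_cancel]
    rw [ha', map_add, hb0, zero_add, map_sum]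
    refine Finset.sum_eq_zero fun p _ => ?_
    have h1 := ((hloc p _).1 (F_anti p (by rw [ordD]; omega) (ha p)))
    rw [hr, tateResidue_single D p _ g h1.1, h1.2]
  · obtain ⟨h1, h2⟩ := (hloc p _).2 rfl
    refine ⟨(g - algebraMap k K (S.exists_sub_const hg p).choose)⁻¹, fun _ => ?_, ?_⟩
    · rw [S.v_inv p (sub_algebraMap_ne_zero hg _), ordD]
      omega
    · rw [hr, tateResidue_single D p _ g h1, h2]
      exact_mod_cast (S.exists_sub_const hg p).choose_spec

end PlaceSystem

namespace PlaceSystem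

open IntermediateField

variable {k K P : Type*} [Field k] [Field K] [Algebra k K] {S : PlaceSystem k K P}

/-! ### Duality -/

/-- The functionals on the adeles that vanish on `A(D)` and on the principal adeles: the dual of
`H¹(D)`. -/
def ann (S : PlaceSystem k K P) (D : P → ℤ) : Submodule k (Module.Dual k S.adele) :=
  (S.A D ⊔ LinearMap.range S.diag.toLinearMap).dualAnnihilator

lemma mem_ann {D : P → ℤ} {μ : Module.Dual k S.adele} :
    μ ∈ S.ann D ↔ (∀ a ∈ S.A D, μ a = 0) ∧ ∀ f, μ (S.diag f) = 0 := by
  rw [ann, Submodule.mem_dualAnnihilator]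
  constructor
  · exact fun h => ⟨fun a ha => h a (Submodule.mem_sup_left ha),
      fun f => h _ (Submodule.mem_sup_right ⟨f, rfl⟩)⟩
  · rintro ⟨h1, h2⟩ a ha
    obtain ⟨b, hb, _, ⟨f, rfl⟩, rfl⟩ := Submodule.mem_sup.mp ha
    rw [map_add, h1 b hb, zero_add]
    exact h2 f

lemma ann_anti {D E : P → ℤ} (h : D ≤ E) : S.ann E ≤ S.ann D := fun _ hμ =>
  mem_ann.mpr ⟨fun a ha => (mem_ann.mp hμ).1 a (A_mono h ha), (mem_ann.mp hμ).2⟩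

lemma finrank_ann (D : P → ℤ) [FiniteDimensional k (S.H1 D)] :
    FiniteDimensional k (S.ann D) ∧ Module.finrank k (S.ann D) = Module.finrank k (S.H1 D) := by
  let e := Submodule.dualQuotEquivDualAnnihilator (S.A D ⊔ LinearMap.range S.diag.toLinearMap)
  refine ⟨Module.Finite.equiv e, ?_⟩
  rw [← Subspace.dual_finrank_eq (K := k) (V := S.H1 D)]
  exact (LinearEquiv.finrank_eq e).symm

/-- The action of the functions on the functionals on the adeles: `f` takes `μ` to `a ↦ μ (f a)`. -/
def twist (μ : Module.Dual k S.adele) : K →ₗ[k] Module.Dual k S.adele where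
  toFun f := μ ∘ₗ LinearMap.mulLeft k (S.diag f)
  map_add' f g := by ext a; simp [add_mul]
  map_smul' c f := by ext a; simp

@[simp] lemma twist_apply (μ : Module.Dual k S.adele) (f : K) (a : S.adele) :
    twist μ f a = μ (S.diag f * a) := rfl

lemma diag_mul_diag_inv_mul {f : K} (hf : f ≠ 0) (a : S.adele) :
    S.diag f * (S.diag f⁻¹ * a) = a := by
  rw [← mul_assoc, ← map_mul, mul_inv_cancel₀ hf, map_one, one_mul]

lemma twist_injective {μ : Module.Dual k S.adele} (hμ : μ ≠ 0) :
    Function.Injective (twist (S := S) μ) := by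
  rw [injective_iff_map_eq_zero]
  intro f h
  by_contra hf
  refine hμ (LinearMap.ext fun a => ?_)
  rw [← diag_mul_diag_inv_mul hf a, ← twist_apply, h]
  rfl

lemma twist_mem_ann {E G : P → ℤ} {μ : Module.Dual k S.adele} (hμ : μ ∈ S.ann E) {f : K}
    (hf : f ∈ S.L G) : twist μ f ∈ S.ann (E - G) := by
  refine mem_ann.mpr ⟨fun a ha => ?_, fun h => ?_⟩
  · have := mul_mem_A (Submodule.mem_comap.mp hf) ha
    rw [add_sub_cancel] at this
    exact (mem_ann.mp hμ).1 _ this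
  · rw [twist_apply, ← map_mul]
    exact (mem_ann.mp hμ).2 _

/-- One half of Serre duality: twisting a nonzero functional that vanishes on `A(E)` and on the
principal adeles embeds `L(E - D)` into the dual of `H¹(D)`. -/
lemma finrank_L_le_finrank_H1 {D E : P → ℤ} {μ : Module.Dual k S.adele} (h0 : μ ≠ 0)
    (hμ : μ ∈ S.ann E) [FiniteDimensional k (S.H1 D)] :
    Module.finrank k (S.L (E - D)) ≤ Module.finrank k (S.H1 D) := by
  obtain ⟨h1, h2⟩ := finrank_ann (S := S) D
  rw [← h2]
  have hmem : ∀ f : S.L (E - D), twist μ f.1 ∈ S.ann D := fun f => by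
    have := twist_mem_ann hμ f.2
    rwa [sub_sub_cancel] at this
  refine LinearMap.finrank_le_finrank_of_injective
    (f := ((twist μ).comp (S.L (E - D)).subtype).codRestrict (S.ann D) hmem) ?_
  intro f g h
  exact Subtype.ext (twist_injective h0 (congrArg Subtype.val h))

lemma finrank_L_zero : Module.finrank k (S.L (0 : P → ℤ)) = 1 := by
  rw [L_zero]
  exact finrank_span_singleton one_ne_zero

section Canonical

variable [CharZero k] {g : K} (hg : Transcendental k g) [FiniteDimensional k⟮g⟯ K]

include hg

omit [CharZero k] [FiniteDimensional k⟮g⟯ K] in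
lemma nonempty_of_transcendental (S : PlaceSystem k K P) : Nonempty P := by
  by_contra h
  rw [not_nonempty_iff] at h
  obtain ⟨c, hc⟩ := S.eq_const g fun p => isEmptyElim p
  exact hg (hc ▸ isAlgebraic_algebraMap c)

omit [CharZero k] [FiniteDimensional k⟮g⟯ K] in
lemma ordD_nonneg {p : P} (h : g ∈ S.F p 0) : 0 ≤ S.ordD g hg p := by
  have h0 := (S.exists_sub_const hg p).choose_spec
  have h1 : 0 ≤ S.v p (g - algebraMap k K (S.exists_sub_const hg p).choose) :=
    sub_mem h (algebraMap_mem_F p _) (sub_algebraMap_ne_zero hg _)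
  rw [ordD]
  omega

/-- A rational differential has finitely many zeros and poles: by the theorem of Riemann–Roch, the
degree of the divisors bounded by its order function is bounded. -/
lemma finite_support_ordD : {p | S.ordD g hg p ≠ 0}.Finite := by
  classical
  obtain ⟨r, hr1, hr2, hr3⟩ := exists_residue_functional (S := S) hg
  obtain ⟨p₀⟩ := nonempty_of_transcendental hg S
  have hr0 : r ≠ 0 := by
    obtain ⟨f, -, hf⟩ := hr3 p₀
    rintro rfl
    exact hf rfl
  have hneg : {p | S.ordD g hg p < 0}.Finite := (finite_notMem_F (S := S) g).subset fun p hp h =>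
    (ordD_nonneg hg h).not_gt hp
  let D₁ : P →₀ ℤ := Finsupp.onFinset hneg.toFinset (fun p => min (S.ordD g hg p) 0) fun p hp => by
    rw [Set.Finite.mem_toFinset, Set.mem_ofPred_eq]
    by_contra h
    exact hp (min_eq_right (not_lt.mp h))
  have hD₁ : ∀ p, D₁ p = min (S.ordD g hg p) 0 := fun p => rfl
  have hpos : {p | 0 < S.ordD g hg p}.Finite := by
    by_contra hinf
    set N := Module.finrank k (S.H1 D₁) + Module.finrank k (S.H1 0) with hN
    obtain ⟨T, hT, hcard⟩ := Set.Infinite.exists_subset_card_eq hinf (N + 1)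
    set B : P →₀ ℤ := ∑ p ∈ T, Finsupp.single p 1 with hB
    have hBp : ∀ p, B p = if p ∈ T then 1 else 0 := fun p => by
      simp [hB, Finsupp.finsetSum_apply, Finsupp.single_apply]
    have hle : (⇑(D₁ + B) : P → ℤ) ≤ S.ordD g hg := by
      intro p
      rw [Finsupp.add_apply, hD₁, hBp]
      split_ifs with hp
      · have : 0 < S.ordD g hg p := hT hp
        rw [min_eq_right this.le]
        change (0 : ℤ) + 1 ≤ S.ordD g hg p
        omega
      · simp
    have hr : r ∈ S.ann ⇑(D₁ + B) := ann_anti hle (mem_ann.mpr ⟨hr2, hr1⟩)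
    have := (riemannRoch_aux (S := S) hg D₁).2.1
    have h1 := finrank_L_le_finrank_H1 (D := D₁) hr0 hr
    obtain ⟨-, -, h2⟩ := riemannRoch_aux (S := S) hg B
    have h3 : B.degree = N + 1 := by
      rw [hB, map_sum]
      simp [Finsupp.degree_single, hcard]
    clear_value N B
    rw [Finsupp.coe_add, add_sub_cancel_left] at h1
    omega
  refine (hneg.union hpos).subset fun p hp => ?_
  exact lt_or_gt_of_ne hp

/-- The divisor of the differential `dg`, a canonical divisor. -/
noncomputable def canon (S : PlaceSystem k K P) : P →₀ ℤ :=
  Finsupp.ofSupportFinite (S.ordD g hg) (finite_support_ordD hg)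

lemma canon_apply (p : P) : canon hg S p = S.ordD g hg p := rfl

/-- Serre duality: `H¹(D)` is dual to `L(κ - D)`, where `κ` is the divisor of `dg`; the pairing is
given by the residue functional. -/
theorem finrank_H1 (D : P →₀ ℤ) :
    Module.finrank k (S.H1 D) = Module.finrank k (S.L (canon hg S - D : P →₀ ℤ)) := by
  classical
  obtain ⟨r, hr1, hr2, hr3⟩ := exists_residue_functional (S := S) hg
  obtain ⟨p₀⟩ := nonempty_of_transcendental hg S
  have hr0 : r ≠ 0 := by
    obtain ⟨f, -, hf⟩ := hr3 p₀
    rintro rfl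
    exact hf rfl
  set κ := canon hg S with hκ
  have hr : r ∈ S.ann κ := mem_ann.mpr ⟨hr2, hr1⟩
  have RR := fun B : P →₀ ℤ => riemannRoch_aux (S := S) hg B
  have hRD := (RR D).2.1
  refine le_antisymm ?_ (finrank_L_le_finrank_H1 hr0 hr)
  -- every functional in the dual of `H¹(D)` is a twist of `r`
  have key : ∀ μ ∈ S.ann D, ∃ f ∈ S.L (κ - D : P →₀ ℤ), twist r f = μ := by
    intro μ hμ
    set D' := D ⊓ κ with hD'
    have hr' : r ∈ S.ann D' := ann_anti (Finsupp.coe_le_coe.mpr inf_le_right) hr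
    have hμ' : μ ∈ S.ann D' := ann_anti (Finsupp.coe_le_coe.mpr inf_le_left) hμ
    obtain ⟨n, hn⟩ := exists_nat_gt ((Module.finrank k (S.L D') : ℤ) - D'.degree
        + 3 * Module.finrank k (S.H1 0))
    set E : P →₀ ℤ := Finsupp.single p₀ (n : ℤ) with hE
    have hdeg : E.degree = n := Finsupp.degree_single _ _
    obtain ⟨i1, -, i2⟩ := RR E
    obtain ⟨i3, i4, i5⟩ := RR (D' - E)
    obtain ⟨i6, i7⟩ := finrank_ann (S := S) ⇑(D' - E)
    have hD'fin := (RR D').1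
    have hle : Module.finrank k (S.L ⇑(D' - E)) ≤ Module.finrank k (S.L D') := by
      refine Submodule.finrank_mono (L_mono ?_)
      rw [Finsupp.coe_le_coe, sub_le_self_iff]
      exact Finsupp.single_nonneg.mpr (by positivity)
    have hmem : ∀ x : S.L E × S.L E, twist r x.1.1 + twist μ x.2.1 ∈ S.ann ⇑(D' - E) := fun x =>
      add_mem (twist_mem_ann hr' x.1.2) (twist_mem_ann hμ' x.2.2)
    -- for `E` of large degree, the twists of `r` and of `μ` by `L(E)` cannot be independent
    let Φ : S.L E × S.L E →ₗ[k] S.ann ⇑(D' - E) :=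
      (((twist r).comp (S.L E).subtype).coprod ((twist μ).comp (S.L E).subtype)).codRestrict _ hmem
    have hΦ : ¬ Function.Injective Φ := by
      intro hinj
      have := LinearMap.finrank_le_finrank_of_injective hinj
      rw [Module.finrank_prod, i7] at this
      rw [map_sub, hdeg] at i5
      omega
    rw [injective_iff_map_eq_zero] at hΦ
    push Not at hΦ
    obtain ⟨⟨f₁, f₂⟩, h1, h2⟩ := hΦ
    have h1' : ∀ a, r (S.diag f₁.1 * a) + μ (S.diag f₂.1 * a) = 0 := fun a =>
      LinearMap.congr_fun (congrArg Subtype.val h1) a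
    have hf₂ : (f₂ : K) ≠ 0 := by
      intro h0
      have : twist r f₁.1 = 0 := LinearMap.ext fun a => by
        have := h1' a
        rwa [h0, map_zero, zero_mul, map_zero, add_zero] at this
      have h3 := twist_injective hr0 (this.trans (map_zero (twist r)).symm)
      exact h2 (Prod.ext (Subtype.ext h3) (Subtype.ext h0))
    have hμf : twist r (-f₁.1 * f₂.1⁻¹) = μ := LinearMap.ext fun a => by
      have := h1' (S.diag f₂.1⁻¹ * a)
      rw [diag_mul_diag_inv_mul hf₂, ← mul_assoc, ← map_mul] at this
      rw [twist_apply, neg_mul, map_neg, show -S.diag (f₁.1 * f₂.1⁻¹) * a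
        = -(S.diag (f₁.1 * f₂.1⁻¹) * a) from Subtype.ext (neg_mul _ _), map_neg]
      exact neg_eq_of_add_eq_zero_right this
    refine ⟨_, ?_, hμf⟩
    -- a pole of `f` not allowed by `κ - D` would contradict the detection of simple poles by `r`
    set f := -f₁.1 * f₂.1⁻¹ with hf
    intro p hf0
    by_contra hlt
    rw [Finsupp.sub_apply, canon_apply] at hlt
    obtain ⟨h, hh, hne⟩ := hr3 p
    apply hne
    have h4 : S.single p h = S.diag f * S.single p (f⁻¹ * h) := by
      apply Subtype.ext; funext q
      change _ = f * (S.single p (f⁻¹ * h)).1 q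
      by_cases hq : q = p
      · subst hq
        rw [single_same, single_same]
        exact (mul_inv_cancel_left₀ hf0 h).symm
      · rw [single_of_ne hq, single_of_ne hq, mul_zero]
    rw [h4, ← twist_apply, hμf]
    refine (mem_ann.mp hμ).1 _ (single_mem_A.mpr (mul_mem_F' (mem_F_v p f⁻¹) hh ?_))
    change ¬ _ ≤ S.v p f at hlt
    change f ≠ 0 at hf0
    rw [S.v_inv p hf0]
    omega
  rw [← (finrank_ann (S := S) ⇑D).2]
  have := (RR (κ - D)).1
  have hle : S.ann D ≤ (S.L (κ - D : P →₀ ℤ)).map (twist r) := fun μ hμ => by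
    obtain ⟨f, hf, rfl⟩ := key μ hμ
    exact Submodule.mem_map_of_mem hf
  exact (Submodule.finrank_mono hle).trans (Submodule.finrank_map_le _ _)

/-- The theorem of Riemann–Roch. -/
theorem riemannRoch (D : P →₀ ℤ) :
    (Module.finrank k (S.L D) : ℤ) - Module.finrank k (S.L (canon hg S - D : P →₀ ℤ))
      = D.degree + 1 - Module.finrank k (S.L (canon hg S)) := by
  have h1 := (riemannRoch_aux (S := S) hg D).2.2
  have h2 := finrank_H1 (S := S) hg 0
  rw [finrank_H1 hg D] at h1
  rw [sub_zero] at h2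
  rw [h1, ← h2]
  rfl

theorem degree_canon :
    (canon hg S).degree = 2 * (Module.finrank k (S.L (canon hg S)) : ℤ) - 2 := by
  have h := riemannRoch (S := S) hg (canon hg S)
  rw [sub_self, Finsupp.coe_zero, finrank_L_zero] at h
  push_cast at h
  linarith

theorem degree_div (f : K) (hf : f ≠ 0) : (S.div f hf).degree = 0 := by
  have h1 := riemannRoch (S := S) hg 0
  have h2 := riemannRoch (S := S) hg (0 - S.div f hf)
  have e : ∀ D : P →₀ ℤ, Module.finrank k (S.L D) = Module.finrank k (S.L ⇑(D - S.div f hf)) :=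
    fun D => by rw [Finsupp.coe_sub]; exact (S.mulL D f hf).finrank_eq
  have e1 := e 0
  have e2 := e (canon hg S - (0 - S.div f hf))
  rw [zero_sub, sub_neg_eq_add, add_sub_cancel_right] at e2
  rw [zero_sub] at e1
  rw [zero_sub, sub_neg_eq_add, ← e1, e2, map_neg] at h2
  rw [sub_zero, map_zero] at h1
  linarith

end Canonical

/-! ### Clifford's inequality -/

/-- A space of functions of dimension `n` has at least `n` orders of vanishing at `p`. -/
lemma exists_values (p : P) (n : ℕ) (W : Submodule k K) [FiniteDimensional k W] {m : ℤ}
    (hW : W ≤ S.F p m) (hn : Module.finrank k W = n) :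
    ∃ T : Finset ℤ, T.card = n ∧ ∀ i ∈ T, m ≤ i ∧ ∃ f ∈ W, f ≠ 0 ∧ S.v p f = i := by
  induction n generalizing W m with
  | zero => exact ⟨∅, rfl, by simp⟩
  | succ n ih =>
    have hne : ∃ i, ∃ f ∈ W, f ≠ 0 ∧ S.v p f = i := by
      obtain ⟨f, hf, h0⟩ := Submodule.exists_mem_ne_zero_of_ne_bot (p := W) (by
        rintro rfl; simp at hn)
      exact ⟨_, f, hf, h0, rfl⟩
    obtain ⟨i, ⟨e, heW, he0, hei⟩, hmin⟩ := Int.exists_least_of_bdd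
      ⟨m, fun i ⟨f, hf, h0, h⟩ => h ▸ hW hf h0⟩ hne
    have hnot : e ∉ W ⊓ S.F p (i + 1) := fun h => notMem_F_of_v he0 (by omega) h.2
    have hsup : W = W ⊓ S.F p (i + 1) ⊔ k ∙ e := by
      apply le_antisymm
      · intro f hf
        have hfi : f ∈ S.F p i := fun h0 => hmin _ ⟨f, hf, h0, rfl⟩
        obtain ⟨c, hc⟩ := exists_sub_smul_mem he0 hei hfi
        rw [← sub_add_cancel f (c • e)]
        exact Submodule.add_mem_sup ⟨sub_mem hf (W.smul_mem c heW), hc⟩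
          (Submodule.smul_mem _ _ (Submodule.mem_span_singleton_self _))
      · exact sup_le inf_le_left ((Submodule.span_singleton_le_iff_mem _ _).mpr heW)
    have hfin : FiniteDimensional k ↥(W ⊓ S.F p (i + 1)) :=
      Submodule.finiteDimensional_of_le inf_le_left
    have hrank : Module.finrank k ↥(W ⊓ S.F p (i + 1)) = n := by
      have := Submodule.finrank_sup_span_singleton_of_notMem _ hnot
      rw [← hsup, hn] at this
      omega
    obtain ⟨T, hT, hT'⟩ := ih (W ⊓ S.F p (i + 1)) inf_le_right hrank
    have hi : i ∉ T := fun h => by have := (hT' i h).1; omega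
    refine ⟨insert i T, by rw [Finset.card_insert_of_notMem hi, hT], fun j hj => ?_⟩
    rcases Finset.mem_insert.mp hj with rfl | hj
    · exact ⟨hei ▸ hW heW he0, e, heW, he0, hei⟩
    · obtain ⟨h1, f, hf, h0, h2⟩ := hT' j hj
      have : m ≤ i := hei ▸ hW heW he0
      exact ⟨by omega, f, hf.1, h0, h2⟩

/-- A space of functions of dimension `n` has at most `n` orders of vanishing at `p`. -/
lemma card_values_le (p : P) (T : Finset ℤ) (W : Submodule k K) [FiniteDimensional k W]
    (hT : ∀ i ∈ T, ∃ f ∈ W, f ≠ 0 ∧ S.v p f = i) : T.card ≤ Module.finrank k W := by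
  induction T using Finset.induction_on_min generalizing W with
  | empty => simp
  | insert i T hi ih =>
    have hiT : i ∉ T := fun h => lt_irrefl _ (hi i h)
    rw [Finset.card_insert_of_notMem hiT]
    obtain ⟨e, heW, he0, hei⟩ := hT i (Finset.mem_insert_self _ _)
    have hfin : FiniteDimensional k ↥(W ⊓ S.F p (i + 1)) :=
      Submodule.finiteDimensional_of_le inf_le_left
    have hlt : W ⊓ S.F p (i + 1) < W := lt_of_le_of_ne inf_le_left fun h =>
      notMem_F_of_v he0 (by omega) (h.symm.le heW).2
    have := ih (W ⊓ S.F p (i + 1)) fun j hj => by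
      obtain ⟨f, hf, h0, h⟩ := hT j (Finset.mem_insert_of_mem hj)
      exact ⟨f, ⟨hf, fun _ => by have := hi j hj; omega⟩, h0, h⟩
    have h2 := Submodule.finrank_lt_finrank_of_lt hlt
    omega

/-- The spaces `L(D)` and `L(E)` have as many orders of vanishing at `p` as their dimensions, and the
sums of these are orders of vanishing of products, which lie in `L(D + E)`. A sumset of two finite
sets of integers has at least as many elements as the two sets together, minus one. -/
lemma finrank_L_add_finrank_L_le (p : P) (D E : P → ℤ) [FiniteDimensional k (S.L D)]
    [FiniteDimensional k (S.L E)] [FiniteDimensional k (S.L (D + E))]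
    (hD : 1 ≤ Module.finrank k (S.L D)) (hE : 1 ≤ Module.finrank k (S.L E)) :
    Module.finrank k (S.L D) + Module.finrank k (S.L E) ≤ Module.finrank k (S.L (D + E)) + 1 := by
  classical
  obtain ⟨T₁, h1, h1'⟩ := exists_values (S := S) p _ (S.L D) (fun _ hf => hf p) rfl
  obtain ⟨T₂, h2, h2'⟩ := exists_values (S := S) p _ (S.L E) (fun _ hf => hf p) rfl
  have h3 := card_values_le (S := S) p (Finset.image₂ (· + ·) T₁ T₂) (S.L (D + E)) (by
    intro i hi
    obtain ⟨a, ha, b, hb, rfl⟩ := Finset.mem_image₂.mp hi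
    obtain ⟨-, f, hf, hf0, rfl⟩ := h1' a ha
    obtain ⟨-, h, hh, hh0, rfl⟩ := h2' b hb
    refine ⟨f * h, fun q => ?_, mul_ne_zero hf0 hh0, S.v_mul p hf0 hh0⟩
    exact mul_mem_F' (hf q) (hh q) (by simp [add_comm]))
  have h4 := cauchy_davenport_add_of_linearOrder_isCancelAdd
    (Finset.card_pos.mp (by omega) : T₁.Nonempty) (Finset.card_pos.mp (by omega) : T₂.Nonempty)
  change _ ≤ (Finset.image₂ (· + ·) T₁ T₂).card at h4
  rw [h1, h2] at h4
  omega

end PlaceSystem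

/-! ### Local rings at smooth points of a curve -/

section SmoothPoint

variable {k O : Type*} [Field k] [CommRing O] [Algebra k O]

/-- The derivation `a ↦ a - c(a) mod 𝔪²` at the rational point with evaluation map `c`, where
`𝔪 = ker c`. -/
noncomputable def cotangentDerivation (c : O →ₐ[k] k) :
    Derivation k O (RingHom.ker c).Cotangent :=
  Derivation.mk'
    { toFun := fun a => (RingHom.ker c).toCotangent ⟨a - algebraMap k O (c a), by
        simp [RingHom.mem_ker]⟩
      map_add' := fun a b => by
        rw [← map_add]; congr 1; ext; simp; ring
      map_smul' := fun r a => by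
        rw [RingHom.id_apply, ← algebraMap_smul O r (Ideal.toCotangent _ _), ← map_smul]
        congr 1; ext; simp [Algebra.smul_def, mul_sub] }
    fun a b => by
      simp only [LinearMap.coe_mk, AddHom.coe_mk]
      rw [← map_smul, ← map_smul, ← map_add, eq_comm, Ideal.toCotangent_eq]
      have : (a * (b - algebraMap k O (c b)) + b * (a - algebraMap k O (c a))) -
          (a * b - algebraMap k O (c (a * b)))
          = (a - algebraMap k O (c a)) * (b - algebraMap k O (c b)) := by
        rw [map_mul, map_mul]; ring
      change (a * (b - algebraMap k O (c b)) + b * (a - algebraMap k O (c a))) -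
          (a * b - algebraMap k O (c (a * b))) ∈ _
      rw [this, pow_two]
      exact Ideal.mul_mem_mul (by simp [RingHom.mem_ker]) (by simp [RingHom.mem_ker])

lemma cotangentDerivation_of_mem (c : O →ₐ[k] k) {a : O} (ha : a ∈ RingHom.ker c) :
    cotangentDerivation c a = (RingHom.ker c).toCotangent ⟨a, ha⟩ := by
  change (RingHom.ker c).toCotangent _ = _
  congr 1
  ext
  simp [(RingHom.mem_ker).mp ha]

lemma exists_smul_of_span_eq_top {ω : Ω[O⁄k]} (hω : Submodule.span O {ω} = ⊤) (η : Ω[O⁄k]) :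
    ∃ b : O, b • ω = η :=
  Submodule.mem_span_singleton.mp (hω ▸ Submodule.mem_top)

variable [IsLocalRing O]

lemma ker_eq_maximalIdeal_of_algHom (c : O →ₐ[k] k) : RingHom.ker c = IsLocalRing.maximalIdeal O :=
  IsLocalRing.eq_maximalIdeal (RingHom.ker_isMaximal_of_surjective c fun r =>
    ⟨algebraMap k O r, by simp⟩)

/-- If the differentials of a Noetherian local ring with a rational point are generated by one
element, then so is the maximal ideal: the differentials map onto `𝔪 / 𝔪²`. -/
lemma maximalIdeal_isPrincipal_of_span_eq_top [IsNoetherianRing O] (c : O →ₐ[k] k) {ω : Ω[O⁄k]}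
    (hω : Submodule.span O {ω} = ⊤) : (IsLocalRing.maximalIdeal O).IsPrincipal := by
  rw [← ker_eq_maximalIdeal_of_algHom c]
  set I := RingHom.ker c with hI
  obtain ⟨y, hy⟩ := I.toCotangent_surjective ((cotangentDerivation c).liftKaehlerDifferential ω)
  have hle : I ≤ Ideal.span {y.1} ⊔ I • I := by
    intro a ha
    obtain ⟨b, hb⟩ := exists_smul_of_span_eq_top hω (KaehlerDifferential.D k O a)
    have h1 := congrArg (cotangentDerivation c).liftKaehlerDifferential hb
    rw [map_smul, ← hy, Derivation.liftKaehlerDifferential_comp_D,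
      cotangentDerivation_of_mem c ha, ← map_smul, eq_comm, Ideal.toCotangent_eq] at h1
    have h2 : a = b * y.1 + (a - b * y.1) := by ring
    rw [h2]
    refine Submodule.add_mem_sup (Ideal.mul_mem_left _ _ (Ideal.mem_span_singleton_self _)) ?_
    rw [smul_eq_mul, ← pow_two]
    exact h1
  refine ⟨y.1, le_antisymm ?_ ?_⟩
  · refine Submodule.le_of_le_smul_of_le_jacobson_bot (IsNoetherian.noetherian I) ?_ hle
    rw [hI, ker_eq_maximalIdeal_of_algHom c]
    exact IsLocalRing.maximalIdeal_le_jacobson _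
  · exact (Ideal.span_singleton_le_iff_mem _).mpr y.2

omit [IsLocalRing O] in
/-- The differential of a uniformizer `t` generates the differentials: if `dt = u ω` with `u` in the
maximal ideal, then `t` would lie in the square of the maximal ideal. -/
lemma span_D_eq_top_of_irreducible [IsDomain O] [IsDiscreteValuationRing O] (c : O →ₐ[k] k)
    {ω : Ω[O⁄k]} (hω : Submodule.span O {ω} = ⊤) {t : O} (ht : Irreducible t) :
    Submodule.span O {KaehlerDifferential.D k O t} = ⊤ := by
  have hm := (IsDiscreteValuationRing.irreducible_iff_uniformizer t).mp ht
  rw [← ker_eq_maximalIdeal_of_algHom c] at hm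
  have htm : t ∈ RingHom.ker c := hm ▸ Ideal.mem_span_singleton_self t
  obtain ⟨u, hu⟩ := exists_smul_of_span_eq_top hω (KaehlerDifferential.D k O t)
  have hunit : IsUnit u := by
    by_contra h
    have hum : u ∈ RingHom.ker c := by
      rw [ker_eq_maximalIdeal_of_algHom c]
      exact h
    have h1 := congrArg (cotangentDerivation c).liftKaehlerDifferential hu
    obtain ⟨y, hy⟩ := Ideal.toCotangent_surjective _
      ((cotangentDerivation c).liftKaehlerDifferential ω)
    rw [map_smul, ← hy, Derivation.liftKaehlerDifferential_comp_D,
      cotangentDerivation_of_mem c htm, ← map_smul, eq_comm, Ideal.toCotangent_eq] at h1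
    have h2 : t ∈ RingHom.ker c ^ 2 := by
      have h3 : u * y.1 ∈ RingHom.ker c ^ 2 := by
        rw [pow_two]; exact Ideal.mul_mem_mul hum y.2
      have h4 := add_mem h1 h3
      have h5 : (t - u * y.1) + u * y.1 = t := by ring
      rw [← h5]
      exact h4
    rw [hm, pow_two, Ideal.span_singleton_mul_span_singleton, Ideal.mem_span_singleton] at h2
    obtain ⟨b, hb⟩ := h2
    have h6 : t * (1 - t * b) = 0 := by linear_combination hb
    rcases mul_eq_zero.mp h6 with h7 | h7
    · exact ht.ne_zero h7
    · exact ht.not_isUnit (IsUnit.of_mul_eq_one b (by linear_combination -h7))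
  rw [← hu, Submodule.span_singleton_smul_eq hunit, hω]

end SmoothPoint

/-! ### Differentials of localizations and of function fields -/

section FunctionField

variable {k A O K : Type*} [Field k] [CommRing A] [Algebra k A] [CommRing O] [Algebra k O]
  [Field K] [Algebra k K]

/-- The differentials of a localization are generated by those of the ring. -/
lemma span_map_eq_top_of_isLocalization [Algebra A O] [IsScalarTower k A O] (M : Submonoid A)
    [IsLocalization M O] {ω : Ω[A⁄k]} (hω : Submodule.span A {ω} = ⊤) :
    Submodule.span O {KaehlerDifferential.map k k A O ω} = ⊤ := by
  rw [← Set.image_singleton]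
  exact span_eq_top_of_isLocalizedModule O M (KaehlerDifferential.map k k A O) hω

lemma nontrivial_kaehlerDifferential_of_isLocalization [IsDomain A] [Algebra A K]
    [IsScalarTower k A K] [IsFractionRing A K] [Module.Free A Ω[A⁄k]] [Nontrivial Ω[A⁄k]] :
    Nontrivial Ω[K⁄k] := by
  obtain ⟨ω, hω⟩ := exists_ne (0 : Ω[A⁄k])
  refine ⟨KaehlerDifferential.map k k A K ω, 0, fun h => hω ?_⟩
  rw [← map_zero (KaehlerDifferential.map k k A K),
    IsLocalizedModule.eq_iff_exists (nonZeroDivisors A)] at h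
  obtain ⟨s, hs⟩ := h
  rw [smul_zero] at hs
  exact (smul_eq_zero.mp hs).resolve_left (nonZeroDivisors.ne_zero s.2)

/-- If `dg` generates the differentials of the function field `K`, then `K` is unramified over `k(g)`,
hence a finite extension. -/
lemma finiteDimensional_adjoin_of_span_D_eq_top [Algebra.EssFiniteType k K] {g : K}
    (hg : Submodule.span K {KaehlerDifferential.D k K g} = ⊤) :
    FiniteDimensional (IntermediateField.adjoin k {g}) K := by
  set F := IntermediateField.adjoin k {g}
  have hsub : Subsingleton Ω[K⁄F] := by
    refine subsingleton_of_forall_eq 0 fun η => ?_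
    obtain ⟨η', rfl⟩ := KaehlerDifferential.map_surjective k F K η
    obtain ⟨b, rfl⟩ := Submodule.mem_span_singleton.mp (hg ▸ Submodule.mem_top : η' ∈ _)
    rw [map_smul, KaehlerDifferential.map_D]
    have h1 : algebraMap K K g = algebraMap F K ⟨g, IntermediateField.mem_adjoin_simple_self k g⟩ :=
      rfl
    rw [h1, Derivation.map_algebraMap, smul_zero]
  have : Algebra.FormallyUnramified F K := ⟨hsub⟩
  have : Algebra.EssFiniteType F K := Algebra.EssFiniteType.of_comp k F K
  exact Algebra.FormallyUnramified.finite_of_free F K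

end FunctionField

namespace SmoothCurve

variable (C : SmoothCurve)

/-! ### The local rings of a smooth curve -/

lemma fromSpecStalk_π (x : C.X) : C.X.fromSpecStalk x ≫ C.π
    = Spec.map (CommRingCat.ofHom (algebraMap ℂ (C.X.presheaf.stalk x))) := by
  have h1 : C.π = C.X.toSpecΓ ≫ Spec.map C.π.appTop ≫
      Spec.map (Scheme.ΓSpecIso (CommRingCat.of ℂ)).inv := by
    rw [← Scheme.toSpecΓ_naturality_assoc, ← SpecMap_ΓSpecIso_hom, ← Spec.map_comp,
      Iso.inv_hom_id, Spec.map_id, Category.comp_id]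
  conv_lhs => rw [h1]
  rw [Scheme.fromSpecStalk_toSpecΓ_assoc, ← Spec.map_comp, ← Spec.map_comp]
  rfl

/-- The `ℂ`-algebra structure of the sections over an open set. -/
noncomputable def sectionsRingHom (V : C.X.Opens) : ℂ →+* Γ(C.X, V) :=
  (C.X.presheaf.map (homOfLE (le_top : V ≤ ⊤)).op).hom.comp
    (C.π.appTop.hom.comp (Scheme.ΓSpecIso (CommRingCat.of ℂ)).inv.hom)

lemma germ_sectionsRingHom {V : C.X.Opens} {x : C.X} (hx : x ∈ V) (z : ℂ) :
    C.X.presheaf.germ V x hx (C.sectionsRingHom V z) = algebraMap ℂ (C.X.presheaf.stalk x) z :=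
  TopCat.Presheaf.germ_res_apply C.X.presheaf (homOfLE (le_top : V ≤ ⊤)) x hx _

/-- Every point has an affine neighbourhood whose ring of functions is standard smooth of relative
dimension one over `ℂ`; the open subset of the base may be taken to be all of `Spec ℂ`, a point. -/
lemma exists_affine (x : C.X) : ∃ (V : C.X.Opens) (_ : IsAffineOpen V) (_ : x ∈ V),
    (C.sectionsRingHom V).IsStandardSmoothOfRelativeDimension 1 := by
  obtain ⟨U, hU, V, hV, hxV, e, h⟩ :=
    SmoothOfRelativeDimension.exists_isStandardSmoothOfRelativeDimension (n := 1) (f := C.π) x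
  have hU' : U = ⊤ := by
    rw [eq_top_iff]
    intro y _
    have : y = C.π x := Subsingleton.elim _ _
    exact this ▸ e hxV
  subst hU'
  refine ⟨V, hV, hxV, ?_⟩
  have := h.comp (RingHom.IsStandardSmoothOfRelativeDimension.equiv
    (Scheme.ΓSpecIso (CommRingCat.of ℂ)).symm.commRingCatIsoToRingEquiv)
  exact this

/-- The differentials of a local ring of the curve are generated by one element. -/
lemma exists_span_eq_top (x : C.X) :
    ∃ ω : Ω[C.X.presheaf.stalk x⁄ℂ], Submodule.span (C.X.presheaf.stalk x) {ω} = ⊤ := by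
  obtain ⟨V, hV, hxV, h⟩ := C.exists_affine x
  have : Nonempty V := ⟨⟨x, hxV⟩⟩
  let : Algebra ℂ Γ(C.X, V) := (C.sectionsRingHom V).toAlgebra
  let := TopCat.Presheaf.algebra_section_stalk C.X.presheaf (⟨x, hxV⟩ : V)
  have hst : Algebra.IsStandardSmoothOfRelativeDimension 1 ℂ Γ(C.X, V) := h
  have := hst.isStandardSmooth
  have hrank := hst.rank_kaehlerDifferential
  obtain ⟨ω, -, hω⟩ := finrank_eq_one_iff'.mp (Module.finrank_eq_of_rank_eq hrank)
  replace hω : Submodule.span Γ(C.X, V) {ω} = ⊤ :=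
    eq_top_iff.mpr fun η _ => Submodule.mem_span_singleton.mpr (hω η)
  have : IsScalarTower ℂ Γ(C.X, V) (C.X.presheaf.stalk x) :=
    IsScalarTower.of_algebraMap_eq fun z => (C.germ_sectionsRingHom hxV z).symm
  have := hV.isLocalization_stalk ⟨x, hxV⟩
  exact ⟨_, span_map_eq_top_of_isLocalization (k := ℂ) (hV.primeIdealOf ⟨x, hxV⟩).asIdeal.primeCompl hω⟩

/-- The function field is essentially of finite type over `ℂ` and has nonzero differentials. -/
lemma exists_affine_functionField : Algebra.EssFiniteType ℂ C.K ∧ Nontrivial Ω[C.K⁄ℂ] := by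
  obtain ⟨V, hV, hxV, h⟩ := C.exists_affine (genericPoint C.X)
  have : Nonempty V := ⟨⟨_, hxV⟩⟩
  let : Algebra ℂ Γ(C.X, V) := (C.sectionsRingHom V).toAlgebra
  have hst : Algebra.IsStandardSmoothOfRelativeDimension 1 ℂ Γ(C.X, V) := h
  have := hst.isStandardSmooth
  have hrank := hst.rank_kaehlerDifferential
  have : IsScalarTower ℂ Γ(C.X, V) C.K :=
    IsScalarTower.of_algebraMap_eq fun z => (C.germ_sectionsRingHom hxV z).symm
  have := functionField_isFractionRing_of_isAffineOpen C.X V hV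
  have hnt : Nontrivial Ω[Γ(C.X, V)⁄ℂ] := by
    by_contra hcon
    rw [not_nontrivial_iff_subsingleton] at hcon
    rw [rank_subsingleton'] at hrank
    simp at hrank
  refine ⟨?_, nontrivial_kaehlerDifferential_of_isLocalization (A := Γ(C.X, V))⟩
  have : Algebra.EssFiniteType Γ(C.X, V) C.K :=
    Algebra.EssFiniteType.of_isLocalization _ (nonZeroDivisors Γ(C.X, V))
  exact Algebra.EssFiniteType.comp ℂ Γ(C.X, V) C.K

/-- The residue field at a closed point is `ℂ`, by the Nullstellensatz. -/
lemma residue_surjective (x : C.Point) :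
    Function.Surjective (algebraMap ℂ (IsLocalRing.ResidueField (C.X.presheaf.stalk x.1))) := by
  have h1 : (residueFieldIsoBase C.π x.1 x.2).inv
      = CommRingCat.ofHom (algebraMap ℂ (C.X.presheaf.stalk x.1)) ≫ C.X.residue x.1 := by
    apply Spec.map_injective
    rw [SpecMap_residueFieldIsoBase_inv, Spec.map_comp, ← fromSpecStalk_π, ← Category.assoc]
    rfl
  have h2 : Function.Bijective (residueFieldIsoBase C.π x.1 x.2).inv :=
    ConcreteCategory.bijective_of_isIso _
  rw [h1] at h2
  exact h2.2

/-- The value at `x` of a function that is regular at `x`. -/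
noncomputable def evalAt (x : C.Point) : C.X.presheaf.stalk x.1 →ₐ[ℂ] ℂ :=
  (AlgEquiv.ofBijective (Algebra.ofId ℂ (IsLocalRing.ResidueField (C.X.presheaf.stalk x.1)))
    ⟨(algebraMap ℂ _).injective, C.residue_surjective x⟩).symm.toAlgHom.comp
    (IsScalarTower.toAlgHom ℂ (C.X.presheaf.stalk x.1) _)

lemma sub_evalAt_mem (x : C.Point) (a : C.X.presheaf.stalk x.1) :
    a - algebraMap ℂ _ (C.evalAt x a) ∈ IsLocalRing.maximalIdeal (C.X.presheaf.stalk x.1) := by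
  rw [← ker_eq_maximalIdeal_of_algHom (C.evalAt x), RingHom.mem_ker]
  simp

/-- If the local ring at `x` were a field, it would be both the function field and `ℂ`, which has no
differentials. -/
lemma stalk_not_isField (x : C.Point) : ¬ IsField (C.X.presheaf.stalk x.1) := by
  intro h
  have hK := C.exists_affine_functionField.2
  have hbot := IsLocalRing.isField_iff_maximalIdeal_eq.mp h
  refine not_subsingleton Ω[C.K⁄ℂ] (subsingleton_of_forall_eq 0 fun η => ?_)
  have hη : η ∈ Submodule.span C.K (Set.range (KaehlerDifferential.D ℂ C.K)) := by
    rw [KaehlerDifferential.span_range_derivation]; trivial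
  have hD : Set.range (KaehlerDifferential.D ℂ C.K) ⊆ {0} := by
    rintro _ ⟨f, rfl⟩
    obtain ⟨a, rfl⟩ := (IsFractionRing.surjective_iff_isField.mpr h : Function.Surjective
      (algebraMap (C.X.presheaf.stalk x.1) C.K)) f
    have h1 := C.sub_evalAt_mem x a
    rw [hbot, Ideal.mem_bot, sub_eq_zero] at h1
    rw [h1, ← IsScalarTower.algebraMap_apply]
    exact Derivation.map_algebraMap _ _
  have := Submodule.span_mono (R := C.K) hD hη
  simpa using this

/-- The local rings are regular of dimension one: their maximal ideals are principal since their
differentials are generated by one element. -/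
instance (x : C.Point) : IsDiscreteValuationRing (C.X.presheaf.stalk x.1) := by
  obtain ⟨ω, hω⟩ := C.exists_span_eq_top x.1
  exact ((IsDiscreteValuationRing.TFAE _ (C.stalk_not_isField x)).out 0 4).mpr
    (maximalIdeal_isPrincipal_of_span_eq_top (C.evalAt x) hω)

lemma coheight_eq_one (x : C.Point) : Order.coheight x.1 = 1 := by
  have h := ringKrullDim_stalk_eq_coheight x.1
  rw [IsDiscreteValuationRing.ringKrullDim_eq_one] at h
  exact_mod_cast h.symm

/-! ### Orders of vanishing -/

variable {C}

lemma ord_algebraMap_nonneg (x : C.Point) {a : C.X.presheaf.stalk x.1} (ha : a ≠ 0) :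
    0 ≤ Scheme.ord (algebraMap _ C.K a) x.1 := by
  have h0 : algebraMap _ C.K a ≠ 0 := by
    rwa [Ne, FaithfulSMul.algebraMap_eq_zero_iff]
  rw [Scheme.le_ord_iff (C.coheight_eq_one x) h0]
  exact Ring.ordFrac_ge_one_of_ne_zero ha

lemma ord_algebraMap_of_isUnit (x : C.Point) {a : C.X.presheaf.stalk x.1} (ha : IsUnit a) :
    Scheme.ord (algebraMap _ C.K a) x.1 = 0 := by
  have h0 : algebraMap _ C.K a ≠ 0 := by
    rw [Ne, FaithfulSMul.algebraMap_eq_zero_iff]; exact ha.ne_zero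
  rw [Scheme.ord_eq_iff (C.coheight_eq_one x) h0]
  exact Ring.ordFrac_of_isUnit ha

lemma ord_algebraMap_of_irreducible (x : C.Point) {t : C.X.presheaf.stalk x.1}
    (ht : Irreducible t) : Scheme.ord (algebraMap _ C.K t) x.1 = 1 := by
  have h0 : algebraMap _ C.K t ≠ 0 := by
    rw [Ne, FaithfulSMul.algebraMap_eq_zero_iff]; exact ht.ne_zero
  rw [Scheme.ord_eq_iff (C.coheight_eq_one x) h0]
  exact Ring.ordFrac_irreducible ht

lemma exists_isUnit_of_ord_eq_zero (x : C.Point) {f : C.K} (hf : f ≠ 0)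
    (h : Scheme.ord f x.1 = 0) : ∃ a : C.X.presheaf.stalk x.1, IsUnit a ∧ algebraMap _ C.K a = f := by
  rw [Scheme.ord_eq_iff (C.coheight_eq_one x) hf] at h
  have h1 : f ∈ MonoidHom.mker (Ring.ordFrac (C.X.presheaf.stalk x.1) (K := C.K)) := h
  rw [Ring.mker_ordFrac_eq_isUnitSubmonoid] at h1
  obtain ⟨a, ha, rfl⟩ := h1
  exact ⟨a, ha, rfl⟩

lemma ord_pow (x : C.X) {f : C.K} (hf : f ≠ 0) (n : ℕ) :
    Scheme.ord (f ^ n) x = n * Scheme.ord f x := by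
  induction n with
  | zero =>
    have := Scheme.ord_mul (x := x) (one_ne_zero (α := C.K)) (one_ne_zero (α := C.K))
    rw [mul_one] at this
    simpa using this
  | succ n ih => rw [pow_succ, Scheme.ord_mul (pow_ne_zero n hf) hf, ih]; push_cast; ring

/-- A function of nonnegative order `n` is a unit times the `n`-th power of a uniformizer. -/
lemma exists_eq_mul_pow (x : C.Point) {t : C.X.presheaf.stalk x.1} (ht : Irreducible t) {f : C.K}
    (hf : f ≠ 0) {n : ℕ} (h : Scheme.ord f x.1 = n) :
    ∃ a : C.X.presheaf.stalk x.1, IsUnit a ∧ algebraMap _ C.K (a * t ^ n) = f := by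
  have h0 : algebraMap _ C.K t ≠ 0 := by
    rw [Ne, FaithfulSMul.algebraMap_eq_zero_iff]; exact ht.ne_zero
  have h1 : f = (f / algebraMap _ C.K t ^ n) * algebraMap _ C.K t ^ n :=
    (div_mul_cancel₀ _ (pow_ne_zero n h0)).symm
  have h2 : f / algebraMap _ C.K t ^ n ≠ 0 := div_ne_zero hf (pow_ne_zero n h0)
  have h3 : Scheme.ord (f / algebraMap _ C.K t ^ n) x.1 = 0 := by
    have h4 := Scheme.ord_mul (x := x.1) h2 (pow_ne_zero n h0)
    rw [← h1, h, ord_pow x.1 h0, ord_algebraMap_of_irreducible x ht] at h4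
    linarith
  obtain ⟨a, ha, hfa⟩ := exists_isUnit_of_ord_eq_zero x h2 h3
  exact ⟨a, ha, by rw [map_mul, map_pow, hfa, ← h1]⟩

lemma mem_range_of_ord_nonneg (x : C.Point) {f : C.K} (h : f ≠ 0 → 0 ≤ Scheme.ord f x.1) :
    ∃ a : C.X.presheaf.stalk x.1, algebraMap _ C.K a = f := by
  by_cases hf : f = 0
  · exact ⟨0, by rw [hf, map_zero]⟩
  · obtain ⟨t, ht⟩ := IsDiscreteValuationRing.exists_irreducible (C.X.presheaf.stalk x.1)
    obtain ⟨n, hn⟩ := Int.eq_ofNat_of_zero_le (h hf)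
    obtain ⟨a, -, ha⟩ := exists_eq_mul_pow x ht hf hn
    exact ⟨_, ha⟩

lemma ord_algebraMap_pos (x : C.Point) {a : C.X.presheaf.stalk x.1} (ha : a ≠ 0)
    (ham : a ∈ IsLocalRing.maximalIdeal (C.X.presheaf.stalk x.1)) :
    0 < Scheme.ord (algebraMap _ C.K a) x.1 := by
  refine lt_of_le_of_ne (ord_algebraMap_nonneg x ha) fun h => ?_
  have h0 : algebraMap _ C.K a ≠ 0 := by
    rwa [Ne, FaithfulSMul.algebraMap_eq_zero_iff]
  obtain ⟨b, hb, hab⟩ := exists_isUnit_of_ord_eq_zero x h0 h.symm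
  exact ham (FaithfulSMul.algebraMap_injective _ C.K hab ▸ hb)

variable (C)

/-! ### Finiteness of zeros and poles, separatedness and global functions -/

instance : IsNoetherian C.X where
  toCompactSpace := (quasiCompact_iff_compactSpace C.π).mp inferInstance

/-- A nonempty open subset of a curve contains all but finitely many closed points. -/
lemma finite_notMem_opens (U : C.X.Opens) [hU : Nonempty U] : {x : C.Point | x.1 ∉ U}.Finite := by
  obtain ⟨S, hS, hcl, hirr, hSU⟩ :=
    TopologicalSpace.NoetherianSpace.exists_finite_set_isClosed_irreducible
      (U.isOpen.isClosed_compl)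
  refine Set.Finite.of_finite_image (f := fun x : C.Point => ({x.1} : Set C.X)) (hS.subset ?_) ?_
  · rintro _ ⟨x, hx, rfl⟩
    obtain ⟨T, hT, hxT⟩ : x.1 ∈ ⋃₀ S := hSU ▸ (hx : x.1 ∈ (U : Set C.X)ᶜ)
    have hz := (hirr T hT).isGenericPoint_genericPoint (hcl T hT)
    set z := (hirr T hT).genericPoint with hzdef
    have hzx : z ⤳ x.1 := hz.specializes hxT
    have hzU : z ∉ U := by
      have : z ∈ (U : Set C.X)ᶜ := hSU ▸ ⟨T, hT, hz.mem⟩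
      exact this
    have hηU : genericPoint C.X ∈ U :=
      ((genericPoint_spec C.X).mem_open_set_iff U.isOpen).mpr (by simpa using hU)
    -- otherwise the chain of `x`, `z` and the generic point is too long
    have hxz : z = x.1 := by
      by_contra hne
      have h1 : x.1 < z := ⟨hzx, fun h => hne (hzx.antisymm h).eq⟩
      have h2 : z < genericPoint C.X :=
        ⟨(genericPoint_spec C.X).specializes trivial, fun h => hzU (h.mem_open U.isOpen hηU)⟩
      have h3 := Order.coheight_add_one_le h1
      have h4 := Order.coheight_add_one_le h2
      rw [C.coheight_eq_one x] at h3
      have h5 : (2 : ℕ∞) ≤ 1 := by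
        calc (2 : ℕ∞) = 0 + 1 + 1 := by norm_num
          _ ≤ Order.coheight (genericPoint C.X) + 1 + 1 := by gcongr; exact zero_le
          _ ≤ Order.coheight z + 1 := by gcongr
          _ ≤ 1 := h3
      exact absurd h5 (by norm_num)
    change ({x.1} : Set C.X) ∈ S
    have h6 : ({x.1} : Set C.X) = T := by
      rw [← hz.def, hxz, x.2.closure_eq]
    rwa [h6]
  · intro x _ y _ h
    exact Subtype.ext (Set.singleton_injective h)

end SmoothCurve

namespace SmoothCurve

variable (C : SmoothCurve)

/-- On a separated curve, the local ring of one closed point is not contained in another: two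
morphisms from the spectrum of the larger one would agree at the generic point. -/
lemma exists_ord_nonneg_and_ord_neg {p q : C.Point} (hpq : p ≠ q) :
    ∃ f : C.K, f ≠ 0 ∧ 0 ≤ Scheme.ord f p.1 ∧ Scheme.ord f q.1 < 0 := by
  by_contra hcon
  push Not at hcon
  have hmem : ∀ a : C.X.presheaf.stalk p.1, algebraMap _ C.K a
      ∈ (algebraMap (C.X.presheaf.stalk q.1) C.K).range := by
    intro a
    obtain ⟨b, hb⟩ := mem_range_of_ord_nonneg q (f := algebraMap _ C.K a) fun h0 =>
      hcon _ h0 (ord_algebraMap_nonneg p fun h => h0 (by rw [h, map_zero]))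
    exact ⟨b, hb⟩
  have hinj := FaithfulSMul.algebraMap_injective (C.X.presheaf.stalk q.1) C.K
  let e : C.X.presheaf.stalk q.1 ≃+* (algebraMap (C.X.presheaf.stalk q.1) C.K).range :=
    RingEquiv.ofBijective (algebraMap _ C.K).rangeRestrict
      ⟨fun a b h => hinj (congrArg Subtype.val h), RingHom.rangeRestrict_surjective _⟩
  let φ : C.X.presheaf.stalk p.1 →+* C.X.presheaf.stalk q.1 :=
    e.symm.toRingHom.comp ((algebraMap (C.X.presheaf.stalk p.1) C.K).codRestrict _ hmem)
  have hφ : ∀ a, algebraMap _ C.K (φ a) = algebraMap _ C.K a := fun a =>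
    congrArg Subtype.val (e.apply_symm_apply ⟨algebraMap _ C.K a, hmem a⟩)
  have hsp : ∀ x : C.X, genericPoint C.X ⤳ x := fun x =>
    (genericPoint_spec C.X).specializes trivial
  have hηp : CommRingCat.ofHom φ ≫ C.X.presheaf.stalkSpecializes (hsp q.1)
      = C.X.presheaf.stalkSpecializes (hsp p.1) := by
    ext a
    exact hφ a
  have hdom : IsDominant (Spec.map (C.X.presheaf.stalkSpecializes (hsp q.1))) := by
    refine ⟨(PrimeSpectrum.denseRange_comap_iff_ker_le_nilRadical _).mpr ?_⟩
    exact ((RingHom.injective_iff_ker_eq_bot _).mp hinj).trans_le bot_le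
  have heq : C.X.fromSpecStalk q.1 = Spec.map (CommRingCat.ofHom φ) ≫ C.X.fromSpecStalk p.1 := by
    refine ext_of_isDominant_of_isSeparated C.π ?_
      (Spec.map (C.X.presheaf.stalkSpecializes (hsp q.1))) ?_
    · rw [Category.assoc, fromSpecStalk_π, fromSpecStalk_π, ← Spec.map_comp]
      congr 1
      ext z
      apply hinj
      change _ = algebraMap _ C.K (φ (algebraMap ℂ _ z))
      rw [hφ, ← IsScalarTower.algebraMap_apply]
      exact (IsScalarTower.algebraMap_apply _ _ _ _).symm
    · rw [← Category.assoc, ← Spec.map_comp, hηp, Scheme.SpecMap_stalkSpecializes_fromSpecStalk,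
        Scheme.SpecMap_stalkSpecializes_fromSpecStalk]
  have hq : q.1 ⤳ p.1 := by
    have h1 : q.1 ∈ Set.range (C.X.fromSpecStalk p.1) := by
      refine ⟨Spec.map (CommRingCat.ofHom φ) (IsLocalRing.closedPoint _), ?_⟩
      have h3 := Scheme.fromSpecStalk_closedPoint (X := C.X) (x := q.1)
      rw [heq] at h3
      exact h3
    rw [Scheme.range_fromSpecStalk] at h1
    exact h1
  have h2 := hq.mem_closed q.2 rfl
  exact hpq (Subtype.ext h2)

/-- A rational function that is regular at every closed point is a constant: it glues to a global
function, which is integral over `ℂ` because the curve is proper. -/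
lemma exists_algebraMap_eq (f : C.K) (hf : ∀ p : C.Point, f ≠ 0 → 0 ≤ Scheme.ord f p.1) :
    ∃ z : ℂ, algebraMap ℂ C.K z = f := by
  have h1 : ∀ p : C.Point, ∃ (U : C.X.Opens) (_ : p.1 ∈ U) (s : Γ(C.X, U)),
      ∀ hη : genericPoint C.X ∈ U, C.X.presheaf.germ U _ hη s = f := by
    intro p
    obtain ⟨a, ha⟩ := mem_range_of_ord_nonneg p (hf p)
    obtain ⟨U, hU, s, hs⟩ := C.X.presheaf.exists_germ_eq a
    refine ⟨U, hU, s, fun hη => ?_⟩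
    have : Nonempty U := ⟨⟨_, hU⟩⟩
    rw [← ha, ← hs, Scheme.algebraMap_germ_eq_germToFunctionField]
  choose U hpU s hs using h1
  have hη : ∀ V : C.X.Opens, Nonempty V → genericPoint C.X ∈ V := fun V hV =>
    ((genericPoint_spec C.X).mem_open_set_iff V.isOpen).mpr (by simpa using hV)
  have hcover : (⊤ : C.X.Opens) ≤ iSup U := by
    intro y _
    obtain ⟨x, hx, hxc⟩ := IsClosed.exists_closed_singleton (isClosed_closure (s := {y}))
      ⟨y, subset_closure rfl⟩
    have hyx : y ⤳ x := specializes_iff_mem_closure.mpr hx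
    exact TopologicalSpace.Opens.mem_iSup.mpr
      ⟨⟨x, hxc⟩, hyx.mem_open (U ⟨x, hxc⟩).isOpen (hpU ⟨x, hxc⟩)⟩
  obtain ⟨σ, hσ, -⟩ := C.X.sheaf.existsUnique_gluing' U ⊤ (fun p => homOfLE le_top) hcover s (by
    intro p q
    have hpq : genericPoint C.X ∈ U p ⊓ U q := ⟨hη _ ⟨⟨_, hpU p⟩⟩, hη _ ⟨⟨_, hpU q⟩⟩⟩
    apply germ_injective_of_isIntegral _ (genericPoint C.X) hpq
    erw [TopCat.Presheaf.germ_res_apply, TopCat.Presheaf.germ_res_apply]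
    rw [hs, hs])
  obtain ⟨p⟩ : Nonempty C.Point := by
    obtain ⟨x, -, hx⟩ := IsClosed.exists_closed_singleton (isClosed_univ (X := C.X))
      ⟨genericPoint C.X, trivial⟩
    exact ⟨⟨x, hx⟩⟩
  have hσf : C.X.presheaf.germ ⊤ (genericPoint C.X) trivial σ = f := by
    rw [← hs p (hη _ ⟨⟨_, hpU p⟩⟩), ← hσ p]
    exact (TopCat.Presheaf.germ_res_apply C.X.presheaf (homOfLE le_top) _ _ _).symm
  have hint : (C.π.appTop.hom.comp (Scheme.ΓSpecIso (CommRingCat.of ℂ)).inv.hom).IsIntegral :=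
    RingHom.isIntegral_respectsIso.2 (e := (Scheme.ΓSpecIso _).symm.commRingCatIsoToRingEquiv) _
      (isIntegral_appTop_of_universallyClosed C.π)
  obtain ⟨z, hz⟩ := (IsAlgClosed.ringHom_bijective_of_isIntegral _ hint).2 σ
  refine ⟨z, ?_⟩
  rw [← hσf, ← hz]
  rfl

/-- The closed points of a smooth complete curve, with the orders of vanishing, form a system of
places of the function field. -/
noncomputable def places : PlaceSystem ℂ C.K C.Point where
  v p f := Scheme.ord f p.1
  v_mul' p f g hf hg := Scheme.ord_mul hf hg
  v_add' p f g _ _ h := Scheme.ord_add h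
  v_algebraMap' p z hz := by
    rw [IsScalarTower.algebraMap_apply ℂ (C.X.presheaf.stalk p.1) C.K]
    exact ord_algebraMap_of_isUnit p ((IsUnit.mk0 z hz).map (algebraMap ℂ _))
  exists_uniformizer p := by
    obtain ⟨t, ht⟩ := IsDiscreteValuationRing.exists_irreducible (C.X.presheaf.stalk p.1)
    exact ⟨algebraMap _ C.K t, by rw [Ne, FaithfulSMul.algebraMap_eq_zero_iff]; exact ht.ne_zero,
      ord_algebraMap_of_irreducible p ht⟩
  exists_residue p f hf h := by
    obtain ⟨a, -, rfl⟩ := exists_isUnit_of_ord_eq_zero p hf h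
    refine ⟨C.evalAt p a, fun h0 => ?_⟩
    rw [IsScalarTower.algebraMap_apply ℂ (C.X.presheaf.stalk p.1) C.K, ← map_sub] at h0 ⊢
    exact ord_algebraMap_pos p (fun h => h0 (by rw [h, map_zero])) (C.sub_evalAt_mem p a)
  finite_support f hf := by
    obtain ⟨U, -, f', hU, rfl, hunit⟩ := exists_isUnit_germ_eq C.X f hf
    refine (C.finite_notMem_opens U).subset fun p hp h => hp (Scheme.ord_of_isUnit hunit h)
  separated p q h := C.exists_ord_nonneg_and_ord_neg h
  eq_const f hf := C.exists_algebraMap_eq f hf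

end SmoothCurve

namespace SmoothCurve

open KaehlerDifferential PlaceSystem

variable {C : SmoothCurve}

/-! ### Rational differentials -/

lemma mem_localRing {p : C.Point} {f : C.K} : f ∈ C.localRing p ↔ f ∈ C.places.F p 0 := by
  constructor
  · rintro ⟨a, rfl⟩ h0
    exact ord_algebraMap_nonneg p fun h => h0 (by rw [h, map_zero])
  · intro h
    obtain ⟨a, ha⟩ := mem_range_of_ord_nonneg p h
    exact ⟨a, ha⟩

/-- A function `t` with a simple zero at `p` whose differential generates the regular differentials
at `p` and all the rational differentials. -/
structure IsLocalParameter (p : C.Point) (t : C.K) : Prop where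
  ne_zero : t ≠ 0
  v_eq_one : C.places.v p t = 1
  D_ne_zero : D ℂ C.K t ≠ 0
  exists_D_eq : ∀ a ∈ C.places.F p 0, ∃ b ∈ C.places.F p 0, D ℂ C.K a = b • D ℂ C.K t
  exists_smul_eq : ∀ η : Ω[C.K⁄ℂ], ∃ f : C.K, f • D ℂ C.K t = η

lemma exists_isLocalParameter (p : C.Point) : ∃ t, C.IsLocalParameter p t := by
  obtain ⟨ω, hω⟩ := C.exists_span_eq_top p.1
  obtain ⟨t, ht⟩ := IsDiscreteValuationRing.exists_irreducible (C.X.presheaf.stalk p.1)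
  have hspan := span_D_eq_top_of_irreducible (C.evalAt p) hω ht
  have hK := span_map_eq_top_of_isLocalization (O := C.K)
    (nonZeroDivisors (C.X.presheaf.stalk p.1)) hspan
  rw [map_D] at hK
  have hall : ∀ η : Ω[C.K⁄ℂ], ∃ f : C.K, f • D ℂ C.K (algebraMap _ C.K t) = η := fun η =>
    Submodule.mem_span_singleton.mp (hK ▸ Submodule.mem_top)
  have hnt := C.exists_affine_functionField.2
  refine ⟨algebraMap _ C.K t, ?_, ord_algebraMap_of_irreducible p ht, ?_, ?_, hall⟩
  · rw [Ne, FaithfulSMul.algebraMap_eq_zero_iff]; exact ht.ne_zero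
  · intro h0
    obtain ⟨η, hη⟩ := exists_ne (0 : Ω[C.K⁄ℂ])
    obtain ⟨f, rfl⟩ := hall η
    exact hη (by rw [h0, smul_zero])
  · intro a ha
    obtain ⟨a, rfl⟩ := mem_range_of_ord_nonneg p ha
    obtain ⟨b, hb⟩ := exists_smul_of_span_eq_top hspan (D ℂ _ a)
    refine ⟨algebraMap _ C.K b, fun h0 => ord_algebraMap_nonneg p fun h => h0 (by
      rw [h, map_zero]), ?_⟩
    have h1 := congrArg (KaehlerDifferential.map ℂ ℂ (C.X.presheaf.stalk p.1) C.K) hb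
    rw [map_smul, map_D, map_D] at h1
    rw [← h1, algebraMap_smul]

/-- The differential of a function of order `n + 1` has order `n`. -/
lemma IsLocalParameter.v_of_pos {p : C.Point} {t : C.K} (ht : C.IsLocalParameter p t) {w h : C.K}
    {n : ℕ} (hw : w ≠ 0) (hv : C.places.v p w = n + 1) (h1 : D ℂ C.K w = h • D ℂ C.K t) :
    h ≠ 0 ∧ C.places.v p h = n := by
  have htn := pow_ne_zero (n + 1) ht.ne_zero
  have hwt : w / t ^ (n + 1) ≠ 0 := div_ne_zero hw htn
  have hvt := C.places.v_pow p ht.ne_zero (n + 1)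
  have hvu : C.places.v p (w / t ^ (n + 1)) = 0 := by
    rw [C.places.v_div p hw htn, hvt, ht.v_eq_one, hv]; push_cast; ring
  obtain ⟨b, hb, hDb⟩ := ht.exists_D_eq (w / t ^ (n + 1)) fun _ => hvu.ge
  set u := w / t ^ (n + 1) with hu
  have hwu : w = u * t ^ (n + 1) := (div_mul_cancel₀ _ htn).symm
  have hD : D ℂ C.K w = (u * ((n + 1 : ℕ) : C.K) * t ^ n + t ^ (n + 1) * b) • D ℂ C.K t := by
    rw [hwu, Derivation.leibniz, Derivation.leibniz_pow, hDb, Nat.add_sub_cancel,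
      ← Nat.cast_smul_eq_nsmul C.K]
    simp only [smul_smul, ← add_smul]
    congr 1
    ring
  have hh : h = u * ((n + 1 : ℕ) : C.K) * t ^ n + t ^ (n + 1) * b :=
    smul_left_injective C.K ht.D_ne_zero (h1.symm.trans hD)
  have hn0 : ((n + 1 : ℕ) : ℂ) ≠ 0 := Nat.cast_ne_zero.mpr n.succ_ne_zero
  have hnK : ((n + 1 : ℕ) : C.K) = algebraMap ℂ C.K ((n + 1 : ℕ) : ℂ) := (map_natCast _ _).symm
  have hnK0 : ((n + 1 : ℕ) : C.K) ≠ 0 := by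
    rw [hnK, Ne, FaithfulSMul.algebraMap_eq_zero_iff]; exact hn0
  have htn' := pow_ne_zero n ht.ne_zero
  have h2 : C.places.v p (u * ((n + 1 : ℕ) : C.K) * t ^ n) = n := by
    rw [C.places.v_mul p (mul_ne_zero hwt hnK0) htn', C.places.v_mul p hwt hnK0, hvu,
      C.places.v_pow p ht.ne_zero, ht.v_eq_one, hnK, C.places.v_algebraMap' p _ hn0]
    ring
  have h3 : t ^ (n + 1) * b ∈ C.places.F p (C.places.v p (u * ((n + 1 : ℕ) : C.K) * t ^ n) + 1) :=
    mul_mem_F' (mem_F_v p _) hb (by rw [h2, hvt, ht.v_eq_one]; push_cast; linarith)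
  have h4 := mul_ne_zero (mul_ne_zero hwt hnK0) htn'
  rw [hh]
  exact ⟨add_ne_zero_of_v_lt h4 h3, (v_add_of_lt h4 h3).trans h2⟩

/-- The coefficient of `dg` with respect to the differential of a local parameter has order
`ordD g`. -/
lemma IsLocalParameter.v_eq_ordD {p : C.Point} {t : C.K} (ht : C.IsLocalParameter p t) {g h : C.K}
    (hg : Transcendental ℂ g) (h1 : D ℂ C.K g = h • D ℂ C.K t) :
    h ≠ 0 ∧ C.places.v p h = C.places.ordD g hg p := by
  rw [ordD]
  have he := (C.places.exists_sub_const hg p).choose_spec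
  set c := (C.places.exists_sub_const hg p).choose
  have h0 : g - algebraMap ℂ C.K c ≠ 0 := sub_algebraMap_ne_zero hg c
  have hD : D ℂ C.K (g - algebraMap ℂ C.K c) = h • D ℂ C.K t := by
    rw [map_sub, Derivation.map_algebraMap, sub_zero, h1]
  set w := g - algebraMap ℂ C.K c
  rcases lt_or_gt_of_ne he with hneg | hpos
  · obtain ⟨h', hh'⟩ := ht.exists_smul_eq (D ℂ C.K w⁻¹)
    obtain ⟨n, hn⟩ := Int.eq_ofNat_of_zero_le (show 0 ≤ -C.places.v p w - 1 by omega)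
    have hw := inv_ne_zero h0
    obtain ⟨h2, h3⟩ := ht.v_of_pos (n := n) hw (by rw [C.places.v_inv p h0]; omega) hh'.symm
    have h4 : h = -(w * w * h') := by
      refine smul_left_injective C.K ht.D_ne_zero (hD.symm.trans ?_)
      have h5 := Derivation.leibniz_inv (D ℂ C.K) w⁻¹
      rw [inv_inv, ← hh'] at h5
      rw [h5, smul_smul]
      congr 1
      ring
    have h6 := mul_ne_zero h0 h0
    rw [h4, v_neg, C.places.v_mul p h6 h2, C.places.v_mul p h0 h0, h3]
    exact ⟨neg_ne_zero.mpr (mul_ne_zero h6 h2), by omega⟩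
  · obtain ⟨n, hn⟩ := Int.eq_ofNat_of_zero_le (show 0 ≤ C.places.v p w - 1 by omega)
    obtain ⟨h2, h3⟩ := ht.v_of_pos (n := n) h0 (by omega) hD
    exact ⟨h2, by omega⟩

/-- The functions of order at least `n` at `p`, as a module over the local ring. -/
def orderSubmodule (p : C.Point) (n : ℤ) : Submodule (C.localRing p) C.K where
  carrier := C.places.F p n
  zero_mem' := zero_mem _
  add_mem' := add_mem
  smul_mem' a _ hf := mul_mem_F' (mem_localRing.mp a.2) hf (by simp)

lemma mem_orderSubmodule {p : C.Point} {n : ℤ} {f : C.K} :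
    f ∈ orderSubmodule p n ↔ f ∈ C.places.F p n := Iff.rfl

/-- A set of functions of order at least `n`, one of which has order `n`, generates the functions
of order at least `n`. -/
lemma span_eq_orderSubmodule {p : C.Point} {n : ℤ} {T : Set C.K} (h1 : ∀ f ∈ T, f ∈ C.places.F p n)
    {e : C.K} (heT : e ∈ T) (he0 : e ≠ 0) (he : C.places.v p e = n) :
    Submodule.span (C.localRing p) T = orderSubmodule p n := by
  refine le_antisymm (Submodule.span_le.mpr h1) fun f hf => ?_
  have h2 : f / e ∈ C.localRing p := by
    rw [mem_localRing, div_eq_mul_inv]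
    exact mul_mem_F' hf (mem_F_v p e⁻¹) (by rw [C.places.v_inv p he0, he]; simp)
  have h3 : f = (⟨f / e, h2⟩ : C.localRing p) • e := (div_mul_cancel₀ f he0).symm
  rw [h3]
  exact Submodule.smul_mem _ _ (Submodule.subset_span heT)

/-- The stalk of `𝒪_C(E)` at `p` consists of the functions of order at least `-E p`. -/
lemma stalkO_eq (E : C.Divisor) (p : C.Point) : C.stalkO E p = orderSubmodule p (-E p) := by
  obtain ⟨e, he0, he⟩ := C.places.exists_v_eq p (-E p)
  exact span_eq_orderSubmodule (fun f hf _ => hf.2.ge) ⟨he0, he⟩ he0 he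

/-- The map `f ↦ f η` into the rational differentials, linear over the local ring at `p`. -/
noncomputable def smulD (p : C.Point) (η : Ω[C.K⁄ℂ]) : C.K →ₗ[C.localRing p] Ω[C.K⁄ℂ] :=
  (LinearMap.toSpanSingleton C.K _ η).restrictScalars (C.localRing p)

@[simp] lemma smulD_apply (p : C.Point) (η : Ω[C.K⁄ℂ]) (f : C.K) : smulD p η f = f • η := rfl

lemma IsLocalParameter.stalkω_eq {p : C.Point} {t : C.K} (ht : C.IsLocalParameter p t)
    (E : C.Divisor) : C.stalkω E p = (orderSubmodule p (-E p)).map (smulD p (D ℂ C.K t)) := by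
  apply le_antisymm
  · refine Submodule.span_le.mpr ?_
    rintro _ ⟨f, a, ha, hf0, hf, rfl⟩
    obtain ⟨b, hb, hab⟩ := ht.exists_D_eq a (mem_localRing.mp ha)
    refine ⟨f * b, mul_mem_F' (fun _ => hf.ge) hb (by simp), ?_⟩
    rw [smulD_apply, hab, smul_smul]
  · rw [← stalkO_eq, stalkO, Submodule.map_span, Submodule.span_le]
    rintro _ ⟨f, ⟨hf0, hf⟩, rfl⟩
    refine Submodule.subset_span ⟨f, t, mem_localRing.mpr fun _ => ?_, hf0, hf, rfl⟩
    rw [ht.v_eq_one]; norm_num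

variable (C)

lemma nonempty_point : Nonempty C.Point := by
  obtain ⟨x, -, hx⟩ := IsClosed.exists_closed_singleton (isClosed_univ (X := C.X))
    ⟨genericPoint C.X, trivial⟩
  exact ⟨⟨x, hx⟩⟩

/-- A function that generates the function field up to a finite extension, and whose differential
generates the rational differentials. -/
lemma exists_transcendental : ∃ g : C.K, Transcendental ℂ g ∧ D ℂ C.K g ≠ 0 ∧
    FiniteDimensional (IntermediateField.adjoin ℂ {g}) C.K ∧
    ∀ η : Ω[C.K⁄ℂ], ∃ f : C.K, f • D ℂ C.K g = η := by
  obtain ⟨p⟩ := C.nonempty_point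
  obtain ⟨t, ht⟩ := C.exists_isLocalParameter p
  have := C.exists_affine_functionField.1
  refine ⟨t, fun halg => ?_, ht.D_ne_zero, finiteDimensional_adjoin_of_span_D_eq_top
    (eq_top_iff.mpr fun η _ => Submodule.mem_span_singleton.mpr (ht.exists_smul_eq η)),
    ht.exists_smul_eq⟩
  obtain ⟨z, rfl⟩ := minpoly.mem_range_of_degree_eq_one ℂ t
    (IsAlgClosed.degree_eq_one_of_irreducible ℂ (minpoly.irreducible halg.isIntegral))
  exact ht.D_ne_zero (Derivation.map_algebraMap _ z)

variable {C}

section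

variable {g : C.K} (hg : Transcendental ℂ g)

/-- The stalk of `ω_C(E)` at `p` consists of the `f dg` with `f` of order at least `-E p - ord_p dg`. -/
lemma stalkω_eq_map_smulD (E : C.Divisor)
    (p : C.Point) : C.stalkω E p
      = (orderSubmodule p (-E p - C.places.ordD g hg p)).map (smulD p (D ℂ C.K g)) := by
  obtain ⟨t, ht⟩ := C.exists_isLocalParameter p
  obtain ⟨h, hh⟩ := ht.exists_smul_eq (D ℂ C.K g)
  obtain ⟨h0, hv⟩ := ht.v_eq_ordD hg hh.symm
  rw [ht.stalkω_eq]
  apply le_antisymm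
  · rintro _ ⟨f, hf, rfl⟩
    refine ⟨f * h⁻¹, mul_mem_F' hf (mem_F_v p h⁻¹) (by rw [C.places.v_inv p h0, hv]; rfl), ?_⟩
    rw [smulD_apply, ← hh, smul_smul, inv_mul_cancel_right₀ h0]
    rfl
  · rintro _ ⟨f, hf, rfl⟩
    refine ⟨f * h, mul_mem_F' hf (mem_F_v p h) (by rw [hv]; simp), ?_⟩
    rw [smulD_apply, smulD_apply, ← hh, smul_smul]

end

end SmoothCurve

namespace SmoothCurve

open KaehlerDifferential PlaceSystem

variable {C : SmoothCurve}

/-! ### Cohomology, canonical divisors and base loci -/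

lemma H0_eq (E : C.Divisor) : C.H0 E = C.places.L E := by
  ext f
  simp only [H0, Submodule.mem_iInf, stalkO_eq, Submodule.restrictScalars_mem, mem_orderSubmodule,
    mem_L]

lemma repartitions_eq : C.repartitions = Subalgebra.toSubmodule C.places.adele := by
  ext a
  change {x | a x ∉ C.localRing x}.Finite ↔ {x | a x ∉ C.places.F x 0}.Finite
  simp only [mem_localRing]

/-- Répartitions are adeles, so both definitions of `H¹` agree. -/
lemma h1_eq (E : C.Divisor) : C.h1 E = Module.finrank ℂ (C.places.H1 E) := by
  let e : C.repartitions ≃ₗ[ℂ] C.places.adele :=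
    LinearEquiv.ofEq _ (Subalgebra.toSubmodule C.places.adele) repartitions_eq
  refine (Submodule.Quotient.equiv _ _ e ?_).finrank_eq
  rw [Submodule.map_sup]
  congr 1
  · ext b
    constructor
    · rintro ⟨a, ha, rfl⟩ p
      exact (stalkO_eq E p).le (ha p trivial)
    · intro hb
      exact ⟨e.symm b, fun p _ => (stalkO_eq E p).ge (hb p), e.apply_symm_apply b⟩
  · ext b
    constructor
    · rintro ⟨a, ⟨f, hf⟩, rfl⟩
      exact ⟨f, Subtype.ext hf⟩
    · rintro ⟨f, rfl⟩
      exact ⟨e.symm (C.places.diag f), ⟨f, rfl⟩, e.apply_symm_apply _⟩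

lemma degree_eq (E : C.Divisor) : degree E = Finsupp.degree E := by
  rw [Finsupp.degree_apply]
  rfl

section

variable {g : C.K} (hg : Transcendental ℂ g) (hD : D ℂ C.K g ≠ 0)
  [FiniteDimensional (IntermediateField.adjoin ℂ {g}) C.K]
  (hall : ∀ η : Ω[C.K⁄ℂ], ∃ f : C.K, f • D ℂ C.K g = η)

include hD hall in
/-- A set of differentials `f dg` generates `ω_C(-E)` if and only if at every point the least order
of these differentials is the coefficient of `E`; the order of `f dg` is the sum of those of `f` and
`dg`. -/
lemma generates_iff (T : Set Ω[C.K⁄ℂ]) (E : C.Divisor) : C.Generates T E ↔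
    ∀ p, (∀ f : C.K, f • D ℂ C.K g ∈ T → f ∈ C.places.F p (E p - canon hg C.places p)) ∧
      ∃ f : C.K, f ≠ 0 ∧ f • D ℂ C.K g ∈ T ∧ C.places.v p f = E p - canon hg C.places p := by
  refine forall_congr' fun p => ?_
  set U : Set C.K := {f | f • D ℂ C.K g ∈ T} with hU
  have hinj : Function.Injective (smulD p (D ℂ C.K g)) := smul_left_injective C.K hD
  have hTU : T = smulD p (D ℂ C.K g) '' U := by
    ext η
    constructor
    · intro hη
      obtain ⟨f, rfl⟩ := hall η
      exact ⟨f, hη, rfl⟩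
    · rintro ⟨f, hf, rfl⟩
      exact hf
  have hiff : Submodule.span (C.localRing p) T = C.stalkω (-E) p ↔
      Submodule.span (C.localRing p) U = orderSubmodule p (E p - canon hg C.places p) := by
    rw [stalkω_eq_map_smulD hg]
    conv_lhs => rw [hTU, ← Submodule.map_span]
    rw [(Submodule.map_injective_of_injective hinj).eq_iff, Finsupp.neg_apply, neg_neg]
    rfl
  rw [hiff]
  constructor
  · intro h
    have h1 : ∀ f ∈ U, f ∈ C.places.F p (E p - canon hg C.places p) := fun f hf =>
      h.le (Submodule.subset_span hf)
    refine ⟨h1, ?_⟩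
    by_contra hcon
    push Not at hcon
    obtain ⟨e, he0, he⟩ := C.places.exists_v_eq p (E p - canon hg C.places p)
    have h2 : Submodule.span (C.localRing p) U
        ≤ orderSubmodule p (E p - canon hg C.places p + 1) :=
      Submodule.span_le.mpr fun f hf hf0 =>
        Int.add_one_le_of_lt (lt_of_le_of_ne (h1 f hf hf0) (Ne.symm (hcon f hf0 hf)))
    have h3 : e ∈ orderSubmodule p (E p - canon hg C.places p) := fun _ => he.ge
    rw [← h] at h3
    exact notMem_F_of_v he0 (by omega) (h2 h3)
  · rintro ⟨h1, e, he0, heU, he⟩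
    exact span_eq_orderSubmodule h1 heU he0 he

/-- The map `f ↦ f dg`, which identifies rational functions and rational differentials if `dg` is not
zero. -/
noncomputable def smulDg (g : C.K) : C.K →ₗ[ℂ] Ω[C.K⁄ℂ] :=
  (LinearMap.toSpanSingleton C.K _ (D ℂ C.K g)).restrictScalars ℂ

omit [FiniteDimensional (IntermediateField.adjoin ℂ {g}) C.K] in
include hD in
lemma smulDg_injective : Function.Injective (smulDg g) := smul_left_injective C.K hD

include hD hall in
/-- Regular differentials are the `f dg` with `f` in the Riemann–Roch space of the divisor of `dg`. -/
lemma H0ω_eq : C.H0ω = (C.places.L (canon hg C.places)).map (smulDg g) := by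
  have key : ∀ f : C.K, f • D ℂ C.K g ∈ C.H0ω ↔ f ∈ C.places.L (canon hg C.places) := by
    intro f
    rw [H0ω, Submodule.mem_iInf, mem_L]
    refine forall_congr' fun p => ?_
    rw [Submodule.restrictScalars_mem, stalkω_eq_map_smulD hg, Finsupp.zero_apply, neg_zero,
      zero_sub]
    exact (smul_left_injective C.K hD).mem_set_image (s := orderSubmodule p _)
  ext η
  obtain ⟨f, rfl⟩ := hall η
  rw [key]
  exact (smulDg_injective hD).mem_set_image.symm

include hD hall in
lemma genus_eq : C.genus = Module.finrank ℂ (C.places.L (canon hg C.places)) := by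
  rw [genus, H0ω_eq hg hD hall]
  exact (Submodule.equivMapOfInjective _ (smulDg_injective hD) _).finrank_eq.symm

include hD hall in
lemma isCanonicalDivisor_canon : C.IsCanonicalDivisor (canon hg C.places) := by
  refine ⟨_, hD, (generates_iff hg hD hall _ _).mpr fun p => ⟨fun f hf => ?_, 1, one_ne_zero, ?_, ?_⟩⟩
  · have : f = 1 := smul_left_injective C.K hD (by simpa using hf)
    rw [this, sub_self]
    exact one_mem_F p
  · simp
  · simp

include hg hD hall in
lemma degree_of_isCanonicalDivisor {E : C.Divisor} (hE : C.IsCanonicalDivisor E) :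
    degree E = 2 * (C.genus : ℤ) - 2 := by
  obtain ⟨η, hη, hgen⟩ := hE
  obtain ⟨f, rfl⟩ := hall η
  have hf : f ≠ 0 := by rintro rfl; exact hη (zero_smul _ _)
  have hEf : E = C.places.div f hf + canon hg C.places := by
    ext p
    obtain ⟨f', -, hf', hv⟩ := ((generates_iff hg hD hall _ _).mp hgen p).2
    have : f' = f := smul_left_injective C.K hD hf'
    rw [Finsupp.add_apply, div_apply, ← this, hv]
    ring
  rw [degree_eq, hEf, map_add, degree_div hg, zero_add, degree_canon, genus_eq hg hD hall]

include hg hD hall in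
/-- The base locus of a nonzero linear system exists: its coefficient at a point is the least order
of the differentials of the system. -/
lemma exists_isBaseLocus (W : Submodule ℂ C.H0ω) (hW : W ≠ ⊥) : ∃ E, IsBaseLocus W E := by
  set T : Set Ω[C.K⁄ℂ] := (↑) '' (W : Set C.H0ω) with hT
  have hreg : ∀ f : C.K, f • D ℂ C.K g ∈ T → f ∈ C.places.L (canon hg C.places) := by
    rintro f ⟨ω, -, hω⟩
    have h1 : f • D ℂ C.K g ∈ C.H0ω := hω ▸ ω.2
    rw [H0ω_eq hg hD hall] at h1
    exact (smulDg_injective hD).mem_set_image.mp h1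
  obtain ⟨ω, hωW, hω0⟩ := Submodule.exists_mem_ne_zero_of_ne_bot hW
  obtain ⟨f₀, hf₀⟩ := hall ω
  have hf₀T : f₀ • D ℂ C.K g ∈ T := ⟨ω, hωW, hf₀.symm⟩
  have hf₀0 : f₀ ≠ 0 := by
    rintro rfl
    rw [zero_smul] at hf₀
    exact hω0 (Subtype.ext hf₀.symm)
  have hleast : ∀ p, ∃ n : ℤ, (∃ f : C.K, f ≠ 0 ∧ f • D ℂ C.K g ∈ T ∧ C.places.v p f = n) ∧
      ∀ m : ℤ, (∃ f : C.K, f ≠ 0 ∧ f • D ℂ C.K g ∈ T ∧ C.places.v p f = m) → n ≤ m := by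
    intro p
    refine Int.exists_least_of_bdd ⟨-canon hg C.places p, ?_⟩ ⟨_, f₀, hf₀0, hf₀T, rfl⟩
    rintro _ ⟨f, hf0, hfT, rfl⟩
    exact hreg f hfT p hf0
  choose n hn1 hn2 using hleast
  have hfin : (Function.support fun p => n p + canon hg C.places p).Finite := by
    refine (C.places.div f₀ hf₀0 + canon hg C.places).support.finite_toSet.subset fun p hp => ?_
    rw [Finset.mem_coe, Finsupp.mem_support_iff, Finsupp.add_apply, div_apply]
    obtain ⟨f, hf0, hfT, hf⟩ := hn1 p
    have h1 : -canon hg C.places p ≤ n p := hf ▸ hreg f hfT p hf0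
    have h2 := hn2 p _ ⟨f₀, hf₀0, hf₀T, rfl⟩
    have h3 : n p + canon hg C.places p ≠ 0 := hp
    omega
  refine ⟨Finsupp.ofSupportFinite _ hfin, (generates_iff hg hD hall _ _).mpr fun p => ?_⟩
  have hval : Finsupp.ofSupportFinite _ hfin p - canon hg C.places p = n p :=
    add_sub_cancel_right _ _
  rw [hval]
  exact ⟨fun f hf hf0 => hn2 p _ ⟨f, hf0, hf, rfl⟩, hn1 p⟩

include hD hall in
/-- A linear system with base locus `E` consists of sections of `ω_C(-E)`. -/
lemma finrank_le_of_isBaseLocus {W : Submodule ℂ C.H0ω} {E : C.Divisor} (hE : IsBaseLocus W E) :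
    Module.finrank ℂ W ≤ C.h0 (canon hg C.places - E) := by
  rw [h0, H0_eq]
  have := (riemannRoch_aux (S := C.places) hg (canon hg C.places - E)).1
  rw [← (W.equivMapOfInjective C.H0ω.subtype C.H0ω.subtype_injective).finrank_eq.symm]
  rw [((C.places.L ⇑(canon hg C.places - E)).equivMapOfInjective (smulDg g)
    (smulDg_injective hD)).finrank_eq]
  refine Submodule.finrank_mono ?_
  rintro _ ⟨ω, hω, rfl⟩
  obtain ⟨f, hf⟩ := hall ω
  refine ⟨f, fun p => ?_, hf⟩
  have h1 := ((generates_iff hg hD hall _ _).mp hE p).1 f ⟨ω, hω, hf.symm⟩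
  rw [Finsupp.sub_apply, neg_sub]
  exact h1

end

variable (C)

/-- The facts about divisors on a curve that bound the degrees of linear systems: the theorem of
Riemann–Roch, the inequality behind Clifford's theorem, and the existence of canonical divisors and
of base loci. -/
lemma riemannRoch_clifford : ∃ κ : C.Divisor, C.IsCanonicalDivisor κ ∧
    (∀ E : C.Divisor, C.IsCanonicalDivisor E → degree E = 2 * (C.genus : ℤ) - 2) ∧
    (∀ E : C.Divisor, (C.h0 E : ℤ) - C.h1 E = degree E + 1 - C.genus) ∧
    (∀ E : C.Divisor, 1 ≤ C.h0 E → 1 ≤ C.h1 E → C.h0 E + C.h1 E ≤ C.genus + 1) ∧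
    (∀ W : Submodule ℂ C.H0ω, W ≠ ⊥ → ∃ E, IsBaseLocus W E) ∧
    (∀ (W : Submodule ℂ C.H0ω) (E : C.Divisor), IsBaseLocus W E →
      Module.finrank ℂ W ≤ C.h0 (κ - E)) := by
  obtain ⟨g, hg, hD, hfin, hall⟩ := C.exists_transcendental
  obtain ⟨p⟩ := C.nonempty_point
  have hh1 : ∀ E : C.Divisor,
      C.h1 E = Module.finrank ℂ (C.places.L ⇑(canon hg C.places - E)) := fun E => by
    rw [h1_eq, finrank_H1 hg]
  have hh0 : ∀ E : C.Divisor, C.h0 E = Module.finrank ℂ (C.places.L E) := fun E => by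
    rw [h0, H0_eq]
  have hL : ∀ E : C.Divisor, FiniteDimensional ℂ (C.places.L E) := fun E =>
    (riemannRoch_aux (S := C.places) hg E).1
  refine ⟨canon hg C.places, isCanonicalDivisor_canon hg hD hall,
    fun E hE => degree_of_isCanonicalDivisor hg hD hall hE, fun E => ?_, fun E h h' => ?_,
    fun W hW => exists_isBaseLocus hg hD hall W hW,
    fun W E hE => finrank_le_of_isBaseLocus hg hD hall hE⟩
  · rw [hh0, hh1, degree_eq, genus_eq hg hD hall]
    exact riemannRoch hg E
  · rw [hh0] at h ⊢
    rw [hh1] at h' ⊢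
    have e : (⇑E : C.Point → ℤ) + ⇑(canon hg C.places - E) = canon hg C.places := by
      rw [← Finsupp.coe_add, add_sub_cancel]
    have := hL E
    have := hL (canon hg C.places - E)
    have : FiniteDimensional ℂ (C.places.L (⇑E + ⇑(canon hg C.places - E))) := by
      rw [e]; exact hL _
    have key := finrank_L_add_finrank_L_le (S := C.places) p ⇑E ⇑(canon hg C.places - E) h h'
    rw [e] at key
    rwa [genus_eq hg hD hall]

variable {C}

/-! ### The Clifford index -/

/-- Clifford's inequality, for divisors that contribute to the Clifford index. -/
lemma degree_ge_of_two_le {E : C.Divisor} (h0 : 2 ≤ C.h0 E) (h1 : 2 ≤ C.h1 E) :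
    0 ≤ degree E - 2 * ((C.h0 E : ℤ) - 1) := by
  obtain ⟨κ, -, -, hRR, hcl, -⟩ := C.riemannRoch_clifford
  have h2 := hRR E
  have h3 := hcl E (by omega) (by omega)
  omega

lemma cliffordIndex_nonneg : 0 ≤ C.cliffordIndex := by
  rw [cliffordIndex]
  split_ifs
  · set s := {c : ℤ | ∃ D : C.Divisor, 2 ≤ C.h0 D ∧ 2 ≤ C.h1 D ∧
      c = degree D - 2 * ((C.h0 D : ℤ) - 1)} with hs
    rcases s.eq_empty_or_nonempty with h | h
    · rw [h, Int.csInf_empty]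
    · obtain ⟨D, h0, h1, hc⟩ := Int.csInf_mem h
        ⟨0, by rintro _ ⟨D, h0, h1, rfl⟩; exact degree_ge_of_two_le h0 h1⟩
      rw [hc]
      exact degree_ge_of_two_le h0 h1
  · norm_num
  · exact le_rfl

lemma cliffordIndex_le (hC : ¬ C.IsHyperelliptic) {E : C.Divisor} (h0 : 2 ≤ C.h0 E)
    (h1 : 2 ≤ C.h1 E) : C.cliffordIndex ≤ degree E - 2 * ((C.h0 E : ℤ) - 1) := by
  rw [cliffordIndex]
  split_ifs with hg hg3
  · exact csInf_le ⟨0, by rintro _ ⟨D, h0, h1, rfl⟩; exact degree_ge_of_two_le h0 h1⟩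
      ⟨E, h0, h1, rfl⟩
  · -- in genus three, a divisor with `h⁰, h¹ ≥ 2` is a `g¹₂`
    obtain ⟨κ, -, -, hRR, hcl, -⟩ := C.riemannRoch_clifford
    have h2 := hRR E
    have h3 := hcl E (by omega) (by omega)
    exact absurd ⟨by omega, E, by omega, h0⟩ hC
  · exact degree_ge_of_two_le h0 h1

variable (C) in
lemma isCanonicalDivisor_canonicalDivisor : C.IsCanonicalDivisor C.canonicalDivisor := by
  obtain ⟨κ, hκ, -⟩ := C.riemannRoch_clifford
  have h : ∃ D, C.IsCanonicalDivisor D := ⟨κ, hκ⟩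
  rw [canonicalDivisor, dif_pos h]
  exact h.choose_spec

variable (C) in
lemma degree_canonicalDivisor : degree C.canonicalDivisor = 2 * (C.genus : ℤ) - 2 := by
  obtain ⟨κ, -, hdeg, -⟩ := C.riemannRoch_clifford
  exact hdeg _ C.isCanonicalDivisor_canonicalDivisor

lemma isBaseLocus_baseLocus {W : Submodule ℂ C.H0ω} (hW : W ≠ ⊥) :
    IsBaseLocus W (baseLocus W) := by
  obtain ⟨κ, -, -, -, -, hbase, -⟩ := C.riemannRoch_clifford
  have h := hbase W hW
  rw [baseLocus, dif_pos h]
  exact h.choose_spec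

/-- The two lower bounds for the degree of a linear system `|W|`: with `E = K - D_W`, the first one
holds if `h¹(E) ≥ 2` by the definition of the Clifford index, and the second one holds otherwise by
the theorem of Riemann–Roch. -/
lemma degSystem_ge (hC : ¬ C.IsHyperelliptic) (W : Submodule ℂ C.H0ω)
    (hW : 2 ≤ Module.finrank ℂ W) :
    2 * dimSystem W + C.cliffordIndex ≤ degSystem W ∨
      dimSystem W + C.genus - 1 ≤ degSystem W := by
  have hne : W ≠ ⊥ := by
    rintro rfl
    rw [finrank_bot] at hW
    omega
  obtain ⟨κ, hκ, hdeg, hRR, -, -, hle⟩ := C.riemannRoch_clifford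
  set E := κ - baseLocus W with hE
  have hd : degree E = degSystem W := by
    rw [degSystem, degree_canonicalDivisor, ← hdeg κ hκ, degree_eq, degree_eq, degree_eq, hE,
      map_sub]
  have h1 := hle W _ (isBaseLocus_baseLocus hne)
  rw [← hE] at h1
  have h2 := hRR E
  rw [dimSystem]
  by_cases h : 2 ≤ C.h1 E
  · left
    have h3 := cliffordIndex_le hC (by omega) h
    omega
  · right
    omega

end SmoothCurve

theorem theorem2 (C : SmoothCurve) (hC : ¬ C.IsHyperelliptic)
    (V : Submodule ℂ C.H0ω) (k : ℕ) (hk : Module.finrank ℂ (C.H0ω ⧸ V) = k)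
    (hkg : k + 2 ≤ C.genus) (m : ℤ) (hm : m = min (k : ℤ) C.cliffordIndex) :
    C.IsCanonicalDivisor C.canonicalDivisor ∧
    (∀ W : Submodule ℂ C.H0ω, W ≤ V → 2 ≤ Module.finrank ℂ W →
      SmoothCurve.IsBaseLocus W (SmoothCurve.baseLocus W) ∧
      (SmoothCurve.degSystem W : ℝ) / (SmoothCurve.dimSystem W : ℝ)
        ≥ (2 * (C.genus : ℝ) - 2 - (m : ℝ)) / ((C.genus : ℝ) - (m : ℝ) - 1)) ∧
    ((k : ℤ) ≤ C.cliffordIndex →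
      SmoothCurve.degSystem V ≥ 2 * (C.genus : ℤ) - 2 - (k : ℤ) ∧
      SmoothCurve.degree (SmoothCurve.baseLocus V) ≤ (k : ℤ)) := by
  have hfin : FiniteDimensional ℂ C.H0ω :=
    FiniteDimensional.of_finrank_pos (show 0 < C.genus by omega)
  have hV : k + Module.finrank ℂ V = C.genus := by
    rw [← hk]; exact V.finrank_quotient_add_finrank
  have hc := SmoothCurve.cliffordIndex_nonneg (C := C)
  refine ⟨C.isCanonicalDivisor_canonicalDivisor, fun W hWV hW => ⟨?_, ?_⟩, fun hkc => ?_⟩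
  · refine SmoothCurve.isBaseLocus_baseLocus ?_
    rintro rfl
    rw [finrank_bot] at hW
    omega
  · have hWV' := Submodule.finrank_mono hWV
    have hr : SmoothCurve.dimSystem W = (Module.finrank ℂ W : ℤ) - 1 := rfl
    have hge := SmoothCurve.degSystem_ge hC W hW
    set d := SmoothCurve.degSystem W
    set r := SmoothCurve.dimSystem W
    have hm0 : 0 ≤ m := by omega
    have hmc : m ≤ C.cliffordIndex := by omega
    have hr0 : 0 < r := by omega
    have hrm : 0 ≤ C.genus - m - 1 - r := by omega
    have hpos : 0 < (C.genus : ℤ) - m - 1 := by omega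
    -- the difference of the two sides is at least `m (g - 1 - m - r)` and `(g - 1) (g - 1 - m - r)`,
    -- respectively, and `r ≤ g - 1 - k ≤ g - 1 - m`
    have key : (2 * (C.genus : ℤ) - 2 - m) * r ≤ d * (C.genus - m - 1) := by
      rcases hge with h | h
      · have h1 : (2 * r + m) * (C.genus - m - 1) ≤ d * (C.genus - m - 1) :=
          mul_le_mul_of_nonneg_right (by omega) hpos.le
        linarith [mul_nonneg hm0 hrm]
      · have h1 : (r + C.genus - 1) * (C.genus - m - 1) ≤ d * (C.genus - m - 1) :=
          mul_le_mul_of_nonneg_right h hpos.le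
        linarith [mul_nonneg (show 0 ≤ (C.genus : ℤ) - 1 by omega) hrm]
    rw [ge_iff_le, div_le_div_iff₀ (by exact_mod_cast hpos) (by exact_mod_cast hr0)]
    exact_mod_cast key
  · have hge := SmoothCurve.degSystem_ge hC V (by omega)
    rw [SmoothCurve.dimSystem] at hge
    have hd : SmoothCurve.degSystem V ≥ 2 * (C.genus : ℤ) - 2 - (k : ℤ) := by
      rcases hge with h | h <;> omega
    refine ⟨hd, ?_⟩
    rw [SmoothCurve.degSystem, C.degree_canonicalDivisor] at hd
    omega
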